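/- Let $d\ge 1$ and let $\gamma:\mathbb R\to\mathbb{RP}^d$ be a curve with monodromy ($\gamma(x+2\pi)=M\gamma(x)$ for some $M\in \mathrm{PGL}(d+1,\mathbb R)$) that has a smooth lift $\Gamma:\mathbb R\to\mathbb R^{d+1}$ with $\det(\Gamma,\Gamma',\dots,\Gamma^{(d)})\equiv 1$ (a *normalized lift*). Then $\Gamma$ satisfies $L\Gamma=0$ for an operator $L=\partial^{d+1}+u_{d-1}\partial^{d-1}+\dots+u_0$ with smooth $2\pi$-periodic coefficients. Let $U$ be the $(d+1)\times(d+1)$ matrix with ones directly above the diagonal, last row $(-u_0,\dots,-u_{d-1},0)$ and zeros elsewhere. Put $Q_2=\partial^2+\frac{2}{d+1}u_{d-1}$ and, for a constant $c$, let $V$ be the (smooth) matrix function with $V(\Gamma,\Gamma',\dots,\Gamma^{(d)})^\top=c\,(Q_2\Gamma,(Q_2\Gamma)',\dots,(Q_2\Gamma)^{(d)})^\top$. *Pentagram map.* For a polygon $(v_j)_{j\in\mathbb Z}$ in $\mathbb{RP}^d$ let $P_i$ be the span of the $d$ vertices $v_{i-(d-1)},v_{i-(d-3)},\dots,v_{i+(d-1)}$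 and let $T(v_i)=\bigcap_{k=0}^{d-1}P_{i-\lfloor (d-1)/2\rfloor+k}$ (defined when these $P$'s are hyperplanes and meet in exactly one point). For $\epsilon>0$ let $T_\epsilon(\gamma)(x)$ be $T(v_0)$ for the polygon $v_j=\gamma(x+j\epsilon)$, and let $\tilde\gamma_\epsilon(x)=T_\epsilon(\gamma)(x)$ for $d$ odd, $\tilde\gamma_\epsilon(x)=T_\epsilon(\gamma)(x-\epsilon/2)$ for $d$ even. Let $\tilde\Gamma_\epsilon$ be a normalized lift of $\tilde\gamma_\epsilon$ (for $d$ odd, with the sign chosen so that $\tilde\Gamma_\epsilon\to\Gamma$ pointwise as $\epsilon\to0^+$). *Matrices.* For a curve $G$ in $\mathbb R^{d+1}$ let $\tilde a_k$ be defined by $G(x+(d+1)\epsilon)=\sum_{k=0}^d\tilde a_kG(x+k\epsilon)$, and let its discrete Lax matrix at $x$ (spectral parameter $z=1$) be the matrix with ones directly above the diagonal, last row $(\tilde a_0,\dots,\tilde a_d)$ and zeros elsewhere. Let $\tilde L_{0,0}$ and $\tilde L_{0,1}$ be the Lax matrices at $x$ of $\Gamma$ and $\tilde\Gamma_\epsilon$.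 Let $\tilde P_{i,0}$ be the matrix with $\tilde P_{i,0}\,(\Gamma(x+(i+k)\epsilon))_{k=0}^{d}=(\tilde\Gamma_\epsilon(x+(i+k)\epsilon))_{k=0}^{d}$. Let $D_\epsilon$ be the matrix taking $(\Gamma(x+k\epsilon))_{k=0}^d$ to $(\Delta_\epsilon^k\Gamma(x)/\epsilon^k)_{k=0}^d$, $\Delta_\epsilon f(x)=f(x+\epsilon)-f(x)$, i.e. $(D_\epsilon)_{ki}=(-1)^{k-i}\binom ki\epsilon^{-k}$. **Theorem.** There is a nonzero constant $c$ depending only on $d$ such that for every $\gamma,\Gamma$ as above the following hold, where all expansions are for fixed $x$ as $\epsilon\to0^+$. 1. For all sufficiently small $\epsilon>0$ and all $x$, the vectors $\Gamma(x),\dots,\Gamma(x+d\epsilon)$ are linearly independent, and $$D_\epsilon\tilde L_{0,0}D_\epsilon^{-1}=I+\epsilon U+O(\epsilon^2).$$ 2. For all sufficiently small $\epsilon>0$, the curve $\tilde\gamma_\epsilon$ is defined and has a normalized lift $\tilde\Gamma_\epsilon$ as above; $\tilde\Gamma_\epsilon$ is annihilated by an operator $\partial^{d+1}+u_{d-1,\epsilon}\partial^{d-1}+\dots+u_{0,\epsilon}$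 with smooth $2\pi$-periodic coefficients; $\tilde\Gamma_\epsilon(x),\dots,\tilde\Gamma_\epsilon(x+d\epsilon)$ are linearly independent for all $x$; $\tilde\Gamma_\epsilon=\Gamma+\epsilon^2c\,Q_2\Gamma+O(\epsilon^4)$; and the discrete Lax equation $\tilde L_{0,1}=\tilde P_{1,0}\tilde L_{0,0}\tilde P_{0,0}^{-1}$ holds. 3. There are functions $w_0,\dots,w_{d-1}$ with $u_{k,\epsilon}=u_k+\epsilon^2w_k+O(\epsilon^4)$. Let $\frac{dU}{dt}$ be the matrix with last row $(-w_0,\dots,-w_{d-1},0)$ and zeros elsewhere (the evolution $du_k/dt=w_k$, with $\epsilon^2$ as time). Then $$\frac{D_\epsilon\tilde L_{0,1}D_\epsilon^{-1}-D_\epsilon\tilde L_{0,0}D_\epsilon^{-1}}{\epsilon^3}\longrightarrow\frac{dU}{dt},$$ $$\frac{(D_\epsilon\tilde P_{1,0}D_\epsilon^{-1})(D_\epsilon\tilde L_{0,0}D_\epsilon^{-1})(D_\epsilon\tilde P_{0,0}D_\epsilon^{-1})^{-1}-D_\epsilon\tilde L_{0,0}D_\epsilon^{-1}}{\epsilon^3}\longrightarrow[V,U]+\frac{dV}{dx},$$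 so the rescaled discrete Lax equation becomes in the limit the $(2,d+1)$-KdV zero-curvature equation $\frac{dU}{dt}=[V,U]+\frac{dV}{dx}$. -/

import Mathlib

open Filter Topology Asymptotics
open scoped ContDiff Matrix LinearAlgebra.Projectivization

noncomputable section

namespace PentagramLax

/-- The vector space `ℝ^{d+1}`, whose lines are the points of `ℝℙ^d`. -/
abbrev Vec (d : ℕ) : Type := Fin (d + 1) → ℝ

/-- `γ(x + 2π) = M · γ(x)` for some projective transformation `M`
(represented by an invertible linear map). -/
def HasMonodromy {d : ℕ} (γ : ℝ → ℙ ℝ (Vec d)) : Prop :=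
  ∃ M : LinearMap.GeneralLinearGroup ℝ (Vec d), ∀ x, γ (x + 2 * Real.pi) = M • γ x

/-- The matrix with rows `Γ(x), Γ'(x), …, Γ^{(d)}(x)`. -/
def jetMatrix (d : ℕ) (Γ : ℝ → Vec d) (x : ℝ) : Matrix (Fin (d + 1)) (Fin (d + 1)) ℝ :=
  Matrix.of fun i => iteratedDeriv (i : ℕ) Γ x

/-- `Γ` is a smooth lift of `γ` to `ℝ^{d+1}` with `det (Γ, Γ', …, Γ^{(d)}) ≡ 1`.
The existence of such a lift contains the smoothness and the nondegeneracy of `γ`. -/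
def IsNormalizedLift {d : ℕ} (γ : ℝ → ℙ ℝ (Vec d)) (Γ : ℝ → Vec d) : Prop :=
  ContDiff ℝ ∞ Γ ∧ (∀ x, (jetMatrix d Γ x).det = 1) ∧
    ∀ x, ∃ h : Γ x ≠ 0, γ x = Projectivization.mk ℝ (Γ x) h

/-! ### The short-diagonal pentagram map -/

/-- The span of the `d` vertices `v_{i-(d-1)}, v_{i-(d-3)}, …, v_{i+(d-1)}`:
for `d = 2κ+1` these are `v_{i-2κ}, v_{i-2κ+2}, …, v_{i+2κ}`, and
for `d = 2κ` these are `v_{i-2κ+1}, v_{i-2κ+3}, …, v_{i+2κ-1}`. -/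
def shortDiagonal {d : ℕ} (v : ℤ → ℙ ℝ (Vec d)) (i : ℤ) : Submodule ℝ (Vec d) :=
  ⨆ k : Fin d, (v (i - ((d : ℤ) - 1) + 2 * ((k : ℕ) : ℤ))).submodule

/-- `p = T(v_i)`: the `d` consecutive short diagonals `P_{i-κ}, …, P_{i+κ}` (for `d = 2κ+1`) or
`P_{i-κ+1}, …, P_{i+κ}` (for `d = 2κ`) are hyperplanes, and they intersect exactly in the
point `p`. In both cases the smallest index is `i - ⌊(d-1)/2⌋`. -/
def IsShortDiagonalImage {d : ℕ} (v : ℤ → ℙ ℝ (Vec d)) (i : ℤ) (p : ℙ ℝ (Vec d)) : Prop :=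
  (∀ k : Fin d, Module.finrank ℝ
    (shortDiagonal v (i - (((d - 1) / 2 : ℕ) : ℤ) + ((k : ℕ) : ℤ))) = d) ∧
  (⨅ k : Fin d, shortDiagonal v (i - (((d - 1) / 2 : ℕ) : ℤ) + ((k : ℕ) : ℤ))) = p.submodule

/-- The polygon with vertices `v_j = γ(x + jε)`. -/
def discretize {d : ℕ} (γ : ℝ → ℙ ℝ (Vec d)) (ε x : ℝ) : ℤ → ℙ ℝ (Vec d) :=
  fun j => γ (x + (j : ℝ) * ε)

/-- `γ'` is the curve `x ↦ T_ε(γ)(x)` if `d` is odd, and `x ↦ T_ε(γ)(x - ε/2)` if `d` is even,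
where `T_ε(γ)(x)` is the image of `v_0 = γ(x)` under the short-diagonal map applied to the
polygon `v_j = γ(x + jε)`. -/
def IsPentagramCurve {d : ℕ} (ε : ℝ) (γ γ' : ℝ → ℙ ℝ (Vec d)) : Prop :=
  ∀ x, IsShortDiagonalImage (discretize γ ε (if Odd d then x else x - ε / 2)) 0 (γ' x)

/-- `Γt ε` is, for all small `ε > 0`, a normalized lift of the pentagram image of `γ` with step
`ε`. When `d + 1` is even a normalized lift is determined only up to sign, and the sign is the one
for which `Γt ε → Γ`. -/
def IsPentagramLift {d : ℕ} (γ : ℝ → ℙ ℝ (Vec d)) (Γ : ℝ → Vec d) (Γt : ℝ → ℝ → Vec d) : Prop :=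
  (∀ᶠ ε in 𝓝[>] (0 : ℝ), ∃ γ' : ℝ → ℙ ℝ (Vec d),
    IsPentagramCurve ε γ γ' ∧ IsNormalizedLift γ' (Γt ε)) ∧
  ∀ x, Tendsto (fun ε => Γt ε x) (𝓝[>] 0) (𝓝 (Γ x))

/-! ### The differential operator of a curve, and the matrices `U` and `V` -/

/-- The action of `∂^{d+1} + u_{d-1} ∂^{d-1} + … + u_0` on vector-valued functions. -/
def applyOperator {d : ℕ} (u : Fin d → ℝ → ℝ) (f : ℝ → Vec d) (x : ℝ) : Vec d :=
  iteratedDeriv (d + 1) f x + ∑ k : Fin d, u k x • iteratedDeriv (k : ℕ) f x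

/-- The coefficients `u_0, …, u_{d-1}`: minus the coordinates of `Γ^{(d+1)}(x)` in the basis
`Γ(x), …, Γ^{(d)}(x)`. -/
def operatorCoeff (d : ℕ) (Γ : ℝ → Vec d) (k : Fin d) (x : ℝ) : ℝ :=
  -(iteratedDeriv (d + 1) Γ x ᵥ* (jetMatrix d Γ x)⁻¹) k.castSucc

/-- `∂^{d+1} + u_{d-1} ∂^{d-1} + … + u_0` has coefficients in `C^∞(ℝ/2πℤ)` and annihilates `Γ`. -/
def IsOperatorOf {d : ℕ} (u : Fin d → ℝ → ℝ) (Γ : ℝ → Vec d) : Prop :=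
  (∀ k, ContDiff ℝ ∞ (u k) ∧ Function.Periodic (u k) (2 * Real.pi)) ∧
    ∀ x, applyOperator u Γ x = 0

/-- The matrix `U`: ones above the diagonal, last row `(-u_0, …, -u_{d-1}, 0)`. -/
def companion (d : ℕ) (u : Fin d → ℝ) : Matrix (Fin (d + 1)) (Fin (d + 1)) ℝ :=
  Matrix.of fun i j =>
    if (i : ℕ) < d then (if (j : ℕ) = i + 1 then 1 else 0)
    else (if h : (j : ℕ) < d then -u ⟨j, h⟩ else 0)

/-- The matrix whose last row is `(-w_0, …, -w_{d-1}, 0)` and whose other rows vanish: the time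
derivative of the matrix `U` when `du_k/dt = w_k`. -/
def companionVelocity (d : ℕ) (w : Fin d → ℝ) : Matrix (Fin (d + 1)) (Fin (d + 1)) ℝ :=
  Matrix.of fun i j =>
    if (i : ℕ) < d then 0 else (if h : (j : ℕ) < d then -w ⟨j, h⟩ else 0)

/-- The matrix `U(x)` of the operator of the curve `Γ`. -/
def curveU (d : ℕ) (Γ : ℝ → Vec d) (x : ℝ) : Matrix (Fin (d + 1)) (Fin (d + 1)) ℝ :=
  companion d fun k => operatorCoeff d Γ k x

/-- `Q₂ Γ = Γ'' + (2/(d+1)) u_{d-1} Γ` (for `d ≥ 1`). -/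
def applyQ2 (d : ℕ) (Γ : ℝ → Vec d) (x : ℝ) : Vec d :=
  iteratedDeriv 2 Γ x +
    (2 / ((d : ℝ) + 1) * (if h : 0 < d then operatorCoeff d Γ ⟨d - 1, by omega⟩ x else 0)) • Γ x

/-- The matrix `V(x)` determined by
`V (Γ, Γ', …, Γ^{(d)})ᵀ = c (Q₂Γ, (Q₂Γ)', …, (Q₂Γ)^{(d)})ᵀ`. -/
def curveV (d : ℕ) (c : ℝ) (Γ : ℝ → Vec d) (x : ℝ) : Matrix (Fin (d + 1)) (Fin (d + 1)) ℝ :=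
  c • (jetMatrix d (applyQ2 d Γ) x * (jetMatrix d Γ x)⁻¹)

/-- Entrywise `x`-derivative of a matrix-valued function. -/
def matrixDeriv {m n : Type*} (A : ℝ → Matrix m n ℝ) (x : ℝ) : Matrix m n ℝ :=
  Matrix.of fun i j => deriv (fun y => A y i j) x

theorem curveV_mul_jetMatrix (d : ℕ) (c : ℝ) (Γ : ℝ → Vec d) (x : ℝ)
    (h : (jetMatrix d Γ x).det = 1) :
    curveV d c Γ x * jetMatrix d Γ x = c • jetMatrix d (applyQ2 d Γ) x := by
  have hu : IsUnit (jetMatrix d Γ x).det := by rw [h]; exact isUnit_one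
  rw [curveV, Matrix.smul_mul, Matrix.nonsing_inv_mul_cancel_right _ _ hu]

/-! ### The discrete Lax matrices -/

/-- The matrix with rows `Γ(x), Γ(x+ε), …, Γ(x+dε)`. -/
def sampleMatrix (d : ℕ) (ε : ℝ) (Γ : ℝ → Vec d) (x : ℝ) :
    Matrix (Fin (d + 1)) (Fin (d + 1)) ℝ :=
  Matrix.of fun i => Γ (x + ((i : ℕ) : ℝ) * ε)

/-- The coefficients `ã_0, …, ã_d` of `Γ(x+(d+1)ε) = ã_d Γ(x+dε) + … + ã_0 Γ(x)`, that is, the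
coordinates of `Γ(x+(d+1)ε)` in the basis `Γ(x), …, Γ(x+dε)`. -/
def differenceCoeff (d : ℕ) (ε : ℝ) (Γ : ℝ → Vec d) (x : ℝ) : Fin (d + 1) → ℝ :=
  Γ (x + ((d : ℝ) + 1) * ε) ᵥ* (sampleMatrix d ε Γ x)⁻¹

/-- The diagonal of `Λ(z)`: `z, 1, z, …, z` for odd `d` and `1, z, 1, …, z` for even `d`. -/
def spectralDiag (d : ℕ) (z : ℝ) (k : ℕ) : ℝ :=
  if Even (k + d) then 1 else z

/-- The matrix with first `d` rows `(0 | Λ(z))` and last row `(a_0, a_1, …, a_d)`. -/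
def laxOfCoeff (d : ℕ) (z : ℝ) (a : Fin (d + 1) → ℝ) : Matrix (Fin (d + 1)) (Fin (d + 1)) ℝ :=
  Matrix.of fun i j =>
    if (i : ℕ) < d then (if (j : ℕ) = i + 1 then spectralDiag d z i else 0) else a j

/-- The discrete Lax matrix, at spectral parameter `z = 1`, attached to the points
`Γ(x), Γ(x+ε), …, Γ(x+dε)`. -/
def laxL (d : ℕ) (ε : ℝ) (Γ : ℝ → Vec d) (x : ℝ) : Matrix (Fin (d + 1)) (Fin (d + 1)) ℝ :=
  laxOfCoeff d 1 (differenceCoeff d ε Γ x)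

/-- The matrix determined by
`P (Γ(x), …, Γ(x+dε))ᵀ = (Γ'(x), …, Γ'(x+dε))ᵀ`, for curves `Γ` and `Γ'`. -/
def laxP (d : ℕ) (ε : ℝ) (Γ Γ' : ℝ → Vec d) (x : ℝ) : Matrix (Fin (d + 1)) (Fin (d + 1)) ℝ :=
  sampleMatrix d ε Γ' x * (sampleMatrix d ε Γ x)⁻¹

/-- The change of basis `D_ε` from `Γ(x), Γ(x+ε), …, Γ(x+dε)` to the difference quotients
`Γ(x), Δ_ε Γ(x)/ε, …, Δ_ε^d Γ(x)/ε^d`. -/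
def changeOfBasis (d : ℕ) (ε : ℝ) : Matrix (Fin (d + 1)) (Fin (d + 1)) ℝ :=
  Matrix.of fun k i =>
    if (i : ℕ) ≤ k then (-1 : ℝ) ^ ((k : ℕ) - i) * ((k : ℕ).choose i : ℝ) / ε ^ (k : ℕ) else 0

/-- Conjugation `A ↦ D_ε A D_ε⁻¹`. -/
def conjD (d : ℕ) (ε : ℝ) (A : Matrix (Fin (d + 1)) (Fin (d + 1)) ℝ) :
    Matrix (Fin (d + 1)) (Fin (d + 1)) ℝ :=
  changeOfBasis d ε * A * (changeOfBasis d ε)⁻¹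

theorem changeOfBasis_mul_sampleMatrix (d : ℕ) (ε : ℝ) (Γ : ℝ → Vec d) (x : ℝ) :
    changeOfBasis d ε * sampleMatrix d ε Γ x =
      Matrix.of fun k : Fin (d + 1) => (ε ^ (k : ℕ))⁻¹ • ((fwdDiff ε)^[(k : ℕ)] Γ x) := by
  ext k j
  have hk : (k : ℕ) + 1 ≤ d + 1 := k.2
  have key : ∀ i : ℕ, (if i ≤ (k : ℕ) then
      (-1 : ℝ) ^ ((k : ℕ) - i) * ((k : ℕ).choose i : ℝ) / ε ^ (k : ℕ) else 0) * Γ (x + i * ε) j =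
      (ε ^ (k : ℕ))⁻¹ * ((((-1 : ℤ) ^ ((k : ℕ) - i) * (k : ℕ).choose i) • Γ (x + i • ε)) j) := by
    intro i
    by_cases hi : i ≤ (k : ℕ)
    · simp [hi, div_eq_mul_inv]; ring
    · simp [hi, Nat.choose_eq_zero_of_lt (not_le.mp hi)]
  simp only [Matrix.mul_apply, changeOfBasis, sampleMatrix, Matrix.of_apply, Pi.smul_apply,
    fwdDiff_iter_eq_sum_shift, Finset.sum_apply, smul_eq_mul, Finset.mul_sum]
  rw [Finset.sum_subset (Finset.range_mono hk), ← Fin.sum_univ_eq_sum_range]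
  · exact Finset.sum_congr rfl fun i _ => key i
  · intro i _ hi
    have hi' : (k : ℕ) < i := by simpa using hi
    simp [Nat.choose_eq_zero_of_lt hi']

theorem laxP_mul_sampleMatrix (d : ℕ) (ε : ℝ) (Γ Γ' : ℝ → Vec d) (x : ℝ)
    (h : IsUnit (sampleMatrix d ε Γ x).det) :
    laxP d ε Γ Γ' x * sampleMatrix d ε Γ x = sampleMatrix d ε Γ' x := by
  rw [laxP, Matrix.nonsing_inv_mul_cancel_right _ _ h]

theorem differenceCoeff_spec (d : ℕ) (ε : ℝ) (Γ : ℝ → Vec d) (x : ℝ)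
    (h : IsUnit (sampleMatrix d ε Γ x).det) :
    ∑ i, differenceCoeff d ε Γ x i • Γ (x + ((i : ℕ) : ℝ) * ε) =
      Γ (x + ((d : ℝ) + 1) * ε) := by
  have : differenceCoeff d ε Γ x ᵥ* sampleMatrix d ε Γ x = Γ (x + ((d : ℝ) + 1) * ε) := by
    rw [differenceCoeff, Matrix.vecMul_vecMul, Matrix.nonsing_inv_mul _ h, Matrix.vecMul_one]
  rw [← this, Matrix.vecMul_eq_sum]
  rfl

end PentagramLax

end

open PentagramLax

/-! ### Smooth families with a parameter -/

/-! Every object is realized as a function of `(ε, x)` that is smooth across `ε = 0`, so each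
asymptotic claim becomes an exact identity with a smooth remainder (`exists_hadamard`). Uniformity
in `x` follows from the unimodular monodromy of a normalized lift and compactness of a period.

The pentagram image. In the basis `Γ, …, Γ^{(d)}`, with the `j`-th coordinate rescaled by `ε^j /
j!`, the points `Γ(x + hε)` are an `O(ε²)` perturbation of the points `(1, h, h², …)` of the
rational normal curve (`exists_moment_expansion`). The intersection of the short diagonals is an
iterated cross product, hence smooth in `ε` once the limiting configuration is nondegenerate. For
that configuration the normals are coefficient vectors of translates of one polynomial `q`, so lying
in all the hyperplanes becomes a polynomial identity (`sum_hasseDeriv_eq`). Its top three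
coefficients give `leadingPoint_zero_ne_zero`, `leadingPoint_one` and `leadingPoint_two`, hence the
coefficient of `Γ''`, which works out to `(d + 1) / 8` for `d ≥ 2`. The nodes are symmetric about
`0`, so the family is even in `ε` and has no odd terms. Unimodularity, through the trace in Jacobi's
formula, then forces the multiple of `Γ` that completes `Γ''` to `Q₂ Γ`
(`exists_normalized_family`).

The Lax equation. With `S` the matrix of difference quotients of `Γ`, the conjugated Lax matrix is
the transition matrix `S(x + ε) S(x)⁻¹`, and `S` extends to `ε = 0` by the jet matrix `J`, where `J'
= U J`. The image curve has matrix `(1 + ε² V_ε) S` with `V_ε → V`. Comparing the two transition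
matrices leaves `ε³ ([V, U] + V')` (`tendsto_gauge_quotient`). The continuous gauge relation `U_ε P
= P' + P U` with `P = 1 + ε² V + O(ε⁴)` gives the same expression for `dU/dt`
(`exists_curveU_expansion`). Since lifts are unique for small `ε`, everything transfers to an
arbitrary `Γt`. -/

theorem contDiff_nat_intervalIntegral {H : Type} [NormedAddCommGroup H] [NormedSpace ℝ H] (n : ℕ) :
    ∀ {E : Type} [NormedAddCommGroup E] [NormedSpace ℝ E] [CompleteSpace E] (f : H × ℝ → E),
      ContDiff ℝ n f → ContDiff ℝ n fun x => ∫ t in (0 : ℝ)..1, f (x, t) := by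
  induction n with
  | zero =>
    intro E _ _ _ f hf
    rw [Nat.cast_zero, contDiff_zero] at hf ⊢
    exact intervalIntegral.continuous_parametric_intervalIntegral_of_continuous' (f := fun x t => f (x, t))
      (by simpa [Function.uncurry_def] using hf) 0 1
  | succ n ih =>
    intro E _ _ _ f hf
    have hf' : ContDiff ℝ n (fderiv ℝ f) := hf.fderiv_right (by simp)
    have hdf : Differentiable ℝ f := hf.differentiable (by simp)
    have hc : Continuous f := hf.continuous
    -- The partial derivative takes values in `H →L[ℝ] E`, which is why the induction quantifies
    -- over `E`.
    let f' : H × ℝ → H →L[ℝ] E := fun p => (fderiv ℝ f p).comp (ContinuousLinearMap.inl ℝ H ℝ)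
    have hf'' : ContDiff ℝ n f' := hf'.clm_comp contDiff_const
    have hc' : Continuous f' := hf''.continuous
    rw [Nat.cast_succ, contDiff_succ_iff_hasFDerivAt]
    refine ⟨_, ih f' hf'', fun x => ?_⟩
    -- Domination: by compactness of `[0, 1]`, the bound at `x` plus one holds uniformly in `t` near
    -- `x`.
    obtain ⟨s, hs, hsb⟩ : ∃ s ∈ 𝓝 x, ∀ y ∈ s, ∀ t ∈ Set.Icc (0 : ℝ) 1,
        ‖f' (y, t)‖ ≤ sSup ((fun t => ‖f' (x, t)‖) '' Set.Icc (0 : ℝ) 1) + 1 := by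
      have hb : BddAbove ((fun t => ‖f' (x, t)‖) '' Set.Icc (0 : ℝ) 1) :=
        (isCompact_Icc.image (by fun_prop)).bddAbove
      have key := (isCompact_Icc (a := (0 : ℝ)) (b := 1)).eventually_forall_of_forall_eventually
        (x₀ := x) (P := fun y t => ‖f' (y, t)‖ ≤
          sSup ((fun t => ‖f' (x, t)‖) '' Set.Icc (0 : ℝ) 1) + 1) (fun t ht => by
          have h1 : ‖f' (x, t)‖ < sSup ((fun t => ‖f' (x, t)‖) '' Set.Icc (0 : ℝ) 1) + 1 :=
            lt_of_le_of_lt (le_csSup hb ⟨t, ht, rfl⟩) (lt_add_one _)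
          exact ((hc'.norm.tendsto (x, t)).eventually_lt_const h1).mono fun z hz => hz.le)
      exact ⟨_, key, fun y hy t ht => hy t ht⟩
    refine hasFDerivAt_integral_of_dominated_of_fderiv_le'' (F := fun x t => f (x, t))
      (F' := fun x t => f' (x, t)) (s := s)
      (bound := fun _ => sSup ((fun t => ‖f' (x, t)‖) '' Set.Icc (0 : ℝ) 1) + 1) hs
      (Eventually.of_forall fun y => (by fun_prop : Continuous fun t => f (y, t)).aestronglyMeasurable)
      ((by fun_prop : Continuous fun t => f (x, t)).intervalIntegrable _ _)
      (by fun_prop : Continuous fun t => f' (x, t)).aestronglyMeasurable ?_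
      intervalIntegrable_const ?_
    · refine MeasureTheory.ae_restrict_of_forall_mem measurableSet_uIoc fun t ht y hy => hsb y hy t ?_
      rw [Set.uIoc_of_le zero_le_one] at ht
      exact Set.Ioc_subset_Icc_self ht
    · refine Eventually.of_forall fun t y _ => ?_
      exact (hdf (y, t)).hasFDerivAt.comp y (hasFDerivAt_prodMk_left y t)

theorem contDiff_infty_intervalIntegral {H E : Type} [NormedAddCommGroup H] [NormedSpace ℝ H]
    [NormedAddCommGroup E] [NormedSpace ℝ E] [CompleteSpace E] {f : H × ℝ → E}
    (hf : ContDiff ℝ ∞ f) : ContDiff ℝ ∞ fun x => ∫ t in (0 : ℝ)..1, f (x, t) :=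
  contDiff_infty.2 fun n => contDiff_nat_intervalIntegral n f (contDiff_infty.1 hf n)

/-- Hadamard's lemma with a parameter. -/
theorem exists_hadamard {P E : Type} [NormedAddCommGroup P] [NormedSpace ℝ P]
    [NormedAddCommGroup E] [NormedSpace ℝ E] [CompleteSpace E] {F : ℝ × P → E}
    (hF : ContDiff ℝ ∞ F) :
    ∃ G : ℝ × P → E, ContDiff ℝ ∞ G ∧ (∀ ε p, F (ε, p) = F (0, p) + ε • G (ε, p)) ∧
      ∀ p, G (0, p) = fderiv ℝ F (0, p) (1, 0) := by
  have hF' : ContDiff ℝ ∞ (fderiv ℝ F) := hF.fderiv_right (by simp)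
  have hdF : Differentiable ℝ F := hF.differentiable (by simp)
  -- `G` is the average of `∂F/∂ε` along the segment from `(0, p)` to `(ε, p)`.
  refine ⟨fun q => ∫ t in (0 : ℝ)..1, fderiv ℝ F (t * q.1, q.2) (1, 0), ?_, fun ε p => ?_,
    fun p => by simp⟩
  · have h : ContDiff ℝ ∞ fun z : (ℝ × P) × ℝ => fderiv ℝ F (z.2 * z.1.1, z.1.2) (1, 0) := by
      have h2 : ContDiff ℝ ∞ fun z : (ℝ × P) × ℝ => ((z.2 * z.1.1, z.1.2) : ℝ × P) := by fun_prop
      exact (hF'.comp h2).clm_apply contDiff_const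
    exact contDiff_infty_intervalIntegral h
  · have hd : ∀ t ∈ Set.uIcc (0 : ℝ) 1, HasDerivAt (fun t => F (t * ε, p))
        (ε • fderiv ℝ F (t * ε, p) (1, 0)) t := by
      intro t _
      have h1 : HasDerivAt (fun t : ℝ => ((t * ε, p) : ℝ × P)) (ε, 0) t :=
        (by simpa using (hasDerivAt_id t).mul_const ε : HasDerivAt (fun t : ℝ => t * ε) ε t).prodMk
          (hasDerivAt_const t p)
      have h2 := (hdF (t * ε, p)).hasFDerivAt.comp_hasDerivAt t h1
      have h3 : ((ε, 0) : ℝ × P) = ε • ((1, 0) : ℝ × P) := by simp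
      rw [h3, map_smul] at h2
      exact h2
    have hcont : Continuous fun t : ℝ => ε • fderiv ℝ F (t * ε, p) (1, 0) := by
      have := hF'.continuous
      fun_prop
    have := intervalIntegral.integral_eq_sub_of_hasDerivAt hd (hcont.intervalIntegrable 0 1)
    rw [intervalIntegral.integral_smul] at this
    simp only at this ⊢
    rw [this]; simp

/-- Hadamard's lemma for functions which are even in the first variable near `0`. -/
theorem exists_hadamard_even {E : Type} [NormedAddCommGroup E] [NormedSpace ℝ E] [CompleteSpace E]
    {F : ℝ × ℝ → E} (hF : ContDiff ℝ ∞ F)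
    (heven : ∀ᶠ ε in 𝓝[≠] (0 : ℝ), ∀ x, F (-ε, x) = F (ε, x)) :
    ∃ G : ℝ × ℝ → E, ContDiff ℝ ∞ G ∧ (∀ ε x, F (ε, x) = F (0, x) + ε ^ 2 • G (ε, x)) ∧
      ∀ᶠ ε in 𝓝[≠] (0 : ℝ), ∀ x, G (-ε, x) = G (ε, x) := by
  obtain ⟨G₁, hG₁, h₁, -⟩ := exists_hadamard hF
  obtain ⟨G, hG, h₂, -⟩ := exists_hadamard hG₁
  -- Evenness gives `ε (G₁(ε) + G₁(-ε)) = 0`; dividing by `ε` and letting `ε → 0` gives `2 G₁(0) =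
  -- 0`.
  have h0 : ∀ x, G₁ (0, x) = 0 := by
    intro x
    have ha : Tendsto (fun ε : ℝ => G₁ (ε, x) + G₁ (-ε, x)) (𝓝[≠] 0) (𝓝 (G₁ (0, x) + G₁ (0, x))) := by
      have hc : Continuous fun ε : ℝ => G₁ (ε, x) + G₁ (-ε, x) := by
        have := hG₁.continuous
        fun_prop
      have := hc.tendsto 0
      simp only [neg_zero] at this
      exact this.mono_left nhdsWithin_le_nhds
    have hb : Tendsto (fun ε : ℝ => G₁ (ε, x) + G₁ (-ε, x)) (𝓝[≠] 0) (𝓝 0) := by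
      refine tendsto_const_nhds.congr' ?_
      filter_upwards [heven, self_mem_nhdsWithin] with ε hε hne
      have h3 := hε x
      rw [h₁, h₁ ε] at h3
      have h4 : ε • (G₁ (ε, x) + G₁ (-ε, x)) = 0 := by
        rw [neg_smul, add_right_inj] at h3
        rw [smul_add, ← h3, neg_add_cancel]
      exact ((smul_eq_zero.1 h4).resolve_left hne).symm
    have h5 := tendsto_nhds_unique ha hb
    rw [← two_smul ℝ, smul_eq_zero] at h5
    exact h5.resolve_left two_ne_zero
  have h : ∀ ε x, F (ε, x) = F (0, x) + ε ^ 2 • G (ε, x) := by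
    intro ε x
    rw [h₁ ε x, h₂ ε x, h0, zero_add, smul_smul, sq]
  refine ⟨G, hG, h, ?_⟩
  filter_upwards [heven, self_mem_nhdsWithin] with ε hε hne x
  have h3 := hε x
  rw [h, h ε, add_right_inj, neg_sq] at h3
  exact smul_right_injective E (pow_ne_zero 2 hne) h3

/-- The difference quotient of a smooth family, with the step as parameter, is smooth. -/
theorem exists_diffQuot {E : Type} [NormedAddCommGroup E] [NormedSpace ℝ E] [CompleteSpace E]
    {F : ℝ × ℝ → E} (hF : ContDiff ℝ ∞ F) :
    ∃ G : ℝ × ℝ → E, ContDiff ℝ ∞ G ∧ (∀ ε x, F (ε, x + ε) - F (ε, x) = ε • G (ε, x)) ∧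
      ∀ x, G (0, x) = deriv (fun y => F (0, y)) x := by
  have hH : ContDiff ℝ ∞ fun q : ℝ × ℝ => F (q.1, q.2 + q.1) - F q :=
    (hF.comp (by fun_prop : ContDiff ℝ ∞ fun q : ℝ × ℝ => (q.1, q.2 + q.1))).sub hF
  obtain ⟨G, hG, h, -⟩ := exists_hadamard hH
  have h' : ∀ ε x, F (ε, x + ε) - F (ε, x) = ε • G (ε, x) := fun ε x => by
    have := h ε x; simpa using this
  refine ⟨G, hG, h', fun x => ?_⟩
  have hd : HasFDerivAt F (fderiv ℝ F (0, x)) (0, x) := (hF.differentiable (by simp) _).hasFDerivAt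
  have h1 : HasDerivAt (fun y => F (0, y)) (fderiv ℝ F (0, x) (0, 1)) x :=
    hd.comp_hasDerivAt x ((hasDerivAt_const x (0 : ℝ)).prodMk (hasDerivAt_id x))
  -- The step is also the parameter: the two terms move in directions `(1, 1)` and `(1, 0)`, whose
  -- difference is the pure `x`-direction.
  have h2 : HasDerivAt (fun ε => F (ε, x + ε) - F (ε, x)) (fderiv ℝ F (0, x) (0, 1)) 0 := by
    have ha : HasDerivAt (fun ε => F (ε, x + ε)) (fderiv ℝ F (0, x) (1, 1)) 0 := by
      have := (hasDerivAt_id (0 : ℝ)).prodMk ((hasDerivAt_id (0 : ℝ)).const_add x)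
      refine HasFDerivAt.comp_hasDerivAt (0 : ℝ) (f := fun ε : ℝ => (ε, x + ε)) ?_ this
      simpa using hd
    have hb : HasDerivAt (fun ε => F (ε, x)) (fderiv ℝ F (0, x) (1, 0)) 0 :=
      HasFDerivAt.comp_hasDerivAt (0 : ℝ) (f := fun ε : ℝ => (ε, x)) hd
        ((hasDerivAt_id (0 : ℝ)).prodMk (hasDerivAt_const (0 : ℝ) x))
    have := ha.sub hb
    rwa [← map_sub, show ((1, 1) - (1, 0) : ℝ × ℝ) = (0, 1) by simp] at this
  have h3 : HasDerivAt (fun ε => F (ε, x + ε) - F (ε, x)) (G (0, x)) 0 := by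
    simp only [h']
    have hg : HasDerivAt (fun ε => G (ε, x)) (fderiv ℝ G (0, x) (1, 0)) 0 :=
      HasFDerivAt.comp_hasDerivAt (0 : ℝ) (f := fun ε : ℝ => (ε, x))
        (hG.differentiable (by simp) _).hasFDerivAt
        ((hasDerivAt_id (0 : ℝ)).prodMk (hasDerivAt_const (0 : ℝ) x))
    have h4 := (hasDerivAt_id (0 : ℝ)).smul hg
    simp only [id, zero_smul, one_smul, zero_add] at h4
    exact h4
  rw [h1.deriv, h2.unique h3]

/-- Each difference extracts one factor `ε` and leaves another smooth family. That family depends on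
`ε` even if the original one does not, so the induction runs over families rather than curves. -/
theorem exists_iterate_diffQuot {E : Type} [NormedAddCommGroup E] [NormedSpace ℝ E]
    [CompleteSpace E] (k : ℕ) : ∀ {F : ℝ × ℝ → E}, ContDiff ℝ ∞ F →
    ∃ G : ℝ × ℝ → E, ContDiff ℝ ∞ G ∧
      (∀ ε x, (fwdDiff ε)^[k] (fun y => F (ε, y)) x = ε ^ k • G (ε, x)) ∧
      ∀ x, G (0, x) = iteratedDeriv k (fun y => F (0, y)) x := by
  induction k with
  | zero => exact fun {F} hF => ⟨F, hF, by simp, by simp⟩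
  | succ k ih =>
    intro F hF
    obtain ⟨G₁, hG₁, h₁, h₁'⟩ := exists_diffQuot hF
    obtain ⟨G, hG, h, h'⟩ := ih hG₁
    refine ⟨G, hG, fun ε x => ?_, fun x => ?_⟩
    · have : fwdDiff ε (fun y => F (ε, y)) = ε • fun y => G₁ (ε, y) := by
        ext y; simp [fwdDiff, h₁]
      rw [Function.iterate_succ_apply, this, fwdDiff_iter_const_smul, Pi.smul_apply, h, smul_smul,
        pow_succ']
    · rw [h', iteratedDeriv_succ']
      congr 1
      exact funext h₁'

theorem contDiff_slice {P E : Type} [NormedAddCommGroup P] [NormedSpace ℝ P]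
    [NormedAddCommGroup E] [NormedSpace ℝ E] {F : P × ℝ → E}
    (hF : ContDiff ℝ ∞ F) (p : P) : ContDiff ℝ ∞ fun y => F (p, y) :=
  hF.comp (by fun_prop : ContDiff ℝ ∞ fun y : ℝ => (p, y))

theorem contDiff_iteratedDeriv_slice {P E : Type} [NormedAddCommGroup P] [NormedSpace ℝ P]
    [NormedAddCommGroup E] [NormedSpace ℝ E] (k : ℕ) : ∀ {F : P × ℝ → E}, ContDiff ℝ ∞ F →
    ContDiff ℝ ∞ fun q : P × ℝ => iteratedDeriv k (fun y => F (q.1, y)) q.2 := by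
  induction k with
  | zero => exact fun hF => by simpa using hF
  | succ k ih =>
    intro F hF
    have hF' : ContDiff ℝ ∞ (fun q => fderiv ℝ F q (0, 1)) :=
      (hF.fderiv_right (m := ∞) (by simp)).clm_apply contDiff_const
    convert ih hF' using 2 with q
    rw [iteratedDeriv_succ']
    congr 1
    funext y
    exact ((hF.differentiable (by simp) (q.1, y)).hasFDerivAt.comp_hasDerivAt y
      ((hasDerivAt_const y q.1).prodMk (hasDerivAt_id y))).deriv

/-- A property of the values of a family which is periodic in `x` that holds near `ε = 0`
for every `x` holds uniformly in `x`. -/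
theorem eventually_forall_of_periodic {E : Type} [TopologicalSpace E] {F : ℝ × ℝ → E}
    (hF : Continuous F) {T : ℝ} (hT : 0 < T) (hper : ∀ ε x, F (ε, x + T) = F (ε, x))
    {s : Set E} (hs : ∀ x, s ∈ 𝓝 (F (0, x))) : ∀ᶠ ε in 𝓝 (0 : ℝ), ∀ x, F (ε, x) ∈ s := by
  have key := (isCompact_Icc (a := (0 : ℝ)) (b := T)).eventually_forall_of_forall_eventually
    (x₀ := (0 : ℝ)) (P := fun ε x => F (ε, x) ∈ s) (fun x _ => hF.tendsto (0, x) (hs x))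
  filter_upwards [key] with ε hε x
  have hp : Function.Periodic (fun y => F (ε, y)) T := fun y => hper ε y
  obtain ⟨y, hy, hxy⟩ := hp.exists_mem_Ico₀ hT x
  have : F (ε, x) = F (ε, y) := hxy
  rw [this]
  exact hε y (Set.Ico_subset_Icc_self hy)

/-! ### Smooth families of matrices -/

/-- Entrywise smoothness of a matrix valued function. -/
def SmoothEntries {P m n : Type} [NormedAddCommGroup P] [NormedSpace ℝ P]
    (M : P → Matrix m n ℝ) : Prop :=
  ∀ i j, ContDiff ℝ ∞ fun p => M p i j

namespace SmoothEntries

variable {P m n l : Type} [NormedAddCommGroup P] [NormedSpace ℝ P]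

theorem mul [Fintype n] {M : P → Matrix m n ℝ} {N : P → Matrix n l ℝ} (hM : SmoothEntries M)
    (hN : SmoothEntries N) : SmoothEntries fun p => M p * N p := fun i j => by
  simp only [Matrix.mul_apply]
  exact ContDiff.sum fun k _ => (hM i k).mul (hN k j)

theorem add {M N : P → Matrix m n ℝ} (hM : SmoothEntries M) (hN : SmoothEntries N) :
    SmoothEntries fun p => M p + N p := fun i j => (hM i j).add (hN i j)

theorem sub {M N : P → Matrix m n ℝ} (hM : SmoothEntries M) (hN : SmoothEntries N) :
    SmoothEntries fun p => M p - N p := fun i j => (hM i j).sub (hN i j)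

theorem smul {f : P → ℝ} {M : P → Matrix m n ℝ} (hf : ContDiff ℝ ∞ f) (hM : SmoothEntries M) :
    SmoothEntries fun p => f p • M p := fun i j => hf.mul (hM i j)

theorem const (M : Matrix m n ℝ) : SmoothEntries fun _ : P => M := fun _ _ => contDiff_const

theorem comp {Q : Type} [NormedAddCommGroup Q] [NormedSpace ℝ Q] {M : P → Matrix m n ℝ}
    (hM : SmoothEntries M) {g : Q → P} (hg : ContDiff ℝ ∞ g) : SmoothEntries fun q => M (g q) :=
  fun i j => (hM i j).comp hg

theorem det [Fintype n] [DecidableEq n] {M : P → Matrix n n ℝ} (hM : SmoothEntries M) :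
    ContDiff ℝ ∞ fun p => (M p).det := by
  simp only [Matrix.det_apply']
  exact ContDiff.sum fun σ _ => contDiff_const.mul (contDiff_prod fun i _ => hM _ _)

theorem updateRow [DecidableEq m] {M : P → Matrix m n ℝ} (hM : SmoothEntries M) (i : m) (v : n → ℝ) :
    SmoothEntries fun p => (M p).updateRow i v := fun k j => by
  by_cases h : k = i
  · subst h; simpa using contDiff_const
  · simpa [Matrix.updateRow_ne h] using hM k j

theorem adjugate [Fintype n] [DecidableEq n] {M : P → Matrix n n ℝ} (hM : SmoothEntries M) :
    SmoothEntries fun p => (M p).adjugate := fun i j => by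
  simp only [Matrix.adjugate_apply]
  exact (hM.updateRow j _).det

theorem inv_of_det_eq_one [Fintype n] [DecidableEq n] {M : P → Matrix n n ℝ}
    (hM : SmoothEntries M) (h : ∀ p, (M p).det = 1) : SmoothEntries fun p => (M p)⁻¹ := by
  have : (fun p => (M p)⁻¹) = fun p => (M p).adjugate := by
    funext p; rw [Matrix.inv_def, h p]; simp
  rw [this]; exact hM.adjugate

theorem of_rows {M : P → Matrix m n ℝ} [Fintype n] (h : ∀ i, ContDiff ℝ ∞ fun p => M p i) :
    SmoothEntries M := fun i j => (contDiff_pi.1 (h i)) j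

theorem vecMul [Fintype m] [Fintype n] {v : P → m → ℝ} {M : P → Matrix m n ℝ} (hv : ContDiff ℝ ∞ v)
    (hM : SmoothEntries M) : ContDiff ℝ ∞ fun p => v p ᵥ* M p := by
  refine contDiff_pi.2 fun j => ?_
  simp only [Matrix.vecMul, dotProduct]
  exact ContDiff.sum fun k _ => ((contDiff_pi.1 hv) k).mul (hM k j)

end SmoothEntries

/-- Jacobi's formula for a path with logarithmic derivative `U`. -/
theorem hasDerivAt_det {n : Type} [Fintype n] [DecidableEq n] {A : ℝ → Matrix n n ℝ}
    {U : Matrix n n ℝ} {t : ℝ} (hA : ∀ i j, HasDerivAt (fun s => A s i j) ((U * A t) i j) t) :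
    HasDerivAt (fun s => (A s).det) (U.trace * (A t).det) t := by
  let Φ : (n → n → ℝ) → ℝ := fun M => (Matrix.of M).det
  have hΦ : ContDiff ℝ ∞ Φ := by
    have : SmoothEntries fun M : n → n → ℝ => Matrix.of M := fun i j => by
      simp only [Matrix.of_apply]; fun_prop
    exact this.det
  have hD : HasFDerivAt Φ (fderiv ℝ Φ (A t)) (A t) := (hΦ.differentiable (by simp) _).hasFDerivAt
  have h1 : HasDerivAt (fun s => Φ (A s)) (fderiv ℝ Φ (A t) (U * A t)) t :=
    HasFDerivAt.comp_hasDerivAt (E := ℝ) (F := n → n → ℝ) t (f := A) hD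
      (hasDerivAt_pi.2 fun i => hasDerivAt_pi.2 fun j => hA i j)
  -- The differential of `det` in the direction `U A` is read off the line `(1 + s U) A`, where the
  -- determinant factors.
  have h2 : HasDerivAt (fun s : ℝ => Φ (A t + s • (U * A t))) (fderiv ℝ Φ (A t) (U * A t)) 0 := by
    have h3 : HasDerivAt (fun s : ℝ => (fun i j => A t i j + s * (U * A t) i j : n → n → ℝ))
        (fun i j => (U * A t) i j) 0 := by
      refine hasDerivAt_pi.2 fun i => hasDerivAt_pi.2 fun j => ?_
      simpa using ((hasDerivAt_id (0 : ℝ)).mul_const ((U * A t) i j)).const_add (A t i j)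
    refine HasFDerivAt.comp_hasDerivAt (E := ℝ) (F := n → n → ℝ) (0 : ℝ)
      (f := fun s : ℝ => (fun i j => A t i j + s * (U * A t) i j : n → n → ℝ)) ?_ h3
    simp only [zero_mul, add_zero]
    exact hD
  have h3 : HasDerivAt (fun s : ℝ => Φ (A t + s • (U * A t))) (U.trace * (A t).det) 0 := by
    have : (fun s : ℝ => Φ (A t + s • (U * A t))) = fun s : ℝ => (1 + U.trace * s +
        (Matrix.det (1 + (Polynomial.X : Polynomial ℝ) • U.map Polynomial.C)).divX.divX.eval s *
          s ^ 2) * (A t).det := by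
      funext s
      rw [← Matrix.det_one_add_smul, ← Matrix.det_mul, add_mul, one_mul, Matrix.smul_mul]
      rfl
    rw [this]
    set p := (Matrix.det (1 + (Polynomial.X : Polynomial ℝ) • U.map Polynomial.C)).divX.divX
    have h4 := ((((hasDerivAt_id (0 : ℝ)).const_mul U.trace).const_add 1).add
      ((p.hasDerivAt 0).mul ((hasDerivAt_id (0 : ℝ)).pow 2))).mul_const (A t).det
    refine h4.congr_deriv ?_
    simp
  rw [← h2.unique h3]
  exact h1

/-! ### Jets of curves -/

section Jets

variable {d : ℕ}

theorem smooth_iteratedDeriv {Γ : ℝ → Vec d} (hΓ : ContDiff ℝ ∞ Γ) (k : ℕ) :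
    ContDiff ℝ ∞ (iteratedDeriv k Γ) := by
  have := contDiff_iteratedDeriv_slice k (F := fun q : ℝ × ℝ => Γ q.2) (hΓ.comp contDiff_snd)
  exact contDiff_slice this 0

theorem smoothEntries_jetMatrix {Γ : ℝ → Vec d} (hΓ : ContDiff ℝ ∞ Γ) :
    SmoothEntries (jetMatrix d Γ) :=
  SmoothEntries.of_rows fun i => smooth_iteratedDeriv hΓ i

theorem smoothEntries_jetMatrix_slice {F : ℝ × ℝ → Vec d} (hF : ContDiff ℝ ∞ F) :
    SmoothEntries fun q : ℝ × ℝ => jetMatrix d (fun y => F (q.1, y)) q.2 :=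
  SmoothEntries.of_rows fun i => contDiff_iteratedDeriv_slice i hF

theorem iteratedDeriv_clm_comp {E F : Type} [NormedAddCommGroup E] [NormedSpace ℝ E]
    [NormedAddCommGroup F] [NormedSpace ℝ F] (L : E →L[ℝ] F) {f : ℝ → E} (hf : ContDiff ℝ ∞ f)
    (k : ℕ) (x : ℝ) : iteratedDeriv k (fun y => L (f y)) x = L (iteratedDeriv k f x) := by
  have := L.iteratedFDeriv_comp_left (f := f) (x := x) (hf.contDiffAt) (i := k)
    (by exact_mod_cast le_top)
  simp only [iteratedDeriv]
  rw [show (fun y => L (f y)) = L ∘ f from rfl, this]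
  rfl

theorem iteratedDeriv_vecMul {Γ : ℝ → Vec d} (hΓ : ContDiff ℝ ∞ Γ)
    (B : Matrix (Fin (d + 1)) (Fin (d + 1)) ℝ) (k : ℕ) (x : ℝ) :
    iteratedDeriv k (fun y => Γ y ᵥ* B) x = iteratedDeriv k Γ x ᵥ* B :=
  iteratedDeriv_clm_comp (Matrix.vecMulLinear B).toContinuousLinearMap hΓ k x

theorem jetMatrix_vecMul {Γ : ℝ → Vec d} (hΓ : ContDiff ℝ ∞ Γ)
    (B : Matrix (Fin (d + 1)) (Fin (d + 1)) ℝ) (x : ℝ) :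
    jetMatrix d (fun y => Γ y ᵥ* B) x = jetMatrix d Γ x * B := by
  ext i j
  have := congrFun (iteratedDeriv_vecMul hΓ B i x) j
  simpa [jetMatrix, Matrix.mul_apply, Matrix.vecMul, dotProduct] using this

theorem jetMatrix_comp_add (Γ : ℝ → Vec d) (s x : ℝ) :
    jetMatrix d (fun y => Γ (y + s)) x = jetMatrix d Γ (x + s) := by
  ext i j
  simp [jetMatrix, iteratedDeriv_comp_add_const]

theorem jetMatrix_add {f g : ℝ → Vec d} (hf : ContDiff ℝ ∞ f) (hg : ContDiff ℝ ∞ g) (x : ℝ) :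
    jetMatrix d (fun y => f y + g y) x = jetMatrix d f x + jetMatrix d g x := by
  ext i j
  have := iteratedDeriv_fun_add (n := (i : ℕ)) (x := x) (f := f) (g := g)
    (hf.contDiffAt.of_le (by exact_mod_cast le_top)) (hg.contDiffAt.of_le (by exact_mod_cast le_top))
  simp [jetMatrix, this]

theorem jetMatrix_const_smul (c : ℝ) (f : ℝ → Vec d) (x : ℝ) :
    jetMatrix d (fun y => c • f y) x = c • jetMatrix d f x := by
  ext i j
  simp [jetMatrix, iteratedDeriv_fun_const_smul_field]

theorem deriv_iteratedDeriv_entry {Γ : ℝ → Vec d} (hΓ : ContDiff ℝ ∞ Γ) (k : ℕ) (j : Fin (d + 1))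
    (x : ℝ) : HasDerivAt (fun y => iteratedDeriv k Γ y j) (iteratedDeriv (k + 1) Γ x j) x := by
  have h := ((smooth_iteratedDeriv hΓ k).differentiable (by simp) x).hasDerivAt
  rw [← iteratedDeriv_succ] at h
  exact hasDerivAt_pi.1 h j

/-- Leibniz' rule as a triangular matrix identity. -/
theorem jetMatrix_smul {f : ℝ → ℝ} {G : ℝ → Vec d} (hf : ContDiff ℝ ∞ f) (hG : ContDiff ℝ ∞ G)
    (x : ℝ) : jetMatrix d (fun y => f y • G y) x =
      (Matrix.of fun i j : Fin (d + 1) => if j ≤ i then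
        ((i : ℕ).choose j : ℝ) * iteratedDeriv ((i : ℕ) - j) f x else 0) * jetMatrix d G x := by
  ext i j
  have hG' : ∀ k, ContDiff ℝ ∞ fun y => G y k := contDiff_pi.1 hG
  have h1 : jetMatrix d (fun y => f y • G y) x i j =
      iteratedDeriv i (fun y => f y * G y j) x := by
    exact (iteratedDeriv_clm_comp (ContinuousLinearMap.proj (R := ℝ) j) (hf.smul hG) i x).symm
  have h2 : ∀ k : ℕ, iteratedDeriv k (fun y => G y j) x = iteratedDeriv k G x j := fun k =>
    iteratedDeriv_clm_comp (ContinuousLinearMap.proj (R := ℝ) j) hG k x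
  have h3 := iteratedDeriv_mul (n := (i : ℕ)) (x := x) (f := fun y => G y j) (g := f)
    ((hG' j).contDiffAt.of_le (by exact_mod_cast le_top))
    (hf.contDiffAt.of_le (by exact_mod_cast le_top))
  rw [h1, show (fun y => f y * G y j) = (fun y => G y j) * f by funext y; simp [mul_comm], h3,
    Matrix.mul_apply, Finset.sum_subset (Finset.range_mono (Nat.succ_le_of_lt i.2)),
    ← Fin.sum_univ_eq_sum_range]
  · refine Finset.sum_congr rfl fun k _ => ?_
    by_cases hk : k ≤ i
    · simp [hk, h2, jetMatrix]; ring
    · have hk' : (i : ℕ) < k := not_le.1 hk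
      simp [hk, Nat.choose_eq_zero_of_lt hk']
  · intro k _ hk
    have : (i : ℕ) < k := by simpa [Nat.lt_succ_iff] using hk
    simp [Nat.choose_eq_zero_of_lt this]

theorem det_jetMatrix_smul {f : ℝ → ℝ} {G : ℝ → Vec d} (hf : ContDiff ℝ ∞ f)
    (hG : ContDiff ℝ ∞ G) (x : ℝ) :
    (jetMatrix d (fun y => f y • G y) x).det = f x ^ (d + 1) * (jetMatrix d G x).det := by
  rw [jetMatrix_smul hf hG, Matrix.det_mul, Matrix.det_of_isLowerTriangular]
  · simp
  · intro i j hij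
    have : ¬ j ≤ i := not_le.2 hij
    simp [this]

/-- The Leibniz matrix has diagonal `f`. This measures how an added multiple of the curve changes
the Wronskian to first order. -/
theorem trace_jetMatrix_smul_mul_inv {f : ℝ → ℝ} {G : ℝ → Vec d} (hf : ContDiff ℝ ∞ f)
    (hG : ContDiff ℝ ∞ G) (x : ℝ) (h : (jetMatrix d G x).det = 1) :
    (jetMatrix d (fun y => f y • G y) x * (jetMatrix d G x)⁻¹).trace = (d + 1) * f x := by
  rw [jetMatrix_smul hf hG, Matrix.mul_nonsing_inv_cancel_right _ _ (by rw [h]; exact isUnit_one)]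
  simp [Matrix.trace]

/-- Two smooth curves which are pointwise proportional differ by a smooth factor. -/
theorem contDiff_ratio {F G : ℝ → Vec d} (hF : ContDiff ℝ ∞ F) (hG : ContDiff ℝ ∞ G)
    (hG0 : ∀ x, G x ≠ 0) {l : ℝ → ℝ} (h : ∀ x, F x = l x • G x) : ContDiff ℝ ∞ l := by
  have hdot : ∀ {a b : ℝ → Vec d}, ContDiff ℝ ∞ a → ContDiff ℝ ∞ b →
      ContDiff ℝ ∞ fun x => a x ⬝ᵥ b x := fun ha hb => by
    simp only [dotProduct]
    exact ContDiff.sum fun k _ => (contDiff_pi.1 ha k).mul (contDiff_pi.1 hb k)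
  have hne : ∀ x, G x ⬝ᵥ G x ≠ 0 := fun x => by simpa using hG0 x
  have : l = fun x => (F x ⬝ᵥ G x) / (G x ⬝ᵥ G x) := by
    funext x
    rw [h, smul_dotProduct, smul_eq_mul, mul_div_cancel_right₀ _ (hne x)]
  rw [this]
  exact (hdot hF hG).div (hdot hG hG) hne

/-- Two curves with constant nonzero Wronskians which are pointwise proportional are
proportional. -/
theorem exists_const_ratio {F G : ℝ → Vec d} (hF : ContDiff ℝ ∞ F) (hG : ContDiff ℝ ∞ G)
    (hG0 : ∀ x, G x ≠ 0) {a b : ℝ} (ha : a ≠ 0) (hFd : ∀ x, (jetMatrix d F x).det = a)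
    (hGd : ∀ x, (jetMatrix d G x).det = b) {l : ℝ → ℝ} (h : ∀ x, F x = l x • G x) :
    ∃ c : ℝ, c ^ (d + 1) * b = a ∧ ∀ x, F x = c • G x := by
  have hl := contDiff_ratio hF hG hG0 h
  have hpow : ∀ x, l x ^ (d + 1) * b = a := fun x => by
    rw [← hGd x, ← hFd x, ← det_jetMatrix_smul hl hG]
    congr 2; exact funext fun y => (h y).symm
  have hb : b ≠ 0 := by rintro rfl; exact ha (by simpa using (hpow 0).symm)
  have hne : ∀ x, l x ≠ 0 := fun x hx => ha (by rw [← hpow x, hx]; simp)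
  refine ⟨l 0, hpow 0, fun x => ?_⟩
  have hder : ∀ x, deriv l x = 0 := by
    intro x
    -- The constant `l ^ (d + 1) * b` has derivative `(d + 1) l ^ d l' b`, in which only `l'` can
    -- vanish.
    have h1 : HasDerivAt l (deriv l x) x := (hl.differentiable (by simp) x).hasDerivAt
    have h2 := (h1.pow (d + 1)).mul_const b
    have h3 : HasDerivAt (fun y => l y ^ (d + 1) * b) 0 x := by
      simp only [hpow]; exact hasDerivAt_const _ _
    have h4 := h3.unique h2
    simp only [Nat.add_sub_cancel] at h4
    rcases mul_eq_zero.1 h4.symm with h5 | h5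
    · rcases mul_eq_zero.1 h5 with h6 | h6
      · rcases mul_eq_zero.1 h6 with h7 | h7
        · exact absurd h7 (by positivity)
        · exact absurd h7 (pow_ne_zero _ (hne x))
      · exact h6
    · exact absurd h5 hb
  rw [h x, is_const_of_deriv_eq_zero (hl.differentiable (by simp)) hder x 0]

end Jets

/-! ### Normalized curves -/

section Normalized

variable {d : ℕ}

/-- A companion matrix moves the rows up and fills in the last one. The same shape thus serves
differentiation of jets (`U`) and the shift of samples (the discrete Lax matrix). -/
theorem laxOfCoeff_one_mul (a : Fin (d + 1) → ℝ) (M : Matrix (Fin (d + 1)) (Fin (d + 1)) ℝ) :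
    laxOfCoeff d 1 a * M = Matrix.of fun i : Fin (d + 1) => if h : (i : ℕ) < d then M ⟨i + 1, by omega⟩
      else a ᵥ* M := by
  ext i j
  by_cases h : (i : ℕ) < d
  · simp only [Matrix.mul_apply, laxOfCoeff, Matrix.of_apply, h, if_true, dif_pos]
    rw [Finset.sum_eq_single (⟨i + 1, by omega⟩ : Fin (d + 1))]
    · simp [spectralDiag]
    · intro k _ hk
      have : (k : ℕ) ≠ i + 1 := fun h' => hk (Fin.ext h')
      simp [this]
    · simp
  · simp [Matrix.mul_apply, laxOfCoeff, h, Matrix.vecMul, dotProduct]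

/-- The coordinates of `Γ^{(d+1)}(x)` in the basis `Γ(x), …, Γ^{(d)}(x)`. -/
noncomputable def topCoord (d : ℕ) (Γ : ℝ → Vec d) (x : ℝ) : Fin (d + 1) → ℝ :=
  iteratedDeriv (d + 1) Γ x ᵥ* (jetMatrix d Γ x)⁻¹

variable {Γ : ℝ → Vec d}

theorem topCoord_vecMul_jetMatrix {x : ℝ} (hdet : (jetMatrix d Γ x).det = 1) :
    topCoord d Γ x ᵥ* jetMatrix d Γ x = iteratedDeriv (d + 1) Γ x := by
  rw [topCoord, Matrix.vecMul_vecMul, Matrix.nonsing_inv_mul _ (by rw [hdet]; exact isUnit_one),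
    Matrix.vecMul_one]

theorem hasDerivAt_jetMatrix_topCoord (hΓ : ContDiff ℝ ∞ Γ) {x : ℝ}
    (hdet : (jetMatrix d Γ x).det = 1) (i j : Fin (d + 1)) :
    HasDerivAt (fun y => jetMatrix d Γ y i j)
      ((laxOfCoeff d 1 (topCoord d Γ x) * jetMatrix d Γ x) i j) x := by
  have h := deriv_iteratedDeriv_entry hΓ i j x
  rw [laxOfCoeff_one_mul]
  by_cases hi : (i : ℕ) < d
  · simpa [hi, jetMatrix] using h
  · have hi' : (i : ℕ) = d := by omega
    simp only [Matrix.of_apply, hi, dif_neg, not_false_eq_true]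
    rw [topCoord_vecMul_jetMatrix hdet]
    have h' : iteratedDeriv ((i : ℕ) + 1) Γ x = iteratedDeriv (d + 1) Γ x :=
      congrArg (fun n => iteratedDeriv n Γ x) (by omega)
    rw [← h']
    exact h

theorem trace_laxOfCoeff (a : Fin (d + 1) → ℝ) : (laxOfCoeff d 1 a).trace = a (Fin.last d) := by
  rw [Matrix.trace, Finset.sum_eq_single (Fin.last d)]
  · simp [laxOfCoeff]
  · intro i _ hi
    have : (i : ℕ) < d := lt_of_le_of_ne (Nat.lt_succ_iff.1 i.2) fun h => hi (Fin.ext h)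
    simp [laxOfCoeff, this]
  · simp

/-- By Jacobi's formula the logarithmic derivative of the Wronskian is the trace of the companion
matrix, which is this coordinate; the Wronskian is constant. -/
theorem topCoord_last (hΓ : ContDiff ℝ ∞ Γ) (hdet : ∀ x, (jetMatrix d Γ x).det = 1) (x : ℝ) :
    topCoord d Γ x (Fin.last d) = 0 := by
  have h := hasDerivAt_det (hasDerivAt_jetMatrix_topCoord hΓ (hdet x))
  simp only [hdet, trace_laxOfCoeff, mul_one] at h
  exact h.unique (hasDerivAt_const _ _)

theorem curveU_eq_laxOfCoeff (hΓ : ContDiff ℝ ∞ Γ) (hdet : ∀ x, (jetMatrix d Γ x).det = 1) (x : ℝ) :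
    curveU d Γ x = laxOfCoeff d 1 (topCoord d Γ x) := by
  ext i j
  by_cases hi : (i : ℕ) < d
  · simp [curveU, companion, laxOfCoeff, hi, spectralDiag]
  · by_cases hj : (j : ℕ) < d
    · simp only [curveU, companion, laxOfCoeff, Matrix.of_apply, hi, hj, if_false, dif_pos,
        operatorCoeff, neg_neg, topCoord]
      rfl
    · have : j = Fin.last d := Fin.ext (by have := j.2; simp; omega)
      subst this
      simp [curveU, companion, laxOfCoeff, topCoord_last hΓ hdet, hi]

/-- `J' = U J` for the matrix `J` of derivatives of a normalized curve. -/
theorem hasDerivAt_jetMatrix (hΓ : ContDiff ℝ ∞ Γ) (hdet : ∀ x, (jetMatrix d Γ x).det = 1) (x : ℝ)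
    (i j : Fin (d + 1)) :
    HasDerivAt (fun y => jetMatrix d Γ y i j) ((curveU d Γ x * jetMatrix d Γ x) i j) x := by
  rw [curveU_eq_laxOfCoeff hΓ hdet]
  exact hasDerivAt_jetMatrix_topCoord hΓ (hdet x) i j

theorem contDiff_topCoord (hΓ : ContDiff ℝ ∞ Γ) (hdet : ∀ x, (jetMatrix d Γ x).det = 1) :
    ContDiff ℝ ∞ (topCoord d Γ) :=
  SmoothEntries.vecMul (smooth_iteratedDeriv hΓ _)
    ((smoothEntries_jetMatrix hΓ).inv_of_det_eq_one hdet)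

theorem contDiff_operatorCoeff (hΓ : ContDiff ℝ ∞ Γ) (hdet : ∀ x, (jetMatrix d Γ x).det = 1)
    (k : Fin d) : ContDiff ℝ ∞ (operatorCoeff d Γ k) :=
  ((contDiff_pi.1 (contDiff_topCoord hΓ hdet)) k.castSucc).neg

theorem iteratedDeriv_top_eq (hΓ : ContDiff ℝ ∞ Γ) (hdet : ∀ x, (jetMatrix d Γ x).det = 1) (x : ℝ) :
    iteratedDeriv (d + 1) Γ x = -∑ k : Fin d, operatorCoeff d Γ k x • iteratedDeriv k Γ x := by
  rw [← topCoord_vecMul_jetMatrix (hdet x), Matrix.vecMul_eq_sum, Fin.sum_univ_castSucc,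
    topCoord_last hΓ hdet, zero_smul, add_zero, ← Finset.sum_neg_distrib]
  refine Finset.sum_congr rfl fun k _ => ?_
  rw [← neg_smul, operatorCoeff, neg_neg]
  rfl

variable {B : Matrix (Fin (d + 1)) (Fin (d + 1)) ℝ} {T : ℝ}

theorem iteratedDeriv_monodromy (hΓ : ContDiff ℝ ∞ Γ) (hB : ∀ x, Γ (x + T) = Γ x ᵥ* B) (k : ℕ)
    (x : ℝ) : iteratedDeriv k Γ (x + T) = iteratedDeriv k Γ x ᵥ* B := by
  rw [← iteratedDeriv_vecMul hΓ B, ← funext hB, iteratedDeriv_comp_add_const]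

theorem jetMatrix_monodromy (hΓ : ContDiff ℝ ∞ Γ) (hB : ∀ x, Γ (x + T) = Γ x ᵥ* B) (x : ℝ) :
    jetMatrix d Γ (x + T) = jetMatrix d Γ x * B := by
  rw [← jetMatrix_comp_add, funext hB, jetMatrix_vecMul hΓ]

theorem vecMul_mul_inv_mul (hB : B.det = 1) (v : Fin (d + 1) → ℝ)
    (M : Matrix (Fin (d + 1)) (Fin (d + 1)) ℝ) : (v ᵥ* B) ᵥ* (M * B)⁻¹ = v ᵥ* M⁻¹ := by
  rw [Matrix.mul_inv_rev, Matrix.vecMul_vecMul, Matrix.mul_nonsing_inv_cancel_left]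
  rw [hB]; exact isUnit_one

theorem topCoord_periodic (hΓ : ContDiff ℝ ∞ Γ) (hB1 : B.det = 1)
    (hB : ∀ x, Γ (x + T) = Γ x ᵥ* B) (x : ℝ) : topCoord d Γ (x + T) = topCoord d Γ x := by
  rw [topCoord, iteratedDeriv_monodromy hΓ hB, jetMatrix_monodromy hΓ hB,
    vecMul_mul_inv_mul hB1, topCoord]

theorem isOperatorOf_operatorCoeff (hΓ : ContDiff ℝ ∞ Γ) (hdet : ∀ x, (jetMatrix d Γ x).det = 1)
    (hB1 : B.det = 1) (hB : ∀ x, Γ (x + 2 * Real.pi) = Γ x ᵥ* B) :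
    IsOperatorOf (operatorCoeff d Γ) Γ := by
  refine ⟨fun k => ⟨contDiff_operatorCoeff hΓ hdet k, fun x => ?_⟩, fun x => ?_⟩
  · have := congrFun (topCoord_periodic hΓ hB1 hB x) k.castSucc
    exact congrArg Neg.neg this
  · rw [applyOperator, iteratedDeriv_top_eq hΓ hdet, neg_add_cancel]

theorem ne_zero_of_det_jetMatrix {x : ℝ} (h : (jetMatrix d Γ x).det ≠ 0) : Γ x ≠ 0 := by
  intro h0
  refine h (Matrix.det_eq_zero_of_row_eq_zero 0 fun j => ?_)
  simp [jetMatrix, h0]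

/-- A normalized lift inherits a linear unimodular monodromy. -/
theorem IsNormalizedLift.exists_monodromy {γ : ℝ → ℙ ℝ (Vec d)} (hγ : HasMonodromy γ)
    (h : IsNormalizedLift γ Γ) : ∃ B : Matrix (Fin (d + 1)) (Fin (d + 1)) ℝ, B.det = 1 ∧
      ∀ x, Γ (x + 2 * Real.pi) = Γ x ᵥ* B := by
  obtain ⟨M, hM⟩ := hγ
  obtain ⟨hΓ, hdet, hl⟩ := h
  let f : Vec d →ₗ[ℝ] Vec d := (M : Vec d →ₗ[ℝ] Vec d)
  let N : Matrix (Fin (d + 1)) (Fin (d + 1)) ℝ := (LinearMap.toMatrix' f)ᵀ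
  have hf : ∀ v, f v = v ᵥ* N := fun v => by
    rw [Matrix.vecMul_transpose, ← Matrix.toLin'_apply, Matrix.toLin'_toMatrix']
  have hNdet : N.det ≠ 0 := by
    rw [Matrix.det_transpose, LinearMap.det_toMatrix']
    exact ((Units.isUnit M).map LinearMap.det).ne_zero
  have hsm : ContDiff ℝ ∞ fun x => Γ x ᵥ* N := SmoothEntries.vecMul hΓ (SmoothEntries.const N)
  have hdet2 : ∀ x, (jetMatrix d (fun x => Γ x ᵥ* N) x).det = N.det := fun x => by
    rw [jetMatrix_vecMul hΓ, Matrix.det_mul, hdet, one_mul]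
  have hne : ∀ x, Γ x ᵥ* N ≠ 0 := fun x =>
    ne_zero_of_det_jetMatrix (Γ := fun x => Γ x ᵥ* N) (by rw [hdet2]; exact hNdet)
  have hprop : ∀ x, ∃ c : ℝ, Γ (x + 2 * Real.pi) = c • (Γ x ᵥ* N) := by
    intro x
    obtain ⟨h1, h2⟩ := hl (x + 2 * Real.pi)
    obtain ⟨h3, h4⟩ := hl x
    have h5 := hM x
    rw [h2, h4, Projectivization.smul_mk, Projectivization.mk_eq_mk_iff'] at h5
    obtain ⟨a, ha⟩ := h5
    refine ⟨a, ?_⟩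
    rw [← ha, ← hf]
    rfl
  choose l hl using hprop
  have hshift : ContDiff ℝ ∞ fun x => Γ (x + 2 * Real.pi) := hΓ.comp (by fun_prop)
  -- Both curves lift the shifted `γ` and have constant Wronskians, so they differ by a constant,
  -- which also rescales `N` to determinant one.
  obtain ⟨c, hc, hc'⟩ := exists_const_ratio hshift hsm hne (a := 1) one_ne_zero
    (fun x => by rw [jetMatrix_comp_add, hdet]) hdet2 hl
  refine ⟨c • N, ?_, fun x => ?_⟩
  · rw [Matrix.det_smul, Fintype.card_fin, hc]
  · rw [hc', Matrix.vecMul_smul]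

end Normalized

/-! ### The generalized cross product -/

section Wedge

variable {d : ℕ}

/-- The generalized cross product of `d` vectors in a free module of rank `d + 1`. -/
noncomputable def wedge {R : Type} [CommRing R] (M : Fin d → Fin (d + 1) → R) : Fin (d + 1) → R := fun j =>
  (Matrix.of (Fin.cons (Pi.single j 1) M : Fin (d + 1) → Fin (d + 1) → R)).det

theorem wedge_dotProduct {R : Type} [CommRing R] (M : Fin d → Fin (d + 1) → R)
    (v : Fin (d + 1) → R) :
    wedge M ⬝ᵥ v = (Matrix.of (Fin.cons v M : Fin (d + 1) → Fin (d + 1) → R)).det := by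
  have hsub : ∀ (w : Fin (d + 1) → R) (j : Fin (d + 1)),
      (Matrix.of (Fin.cons w M : Fin (d + 1) → Fin (d + 1) → R)).submatrix Fin.succ j.succAbove =
        Matrix.of fun i k => M i (j.succAbove k) := fun w j => by ext i k; simp
  simp only [wedge, dotProduct, Matrix.det_succ_row_zero, hsub]
  refine Finset.sum_congr rfl fun j _ => ?_
  rw [Finset.sum_eq_single j]
  · simp; ring
  · intro k _ hk; simp [hk]
  · simp

theorem wedge_dotProduct_self {R : Type} [CommRing R] (M : Fin d → Fin (d + 1) → R) (k : Fin d) :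
    wedge M ⬝ᵥ M k = 0 := by
  rw [wedge_dotProduct]
  exact Matrix.det_zero_of_row_eq (i := 0) (j := k.succ) (Fin.succ_ne_zero k).symm (by
    funext j; simp)

theorem smooth_wedge {P : Type} [NormedAddCommGroup P] [NormedSpace ℝ P]
    {M : P → Fin d → Fin (d + 1) → ℝ} (hM : ∀ i, ContDiff ℝ ∞ fun p => M p i) :
    ContDiff ℝ ∞ fun p => wedge (M p) := by
  refine contDiff_pi.2 fun j => SmoothEntries.det
    (M := fun p => Matrix.of (Fin.cons (Pi.single j 1) (M p) : Fin (d + 1) → Fin (d + 1) → ℝ)) ?_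
  intro i k
  refine Fin.cases ?_ (fun i => ?_) i
  · simpa using contDiff_const
  · simpa using contDiff_pi.1 (hM i) k

theorem det_cons_ne_zero_iff (M : Fin d → Vec d) (v : Vec d) :
    (Matrix.of (Fin.cons v M : Fin (d + 1) → Fin (d + 1) → ℝ)).det ≠ 0 ↔
      LinearIndependent ℝ M ∧ v ∉ Submodule.span ℝ (Set.range M) := by
  rw [← linearIndependent_finCons, ← isUnit_iff_ne_zero, ← Matrix.isUnit_iff_isUnit_det,
    ← Matrix.linearIndependent_rows_iff_isUnit]
  rfl

/-- Over `ℝ` the cross product has nonzero square length, and this is the determinant with the cross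
product itself as extra row. -/
theorem linearIndependent_of_wedge_ne_zero {M : Fin d → Vec d} (h : wedge M ≠ 0) :
    LinearIndependent ℝ M := by
  have h1 : wedge M ⬝ᵥ wedge M ≠ 0 := by simpa using h
  rw [wedge_dotProduct, det_cons_ne_zero_iff] at h1
  exact h1.1

theorem mem_span_iff_wedge_dotProduct {M : Fin d → Vec d} (h : wedge M ≠ 0) (v : Vec d) :
    v ∈ Submodule.span ℝ (Set.range M) ↔ wedge M ⬝ᵥ v = 0 := by
  rw [← not_iff_not, wedge_dotProduct, ← ne_eq, det_cons_ne_zero_iff]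
  exact ⟨fun hv => ⟨linearIndependent_of_wedge_ne_zero h, hv⟩, fun hv => hv.2⟩

theorem exists_smul_wedge {M : Fin d → Vec d} (h : wedge M ≠ 0) {v : Vec d}
    (hv : ∀ k, M k ⬝ᵥ v = 0) : ∃ a : ℝ, v = a • wedge M := by
  have h1 : wedge M ⬝ᵥ wedge M ≠ 0 := by simpa using h
  have hdet : (Matrix.of (Fin.cons (wedge M) M : Fin (d + 1) → Fin (d + 1) → ℝ)).det ≠ 0 := by
    rwa [← wedge_dotProduct]
  -- The coefficient of the orthogonal projection: the remainder is killed by the normal and by all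
  -- `M k`, which form an invertible matrix.
  refine ⟨(wedge M ⬝ᵥ v) / (wedge M ⬝ᵥ wedge M), ?_⟩
  rw [← sub_eq_zero]
  refine Matrix.eq_zero_of_mulVec_eq_zero hdet ?_
  funext i
  refine Fin.cases ?_ (fun k => ?_) i
  · simp [Matrix.mulVec, dotProduct_sub, dotProduct_smul, div_mul_cancel₀ _ h1]
  · simp [Matrix.mulVec, dotProduct_sub, dotProduct_smul, hv, dotProduct_comm (M k) (wedge M),
      wedge_dotProduct_self]

/-- `d` hyperplanes, each spanned by `d` vectors, whose normal vectors are independent. -/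
theorem finrank_and_iInf_of_wedge_ne_zero {y : Fin d → Fin d → Vec d}
    (h : wedge (fun k => wedge (y k)) ≠ 0) :
    (∀ k, Module.finrank ℝ (⨆ l, Submodule.span ℝ {y k l} : Submodule ℝ (Vec d)) = d) ∧
      (⨅ k, ⨆ l, Submodule.span ℝ {y k l}) =
        Submodule.span ℝ {wedge fun k => wedge (y k)} := by
  have hne : ∀ k, wedge (y k) ≠ 0 := fun k =>
    (linearIndependent_of_wedge_ne_zero h).ne_zero k
  refine ⟨fun k => ?_, ?_⟩
  · rw [← Submodule.span_range_eq_iSup, finrank_span_eq_card (linearIndependent_of_wedge_ne_zero (hne k)), Fintype.card_fin]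
  · ext v
    simp only [← Submodule.span_range_eq_iSup, Submodule.mem_iInf, mem_span_iff_wedge_dotProduct (hne _),
      Submodule.mem_span_singleton]
    refine ⟨fun hv => ?_, ?_⟩
    · obtain ⟨a, ha⟩ := exists_smul_wedge h hv
      exact ⟨a, ha.symm⟩
    · rintro ⟨a, rfl⟩ k
      rw [dotProduct_smul, dotProduct_comm, wedge_dotProduct_self (fun k => wedge (y k)) k, smul_zero]

end Wedge

/-! ### The leading order configuration on the rational normal curve -/

section Moment

open Polynomial

variable {d : ℕ}

theorem natDegree_prod_X_sub_C_fin (a : Fin d → ℝ) : (∏ l, (X - C (a l))).natDegree = d := by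
  simp

theorem coeff_prod_X_sub_C_top (a : Fin d → ℝ) : (∏ l, (X - C (a l))).coeff d = 1 := by
  have := (monic_prod_X_sub_C a Finset.univ).coeff_natDegree
  rwa [natDegree_prod_X_sub_C_fin] at this

/-- The difference of the two sides has degree below `d` and `d` distinct roots. -/
theorem eq_C_mul_prod_of_roots {P : ℝ[X]} (hP : P.natDegree ≤ d) {a : Fin d → ℝ}
    (ha : Function.Injective a) (h : ∀ l, P.eval (a l) = 0) :
    P = C (P.coeff d) * ∏ l, (X - C (a l)) := by
  have hdeg := natDegree_prod_X_sub_C_fin a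
  rw [← sub_eq_zero]
  refine eq_zero_of_degree_lt_of_eval_index_eq_zero Finset.univ (v := a) ha.injOn ?_ fun l _ => ?_
  · rw [Finset.card_univ, Fintype.card_fin, degree_lt_iff_coeff_zero]
    intro m hm
    rcases eq_or_lt_of_le hm with rfl | hm
    · rw [coeff_sub, coeff_C_mul, coeff_prod_X_sub_C_top, mul_one, sub_self]
    · rw [coeff_sub, coeff_C_mul, coeff_eq_zero_of_natDegree_lt (lt_of_le_of_lt hP hm),
        coeff_eq_zero_of_natDegree_lt (hdeg.trans_lt hm)]
      simp
  · rw [eval_sub, h, eval_mul, eval_prod, Finset.prod_eq_zero (Finset.mem_univ l)] <;> simp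

/-- Newton's identity `2 e₂ = p₁² - p₂`, by adding one root at a time. -/
theorem coeff_prod_X_sub_C_second {ι : Type} [DecidableEq ι] (a : ι → ℝ) (s : Finset ι) :
    ∀ m, s.card = m + 2 → 2 * (∏ l ∈ s, (X - C (a l))).coeff m =
      (∑ l ∈ s, a l) ^ 2 - ∑ l ∈ s, a l ^ 2 := by
  induction s using Finset.induction_on with
  | empty => intro m hm; simp at hm
  | insert i s hi ih =>
    intro m hm
    rw [Finset.card_insert_of_notMem hi] at hm
    have hcard : s.card = m + 1 := by omega
    have h1 : (∏ l ∈ s, (X - C (a l))).coeff m = -∑ l ∈ s, a l := by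
      have := prod_X_sub_C_coeff_card_pred s a (by omega)
      rwa [hcard, Nat.add_sub_cancel] at this
    rw [Finset.prod_insert hi, Finset.sum_insert hi, Finset.sum_insert hi, sub_mul, coeff_sub,
      coeff_C_mul, h1]
    cases m with
    | zero =>
      obtain ⟨b, rfl⟩ := Finset.card_eq_one.1 hcard
      simp; ring
    | succ m =>
      have := ih m (by omega)
      rw [coeff_X_mul]
      linear_combination this

/-- The centers `-(d-1)/2, …, (d-1)/2` of the short diagonals. -/
noncomputable def center (d : ℕ) (k : Fin d) : ℝ := ((k : ℕ) : ℝ) - ((d : ℝ) - 1) / 2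

/-- The parameter of the `l`-th vertex in the `k`-th short diagonal. -/
noncomputable def node (d : ℕ) (k l : Fin d) : ℝ := center d k + 2 * center d l

theorem center_rev (k : Fin d) : center d k.rev = -center d k := by
  simp only [center, Fin.val_rev]
  rw [Nat.cast_sub k.2]
  push_cast
  ring

theorem node_rev (k l : Fin d) : node d k.rev l.rev = -node d k l := by
  simp only [node, center_rev]; ring

theorem center_injective : Function.Injective (center d) := fun k l h => by
  simp only [center, sub_left_inj, Nat.cast_inj] at h
  exact Fin.ext h

theorem sum_center : ∑ k, center d k = 0 := by
  have h := Equiv.sum_comp Fin.revPerm (center d)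
  simp only [Fin.revPerm_apply, center_rev, Finset.sum_neg_distrib] at h
  linarith

theorem sum_center_sq_pos (hd : 2 ≤ d) : 0 < ∑ k, center d k ^ 2 := by
  have h0 : center d ⟨0, by omega⟩ ≠ 0 := by
    have : (2 : ℝ) ≤ d := by exact_mod_cast hd
    simp only [center, Nat.cast_zero]
    intro h
    linarith
  exact lt_of_lt_of_le (sq_pos_of_ne_zero h0)
    (Finset.single_le_sum (f := fun k => center d k ^ 2) (fun k _ => sq_nonneg _)
      (Finset.mem_univ (⟨0, by omega⟩ : Fin d)))

/-- The point with parameter `t` on the rational normal curve. -/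
noncomputable def moment (d : ℕ) (t : ℝ) : Vec d := fun j => t ^ (j : ℕ)

theorem det_cons_moment (t : ℝ) (h : Fin d → ℝ) :
    (Matrix.of (Fin.cons (moment d t) (fun l => moment d (h l)) :
      Fin (d + 1) → Fin (d + 1) → ℝ)) = Matrix.vandermonde (Fin.cons t h) := by
  ext i j
  refine Fin.cases ?_ (fun i => ?_) i <;> simp [moment, Matrix.vandermonde]

/-- Pairing the normal with `moment d t` gives a polynomial in `t` of degree at most `d` that
vanishes at every `h l`. It is not zero, because at any other `t` it is a nonzero Vandermonde
determinant. -/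
theorem exists_sum_wedge_moment {h : Fin d → ℝ} (hh : Function.Injective h) :
    ∃ a : ℝ, a ≠ 0 ∧ ∑ j, C (wedge (fun l => moment d (h l)) j) * X ^ (j : ℕ) =
      C a * ∏ l, (X - C (h l)) := by
  set P : ℝ[X] := ∑ j, C (wedge (fun l => moment d (h l)) j) * X ^ (j : ℕ) with hP
  have heval : ∀ t, P.eval t = wedge (fun l => moment d (h l)) ⬝ᵥ moment d t := fun t => by
    simp [hP, eval_finsetSum, dotProduct, moment]
  have hdeg : P.natDegree ≤ d := natDegree_sum_le_of_forall_le _ _ fun j _ =>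
    (natDegree_C_mul_X_pow_le _ _).trans (Nat.lt_succ_iff.1 j.2)
  have hroot : ∀ l, P.eval (h l) = 0 := fun l => by
    rw [heval]; exact wedge_dotProduct_self (fun l => moment d (h l)) l
  refine ⟨P.coeff d, fun h0 => ?_, eq_C_mul_prod_of_roots hdeg hh hroot⟩
  have hP0 : P = 0 := by rw [eq_C_mul_prod_of_roots hdeg hh hroot, h0]; simp
  obtain ⟨t, ht⟩ := (Set.finite_range h).exists_notMem
  have h1 := heval t
  rw [hP0, eval_zero, wedge_dotProduct, det_cons_moment] at h1
  refine Matrix.det_vandermonde_ne_zero_iff.2 ?_ h1.symm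
  rw [Fin.cons_injective_iff]
  exact ⟨ht, hh⟩

/-- The polynomial identity satisfied by a point in all short diagonals of the rational normal
curve. -/
theorem sum_hasseDeriv_eq {v : Vec d}
    (hv : ∀ k, wedge (fun l => moment d (node d k l)) ⬝ᵥ v = 0) :
    ∑ j, C (v j) * hasseDeriv (j : ℕ) (∏ l, (X - C (2 * center d l))) =
      C (v 0) * ∏ k, (X - C (-center d k)) := by
  set q : ℝ[X] := ∏ l, (X - C (2 * center d l)) with hq
  have hqdeg : q.natDegree = d := natDegree_prod_X_sub_C_fin _
  have hqtop : q.coeff d = 1 := coeff_prod_X_sub_C_top _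
  set Q : ℝ[X] := ∑ j, C (v j) * hasseDeriv (j : ℕ) q with hQ
  have hdeg : Q.natDegree ≤ d := natDegree_sum_le_of_forall_le _ _ fun j _ =>
    (natDegree_C_mul_le _ _).trans ((natDegree_hasseDeriv_le _ _).trans (by omega))
  have hcoeff : Q.coeff d = v 0 := by
    rw [hQ, finsetSum_coeff, Finset.sum_eq_single 0]
    · simp [hqtop]
    · intro j _ hj
      have : 0 < (j : ℕ) := Nat.pos_of_ne_zero fun h => hj (Fin.ext h)
      rw [coeff_C_mul, hasseDeriv_coeff, coeff_eq_zero_of_natDegree_lt (p := q) (by omega)]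
      simp
    · simp
  rw [← hcoeff]
  refine eq_C_mul_prod_of_roots hdeg (fun k l h => center_injective (neg_injective h)) fun k => ?_
  have hinj : Function.Injective (node d k) := fun l l' h => center_injective (by
    simpa [node] using h)
  obtain ⟨a, ha, hP⟩ := exists_sum_wedge_moment hinj
  -- All the short diagonals are translates of one configuration, so the coefficients of the `k`-th
  -- normal are, up to the factor `a`, the Taylor coefficients of `q` at `-center d k`. The pairing
  -- with `v` is then `a` times the value of `Q` there.
  have htaylor : ∏ l, (X - C (node d k l)) = taylor (-center d k) q := by
    rw [taylor_apply, hq, prod_comp]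
    refine Finset.prod_congr rfl fun l _ => ?_
    simp [node]; ring
  have hcoef : ∀ j : Fin (d + 1), wedge (fun l => moment d (node d k l)) j =
      a * (hasseDeriv (j : ℕ) q).eval (-center d k) := fun j => by
    rw [← taylor_coeff, ← htaylor, ← coeff_C_mul, ← hP, finsetSum_coeff,
      Finset.sum_eq_single j]
    · simp
    · intro i _ hi
      have : (j : ℕ) ≠ i := fun h => hi (Fin.ext h.symm)
      simp [coeff_X_pow, this]
    · simp
  have h0 := hv k
  simp only [dotProduct, hcoef, mul_assoc, ← Finset.mul_sum] at h0
  rw [hQ, eval_finsetSum]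
  simpa [mul_comm] using (mul_eq_zero.1 h0).resolve_left ha

theorem coeff_sum_hasseDeriv (v : Vec d) (q : ℝ[X]) (m : ℕ) :
    (∑ j, C (v j) * hasseDeriv (j : ℕ) q).coeff m =
      ∑ j, v j * ((m + j).choose j * q.coeff (m + j)) := by
  simp [hasseDeriv_coeff]

/-- With `v 0 = 0` the right side of `sum_hasseDeriv_eq` vanishes. The left side is triangular: once
the earlier coordinates are zero, the coefficient of degree `d - n` is `v n` times a binomial
coefficient. -/
theorem eq_zero_of_zero_coord {v : Vec d}
    (hv : ∀ k, wedge (fun l => moment d (node d k l)) ⬝ᵥ v = 0) (h0 : v 0 = 0) : v = 0 := by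
  have hsum := sum_hasseDeriv_eq hv
  set q : ℝ[X] := ∏ l, (X - C (2 * center d l)) with hq
  have hqdeg : q.natDegree = d := natDegree_prod_X_sub_C_fin _
  have hqtop : q.coeff d = 1 := coeff_prod_X_sub_C_top _
  have key : ∀ n (hn : n < d + 1), v ⟨n, hn⟩ = 0 := by
    intro n
    induction n using Nat.strong_induction_on with
    | _ n ih =>
      intro hn
      have h1 := congrArg (fun p => coeff p (d - n)) hsum
      simp only [h0, map_zero, zero_mul, coeff_zero] at h1
      rw [coeff_sum_hasseDeriv, Finset.sum_eq_single (⟨n, hn⟩ : Fin (d + 1))] at h1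
      · rw [show d - n + n = d by omega, hqtop, mul_one] at h1
        refine (mul_eq_zero.1 h1).resolve_right ?_
        exact_mod_cast (Nat.choose_pos (Nat.lt_succ_iff.1 hn)).ne'
      · intro j _ hj
        rcases lt_or_gt_of_ne (fun h : (j : ℕ) = n => hj (Fin.ext h)) with h | h
        · rw [ih j h j.2, zero_mul]
        · rw [coeff_eq_zero_of_natDegree_lt (p := q) (by omega)]
          simp
      · simp
  funext i
  exact key i i.2

/-- The intersection point of the short diagonals of the rational normal curve. -/
noncomputable def leadingPoint (d : ℕ) : Vec d := wedge fun k => wedge fun l => moment d (node d k l)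

theorem wedge_dotProduct_leadingPoint (k : Fin d) :
    wedge (fun l => moment d (node d k l)) ⬝ᵥ leadingPoint d = 0 := by
  rw [dotProduct_comm]
  exact wedge_dotProduct_self (fun k => wedge fun l => moment d (node d k l)) k

/-- This coordinate is the determinant of `e₀` and the `d` normals; a kernel vector would contradict
`eq_zero_of_zero_coord`. It is the transversality of the limiting short diagonals. -/
theorem leadingPoint_zero_ne_zero : leadingPoint d 0 ≠ 0 := by
  have h1 : leadingPoint d 0 = leadingPoint d ⬝ᵥ Pi.single 0 1 := by simp
  rw [h1, leadingPoint, wedge_dotProduct]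
  intro hdet
  obtain ⟨v, hv, hv0⟩ := Matrix.exists_mulVec_eq_zero_iff.2 hdet
  refine hv (eq_zero_of_zero_coord (fun k => ?_) ?_)
  · simpa [Matrix.mulVec] using congrFun hv0 k.succ
  · simpa [Matrix.mulVec] using congrFun hv0 0

/-- The centers sum to zero, so neither product in `sum_hasseDeriv_eq` has a term of degree `d - 1`.
-/
theorem leadingPoint_one (h1 : 1 < d + 1) : leadingPoint d ⟨1, h1⟩ = 0 := by
  have hsum := sum_hasseDeriv_eq (v := leadingPoint d) wedge_dotProduct_leadingPoint
  set q : ℝ[X] := ∏ l, (X - C (2 * center d l)) with hq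
  have hqdeg : q.natDegree = d := natDegree_prod_X_sub_C_fin _
  have hqtop : q.coeff d = 1 := coeff_prod_X_sub_C_top _
  have hcard : 0 < (Finset.univ : Finset (Fin d)).card := by simp; omega
  have hq1 : q.coeff (d - 1) = 0 := by
    have := prod_X_sub_C_coeff_card_pred Finset.univ (fun l : Fin d => 2 * center d l) hcard
    rwa [← Finset.mul_sum, sum_center, Finset.card_univ, Fintype.card_fin, mul_zero, neg_zero]
      at this
  have hr1 : (∏ k, (X - C (-center d k))).coeff (d - 1) = 0 := by
    have := prod_X_sub_C_coeff_card_pred Finset.univ (fun l : Fin d => -center d l) hcard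
    rwa [Finset.sum_neg_distrib, sum_center, Finset.card_univ, Fintype.card_fin, neg_zero,
      neg_zero] at this
  have h2 := congrArg (fun p => coeff p (d - 1)) hsum
  simp only [coeff_C_mul, hr1, mul_zero] at h2
  rw [coeff_sum_hasseDeriv, Finset.sum_eq_single (⟨1, h1⟩ : Fin (d + 1))] at h2
  · rw [show d - 1 + 1 = d by omega, hqtop, mul_one, Nat.choose_one_right] at h2
    exact (mul_eq_zero.1 h2).resolve_right (by exact_mod_cast (by omega : d ≠ 0))
  · intro j _ hj
    rcases lt_or_gt_of_ne (fun h : (j : ℕ) = 1 => hj (Fin.ext h)) with h | h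
    · rw [show (j : ℕ) = 0 by omega, add_zero, hq1]; simp
    · rw [coeff_eq_zero_of_natDegree_lt (p := q) (by omega)]
      simp
  · simp

/-- The coefficient of degree `d - 2`: the roots `2 center` and `-center` contribute `-2` and `-1/2`
times the sum of squares, and the gap `3/2` is balanced by `d.choose 2` times this coordinate. -/
theorem leadingPoint_two (h2 : 2 < d + 1) :
    (d : ℝ) * (d - 1) * leadingPoint d ⟨2, h2⟩ =
      3 * (∑ k, center d k ^ 2) * leadingPoint d 0 := by
  have hsum := sum_hasseDeriv_eq (v := leadingPoint d) wedge_dotProduct_leadingPoint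
  set q : ℝ[X] := ∏ l, (X - C (2 * center d l)) with hq
  have hqdeg : q.natDegree = d := natDegree_prod_X_sub_C_fin _
  have hqtop : q.coeff d = 1 := coeff_prod_X_sub_C_top _
  obtain ⟨m, rfl⟩ : ∃ m, d = m + 2 := ⟨d - 2, by omega⟩
  have hq2 : 2 * q.coeff m = -(4 * ∑ k, center (m + 2) k ^ 2) := by
    have := coeff_prod_X_sub_C_second (fun l : Fin (m + 2) => 2 * center (m + 2) l) Finset.univ m
      (by simp)
    rw [← Finset.mul_sum, sum_center] at this
    rw [hq, this, Finset.mul_sum, ← Finset.sum_neg_distrib]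
    simp only [mul_zero, ne_eq, OfNat.ofNat_ne_zero, not_false_eq_true, zero_pow, zero_sub]
    rw [← Finset.sum_neg_distrib]
    exact Finset.sum_congr rfl fun _ _ => by ring
  have hr2 : 2 * (∏ k, (X - C (-center (m + 2) k))).coeff m = -∑ k, center (m + 2) k ^ 2 := by
    have := coeff_prod_X_sub_C_second (fun l : Fin (m + 2) => -center (m + 2) l) Finset.univ m
      (by simp)
    rw [Finset.sum_neg_distrib, sum_center] at this
    rw [this]; simp
  have h3 := congrArg (fun p => coeff p m) hsum
  simp only [coeff_C_mul] at h3
  rw [coeff_sum_hasseDeriv, Fin.sum_univ_succ, Fin.sum_univ_succ, Fin.sum_univ_succ,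
    Finset.sum_eq_zero] at h3
  · have hl1 : leadingPoint (m + 2) (Fin.succ 0) = 0 := leadingPoint_one (by omega)
    have hl2 : leadingPoint (m + 2) (Fin.succ (Fin.succ 0)) = leadingPoint (m + 2) ⟨2, h2⟩ := rfl
    have hch : ((m + 2).choose 2 : ℝ) = (m + 2) * (m + 1) / 2 := by
      rw [Nat.cast_choose_two]; push_cast; ring
    rw [hl1, hl2] at h3
    simp only [Fin.val_zero, Fin.val_succ, add_zero, zero_add, Nat.choose_zero_right, Nat.cast_one,
      one_mul, zero_mul, Nat.reduceAdd, hqtop, hch, mul_one] at h3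
    push_cast
    linear_combination 2 * h3 - leadingPoint (m + 2) 0 * hq2 + leadingPoint (m + 2) 0 * hr2
  · intro j _
    rw [coeff_eq_zero_of_natDegree_lt (p := q) (by simp [hqdeg])]
    simp

end Moment

/-! ### Smooth extensions and Taylor expansions -/

/-- A bump function cuts `g` off. Reciprocals and roots can then be composed into globally smooth
families, their defining equations being needed only for small `ε`. -/
theorem exists_contDiff_eventuallyEq {g : ℝ → ℝ} {s : Set ℝ} (hs : IsOpen s)
    (hg : ∀ x ∈ s, ContDiffAt ℝ ∞ g x) {a : ℝ} (ha : a ∈ s) :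
    ∃ f : ℝ → ℝ, ContDiff ℝ ∞ f ∧ f =ᶠ[𝓝 a] g := by
  obtain ⟨r, hr, hrs⟩ := Metric.isOpen_iff.1 hs a ha
  let φ : ContDiffBump a := ⟨r / 3, r / 2, by positivity, by linarith⟩
  refine ⟨fun x => φ x * g x, contDiff_iff_contDiffAt.2 fun x => ?_, ?_⟩
  · by_cases hx : x ∈ s
    · exact (φ.contDiff.contDiffAt).mul (hg x hx)
    · have hx' : x ∉ tsupport φ := fun h => hx (hrs (by
        rw [φ.tsupport_eq] at h
        exact lt_of_le_of_lt (Metric.mem_closedBall.1 h) (by change r / 2 < r; linarith)))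
      have : (fun x => φ x * g x) =ᶠ[𝓝 x] fun _ => 0 := by
        filter_upwards [notMem_tsupport_iff_eventuallyEq.1 hx'] with y hy
        simp [hy]
      exact contDiffAt_const.congr_of_eventuallyEq this
  · filter_upwards [φ.eventuallyEq_one] with x hx
    simp [hx]

theorem exists_contDiff_inv {a : ℝ} (ha : a ≠ 0) :
    ∃ f : ℝ → ℝ, ContDiff ℝ ∞ f ∧ ∀ᶠ w in 𝓝 a, f w * w = 1 := by
  obtain ⟨f, hf, h⟩ := exists_contDiff_eventuallyEq (g := fun x => x⁻¹) isOpen_ne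
    (fun x hx => contDiffAt_inv ℝ hx) ha
  refine ⟨f, hf, ?_⟩
  filter_upwards [h, isOpen_ne.mem_nhds ha] with w hw hw0
  rw [hw, inv_mul_cancel₀ hw0]

theorem exists_contDiff_inv_root (n : ℕ) :
    ∃ f : ℝ → ℝ, ContDiff ℝ ∞ f ∧ f 1 = 1 ∧ ∀ᶠ w in 𝓝 (1 : ℝ), f w ^ (n + 1) * w = 1 := by
  obtain ⟨f, hf, h⟩ := exists_contDiff_eventuallyEq
    (g := fun x : ℝ => x ^ (-(1 / ((n : ℝ) + 1)))) (isOpen_Ioi (a := (0 : ℝ)))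
    (fun x hx => Real.contDiffAt_rpow_const_of_ne (ne_of_gt hx)) (a := 1) (by simp)
  refine ⟨f, hf, by simpa using h.eq_of_nhds, ?_⟩
  filter_upwards [h, isOpen_Ioi.mem_nhds (show (1 : ℝ) ∈ Set.Ioi 0 by simp)] with w hw hw0
  have hn : (n : ℝ) + 1 ≠ 0 := by positivity
  rw [hw, ← Real.rpow_natCast, ← Real.rpow_mul (le_of_lt hw0)]
  push_cast
  rw [neg_mul, one_div, inv_mul_cancel₀ hn, Real.rpow_neg_one, inv_mul_cancel₀ (ne_of_gt hw0)]

section Taylor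

variable {d : ℕ}

/-- The integral form of the remainder is used because it is jointly smooth in step and base point.
-/
theorem exists_taylor {E : Type} [NormedAddCommGroup E] [NormedSpace ℝ E] [CompleteSpace E]
    {Γ : ℝ → E} (hΓ : ContDiff ℝ ∞ Γ) (n : ℕ) :
    ∃ ρ : ℝ × ℝ → E, ContDiff ℝ ∞ ρ ∧ ∀ ε x, Γ (x + ε) =
      ∑ j ∈ Finset.range (n + 1), (ε ^ j / (j.factorial : ℝ)) • iteratedDeriv j Γ x +
        ε ^ (n + 1) • ρ (ε, x) := by
  have hsm : ContDiff ℝ ∞ (iteratedDeriv (n + 1) Γ) :=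
    contDiff_slice (contDiff_iteratedDeriv_slice (n + 1) (F := fun q : ℝ × ℝ => Γ q.2)
      (hΓ.comp contDiff_snd)) 0
  refine ⟨fun q => (n.factorial : ℝ)⁻¹ • ∫ t in (0 : ℝ)..1, (1 - t) ^ n •
    iteratedDeriv (n + 1) Γ (q.2 + t * q.1), ?_, fun ε x => ?_⟩
  · refine ContDiff.const_smul _ (contDiff_infty_intervalIntegral
      (f := fun z : (ℝ × ℝ) × ℝ => (1 - z.2) ^ n • iteratedDeriv (n + 1) Γ (z.1.2 + z.2 * z.1.1)) ?_)
    exact ContDiff.smul (by fun_prop) (hsm.comp (by fun_prop))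
  · have := map_add_eq_sum_add_integral_iteratedFDeriv (f := Γ) (x := x) (y := ε) (n := n)
      (fun t _ => hΓ.contDiffAt.of_le (by exact_mod_cast le_top))
    simp only [iteratedFDeriv_apply_eq_iteratedDeriv_mul_prod, Finset.prod_const, Finset.card_univ,
      Fintype.card_fin, smul_eq_mul] at this
    rw [this]
    congr 1
    · refine Finset.sum_congr rfl fun j _ => ?_
      rw [smul_smul, div_eq_inv_mul]
    · rw [smul_comm (ε ^ (n + 1)), ← intervalIntegral.integral_smul (ε ^ (n + 1))]
      simp only [smul_comm (ε ^ (n + 1))]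

/-- The anisotropic rescaling of coordinates in the basis `Γ(x), …, Γ^{(d)}(x)`. -/
noncomputable def rescale (ε : ℝ) (y : Vec d) : Vec d :=
  fun j => ε ^ (j : ℕ) / ((j : ℕ).factorial : ℝ) * y j

theorem rescale_injective {ε : ℝ} (hε : ε ≠ 0) : Function.Injective (rescale (d := d) ε) := by
  intro y z h
  funext j
  have := congrFun h j
  simp only [rescale] at this
  exact mul_left_cancel₀ (by positivity) this

theorem smooth_rescale {y : ℝ × ℝ → Vec d} (hy : ContDiff ℝ ∞ y) :
    ContDiff ℝ ∞ fun q : ℝ × ℝ => rescale q.1 (y q) := by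
  refine contDiff_pi.2 fun j => ?_
  have := contDiff_pi.1 hy j
  simp only [rescale, div_eq_mul_inv]
  fun_prop

variable {Γ : ℝ → Vec d}

theorem vecMul_jetMatrix_injective {x : ℝ} (hdet : (jetMatrix d Γ x).det = 1) :
    Function.Injective fun v : Vec d => v ᵥ* jetMatrix d Γ x :=
  Matrix.vecMul_injective_of_isUnit
    ((Matrix.isUnit_iff_isUnit_det _).2 (by rw [hdet]; exact isUnit_one))

/-- In rescaled coordinates, `Γ(x + hε)` is a perturbation of order `ε²` of the rational normal
curve. -/
theorem exists_moment_expansion (hΓ : ContDiff ℝ ∞ Γ) (hdet : ∀ x, (jetMatrix d Γ x).det = 1)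
    (h : ℝ) : ∃ e : ℝ × ℝ → Vec d, ContDiff ℝ ∞ e ∧ ∀ ε x, Γ (x + h * ε) =
      rescale ε (moment d h + ε ^ 2 • e (ε, x)) ᵥ* jetMatrix d Γ x := by
  obtain ⟨ρ, hρ, hT⟩ := exists_taylor hΓ (d + 1)
  let t : ℝ × ℝ → Vec d := fun q => ρ (h * q.1, q.2) ᵥ* (jetMatrix d Γ q.2)⁻¹
  have ht : ContDiff ℝ ∞ t := by
    refine SmoothEntries.vecMul (hρ.comp (by fun_prop)) ?_
    exact ((smoothEntries_jetMatrix hΓ).inv_of_det_eq_one hdet).comp contDiff_snd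
  have hte : ∀ ε x, ρ (h * ε, x) = t (ε, x) ᵥ* jetMatrix d Γ x := fun ε x => by
    simp only [t]
    rw [Matrix.vecMul_vecMul, Matrix.nonsing_inv_mul _ (by rw [hdet]; exact isUnit_one),
      Matrix.vecMul_one]
  have htop := contDiff_topCoord hΓ hdet
  -- These powers are `ε^{d+1}` and `ε^{d+2}` divided by `ε^j ε²`. For `j = d` the first exponent is
  -- truncated, harmlessly, since `topCoord` vanishes there; this is where the normalization
  -- improves the error from `ε` to `ε²`.
  refine ⟨fun q j => ((j : ℕ).factorial : ℝ) * (h ^ (d + 1) * q.1 ^ (d - 1 - (j : ℕ)) *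
    (((d + 1).factorial : ℝ)⁻¹ * topCoord d Γ q.2 j) +
      h ^ (d + 2) * q.1 ^ (d - (j : ℕ)) * t q j), ?_, fun ε x => ?_⟩
  · refine contDiff_pi.2 fun j => ?_
    have h1 := contDiff_pi.1 ht j
    have h2 : ContDiff ℝ ∞ fun q : ℝ × ℝ => topCoord d Γ q.2 j :=
      (contDiff_pi.1 htop j).comp contDiff_snd
    fun_prop
  · rw [hT, Finset.sum_range_succ, ← topCoord_vecMul_jetMatrix (hdet x), hte,
      ← Fin.sum_univ_eq_sum_range (fun j => ((h * ε) ^ j / (j.factorial : ℝ)) • iteratedDeriv j Γ x)]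
    have hsum : ∑ j : Fin (d + 1), ((h * ε) ^ (j : ℕ) / ((j : ℕ).factorial : ℝ)) •
        iteratedDeriv (j : ℕ) Γ x =
        (fun j : Fin (d + 1) => (h * ε) ^ (j : ℕ) / ((j : ℕ).factorial : ℝ)) ᵥ* jetMatrix d Γ x := by
      rw [Matrix.vecMul_eq_sum]; rfl
    rw [hsum, ← Matrix.smul_vecMul, ← Matrix.smul_vecMul, ← Matrix.add_vecMul, ← Matrix.add_vecMul]
    congr 1
    funext j
    have hj0 : ((j : ℕ).factorial : ℝ) ≠ 0 := by positivity
    have hexp2 : ε ^ (j : ℕ) * ε ^ 2 * ε ^ (d - (j : ℕ)) = ε ^ (d + 2) := by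
      rw [← pow_add, ← pow_add]; congr 1; have := j.2; omega
    have hexp1 : ε ^ (j : ℕ) * ε ^ 2 * ε ^ (d - 1 - (j : ℕ)) * topCoord d Γ x j =
        ε ^ (d + 1) * topCoord d Γ x j := by
      by_cases hj : (j : ℕ) < d
      · rw [← pow_add, ← pow_add]; congr 2; omega
      · have : j = Fin.last d := Fin.ext (by have := j.2; simp; omega)
        rw [this, topCoord_last hΓ hdet]; simp
    simp only [Pi.add_apply, Pi.smul_apply, smul_eq_mul, rescale, moment]
    rw [mul_pow, mul_pow, mul_pow, div_mul_eq_mul_div, div_mul_eq_mul_div, eq_div_iff hj0,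
      add_mul, add_mul, div_mul_cancel₀ _ hj0, div_eq_mul_inv]
    linear_combination (-h ^ (d + 2) * t (ε, x) j * ((j : ℕ).factorial : ℝ)) * hexp2 -
      h ^ (d + 1) * ((d + 1).factorial : ℝ)⁻¹ * ((j : ℕ).factorial : ℝ) * hexp1

/-- The intersection point of the short diagonals in rescaled coordinates. -/
theorem exists_rescaled_image (hΓ : ContDiff ℝ ∞ Γ) (hdet : ∀ x, (jetMatrix d Γ x).det = 1)
    {B : Matrix (Fin (d + 1)) (Fin (d + 1)) ℝ} {T : ℝ}
    (hB : ∀ x, Γ (x + T) = Γ x ᵥ* B) :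
    ∃ (y : Fin d → Fin d → ℝ × ℝ → Vec d) (Z : ℝ × ℝ → Vec d),
      (∀ k l ε x, Γ (x + node d k l * ε) = rescale ε (y k l (ε, x)) ᵥ* jetMatrix d Γ x) ∧
      (∀ ε x, (wedge fun k => wedge fun l => y k l (ε, x + T)) =
        wedge fun k => wedge fun l => y k l (ε, x)) ∧
      ContDiff ℝ ∞ Z ∧
      ∀ ε x, (wedge fun k => wedge fun l => y k l (ε, x)) = leadingPoint d + ε ^ 2 • Z (ε, x) := by
  choose e he hexp using fun h : ℝ => exists_moment_expansion hΓ hdet h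
  -- The factor `ε²` is made an independent variable, so that Hadamard's lemma extracts it whole.
  let Ψ : ℝ × (ℝ × ℝ) → Vec d := fun q => wedge fun k => wedge fun l =>
    moment d (node d k l) + q.1 • e (node d k l) q.2
  have hΨ : ContDiff ℝ ∞ Ψ := smooth_wedge fun k => smooth_wedge fun l =>
    contDiff_const.add (contDiff_fst.smul ((he _).comp contDiff_snd))
  obtain ⟨G, hG, hGe, -⟩ := exists_hadamard hΨ
  refine ⟨fun k l q => moment d (node d k l) + q.1 ^ 2 • e (node d k l) q,
    fun q => G (q.1 ^ 2, q), fun k l ε x => hexp _ ε x, fun ε x => ?_, hG.comp (by fun_prop),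
    fun ε x => ?_⟩
  -- The jet matrix absorbs the monodromy, so the rescaled coordinates are genuinely periodic; at `ε
  -- = 0` they are constant.
  · congr 1; funext k; congr 1; funext l
    by_cases hε : ε = 0
    · simp [hε]
    · refine rescale_injective hε (vecMul_jetMatrix_injective (hdet (x + T)) ?_)
      simp only
      rw [← hexp, jetMatrix_monodromy hΓ hB, ← Matrix.vecMul_vecMul, ← hexp, add_right_comm, hB]
  · have := hGe (ε ^ 2) (ε, x)
    simpa [Ψ, leadingPoint] using this

end Taylor

/-! ### The image curve -/

section Image

variable {d : ℕ} {Γ : ℝ → Vec d}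

/-- The rescaled coordinates as a linear automorphism. -/
noncomputable def rescaleEquiv {ε x : ℝ} (hε : ε ≠ 0) (hdet : (jetMatrix d Γ x).det = 1) :
    Vec d ≃ₗ[ℝ] Vec d :=
  LinearEquiv.ofInjectiveEndo
    { toFun := fun v => rescale ε v ᵥ* jetMatrix d Γ x
      map_add' := fun v w => by
        rw [← Matrix.add_vecMul]; congr 1; funext j; simp [rescale, mul_add]
      map_smul' := fun a v => by
        rw [← Matrix.smul_vecMul]; congr 1; funext j; simp [rescale]; ring }
    ((vecMul_jetMatrix_injective hdet).comp (rescale_injective hε))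

theorem map_span_singleton (e : Vec d ≃ₗ[ℝ] Vec d) (v : Vec d) :
    Submodule.map (e : Vec d →ₗ[ℝ] Vec d) (Submodule.span ℝ {v}) = Submodule.span ℝ {e v} := by
  rw [Submodule.map_span, Set.image_singleton]; rfl

theorem span_image_of_wedge_ne_zero {y : Fin d → Fin d → Vec d} {p : Fin d → Fin d → Vec d}
    (e : Vec d ≃ₗ[ℝ] Vec d) (hp : ∀ k l, p k l = e (y k l))
    (h : wedge (fun k => wedge (y k)) ≠ 0) :
    (∀ k, Module.finrank ℝ (⨆ l, Submodule.span ℝ {p k l} : Submodule ℝ (Vec d)) = d) ∧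
      (⨅ k, ⨆ l, Submodule.span ℝ {p k l}) =
        Submodule.span ℝ {e (wedge fun k => wedge (y k))} := by
  obtain ⟨h1, h2⟩ := finrank_and_iInf_of_wedge_ne_zero h
  have hmap : ∀ k, (⨆ l, Submodule.span ℝ {p k l}) =
      Submodule.map (e : Vec d →ₗ[ℝ] Vec d) (⨆ l, Submodule.span ℝ {y k l}) := fun k => by
    rw [Submodule.map_iSup]
    exact iSup_congr fun l => by rw [map_span_singleton, hp]
  refine ⟨fun k => ?_, ?_⟩
  · rw [hmap, LinearEquiv.finrank_map_eq, h1]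
  · simp only [hmap]
    rw [← map_span_singleton, ← h2]
    exact ((Submodule.orderIsoMapComap e).map_iInf _).symm

/-- The span of the intersection does not change when the step changes sign. -/
theorem iInf_iSup_span_neg (Γ : ℝ → Vec d) (ε x : ℝ) :
    (⨅ k, ⨆ l, Submodule.span ℝ {Γ (x + node d k l * -ε)}) =
      ⨅ k, ⨆ l, Submodule.span ℝ {Γ (x + node d k l * ε)} := by
  rw [← Equiv.iInf_comp Fin.revPerm]
  refine iInf_congr fun k => ?_
  rw [← Equiv.iSup_comp Fin.revPerm]
  refine iSup_congr fun l => ?_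
  simp [node_rev]

/-- The second order coefficient of the pentagram map. -/
noncomputable def pentagramCoeff (d : ℕ) : ℝ :=
  if 2 ≤ d then 3 * (∑ k, center d k ^ 2) / (2 * (d * (d - 1))) else 0

theorem tendsto_neg_nhdsNE : Tendsto (fun ε : ℝ => -ε) (𝓝[≠] 0) (𝓝[≠] 0) := by
  refine tendsto_nhdsWithin_iff.2 ⟨?_, ?_⟩
  · have : Tendsto (fun ε : ℝ => -ε) (𝓝 0) (𝓝 0) := by simpa using (continuous_neg (G := ℝ)).tendsto 0
    exact this.mono_left nhdsWithin_le_nhds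
  · filter_upwards [self_mem_nhdsWithin] with ε hε
    simpa using hε

theorem eq_of_eventuallyEq_nhdsNE {E : Type} [TopologicalSpace E] [T2Space E] {f g : ℝ → E}
    (hf : Continuous f) (hg : Continuous g) (h : ∀ᶠ ε in 𝓝[≠] (0 : ℝ), f ε = g ε) : f 0 = g 0 :=
  tendsto_nhds_unique ((hf.tendsto 0).mono_left nhdsWithin_le_nhds)
    (((hg.tendsto 0).mono_left nhdsWithin_le_nhds).congr' (h.mono fun _ h => h.symm))

/-- A smooth family of representatives of the intersection points, even in the step. -/
theorem exists_even_family (hd : 1 ≤ d) (hΓ : ContDiff ℝ ∞ Γ)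
    (hdet : ∀ x, (jetMatrix d Γ x).det = 1)
    {B : Matrix (Fin (d + 1)) (Fin (d + 1)) ℝ} {T : ℝ} (hT : 0 < T)
    (hB : ∀ x, Γ (x + T) = Γ x ᵥ* B) :
    ∃ G G₂ : ℝ × ℝ → Vec d, ContDiff ℝ ∞ G ∧ ContDiff ℝ ∞ G₂ ∧
      (∀ ε x, G (ε, x) = Γ x + ε ^ 2 • G₂ (ε, x)) ∧
      (∀ x, G₂ (0, x) = pentagramCoeff d • iteratedDeriv 2 Γ x) ∧
      (∀ ε x, G (ε, x + T) = G (ε, x) ᵥ* B) ∧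
      (∀ᶠ ε in 𝓝[≠] (0 : ℝ), ∀ x, G (-ε, x) = G (ε, x)) ∧
      (∀ᶠ ε in 𝓝[≠] (0 : ℝ), ∀ x, G₂ (-ε, x) = G₂ (ε, x)) ∧
      ∀ᶠ ε in 𝓝[≠] (0 : ℝ), ∀ x,
        (∀ k, Module.finrank ℝ
          (⨆ l, Submodule.span ℝ {Γ (x + node d k l * ε)} : Submodule ℝ (Vec d)) = d) ∧
        (⨅ k, ⨆ l, Submodule.span ℝ {Γ (x + node d k l * ε)}) = Submodule.span ℝ {G (ε, x)} := by
  obtain ⟨y, Z, hy, hper, hZ, hYZ⟩ := exists_rescaled_image hΓ hdet hB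
  set Y : ℝ × ℝ → Vec d := fun q => wedge fun k => wedge fun l => y k l q with hYdef
  have hYZ' : ∀ q, Y q = leadingPoint d + q.1 ^ 2 • Z q := fun q => hYZ q.1 q.2
  have hY : ContDiff ℝ ∞ Y := by
    rw [funext hYZ']
    exact contDiff_const.add ((contDiff_fst.pow 2).smul hZ)
  have hY0 : ∀ x, Y (0, x) = leadingPoint d := fun x => by simp [hYZ']
  obtain ⟨inv, hinv, hinv'⟩ := exists_contDiff_inv (leadingPoint_zero_ne_zero (d := d))
  have hYj : ∀ j, ContDiff ℝ ∞ fun q => Y q j := contDiff_pi.1 hY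
  set n : ℝ × ℝ → ℝ := fun q => inv (Y q 0) with hn
  have hns : ContDiff ℝ ∞ n := hinv.comp (hYj 0)
  have hnY : ∀ᶠ ε in 𝓝 (0 : ℝ), ∀ x, n (ε, x) * Y (ε, x) 0 = 1 :=
    eventually_forall_of_periodic (F := fun q => Y q 0) (hYj 0).continuous hT
      (fun ε x => congrFun (hper ε x) 0) (s := {w | inv w * w = 1})
      (fun x => by rw [hY0]; exact hinv')
  have hn0 : ∀ x, n (0, x) * leadingPoint d 0 = 1 := fun x => by
    have := hnY.self_of_nhds x
    rwa [hY0] at this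
  have hnY' := hnY.filter_mono (nhdsWithin_le_nhds (s := {0}ᶜ))
  set G : ℝ × ℝ → Vec d := fun q => rescale q.1 (n q • Y q) ᵥ* jetMatrix d Γ q.2 with hG
  have hGs : ContDiff ℝ ∞ G := SmoothEntries.vecMul (smooth_rescale (hns.smul hY))
    ((smoothEntries_jetMatrix hΓ).comp contDiff_snd)
  have hspan : ∀ ε, ε ≠ 0 → (∀ x, n (ε, x) * Y (ε, x) 0 = 1) → ∀ x,
        (∀ k, Module.finrank ℝ
          (⨆ l, Submodule.span ℝ {Γ (x + node d k l * ε)} : Submodule ℝ (Vec d)) = d) ∧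
        (⨅ k, ⨆ l, Submodule.span ℝ {Γ (x + node d k l * ε)}) = Submodule.span ℝ {G (ε, x)} := by
    intro ε hε h1 x
    have hYne : Y (ε, x) ≠ 0 := fun h => by
      have := h1 x
      rw [h] at this; simp at this
    have hnne : n (ε, x) ≠ 0 := left_ne_zero_of_mul_eq_one (h1 x)
    obtain ⟨h2, h3⟩ := span_image_of_wedge_ne_zero (y := fun k l => y k l (ε, x))
      (p := fun k l => Γ (x + node d k l * ε)) (rescaleEquiv hε (hdet x))
      (fun k l => hy k l ε x) hYne
    refine ⟨h2, h3.trans ?_⟩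
    have : G (ε, x) = n (ε, x) • rescaleEquiv hε (hdet x) (Y (ε, x)) := by
      rw [← map_smul]; rfl
    rw [this, Submodule.span_singleton_smul_eq hnne.isUnit]
  have hG0 : ∀ x, G (0, x) = Γ x := by
    intro x
    have : rescale (0 : ℝ) (n (0, x) • Y (0, x)) = Pi.single 0 1 := by
      funext j
      refine Fin.cases ?_ (fun j => ?_) j
      · simp [rescale, hY0, hn0]
      · simp [rescale]
    simp only [hG, this, Matrix.single_one_vecMul]
    simp [jetMatrix]
  have hcoord : ∀ ε x, (∀ x, n (ε, x) * Y (ε, x) 0 = 1) →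
      rescale ε (n (ε, x) • Y (ε, x)) 0 = 1 := fun ε x h => by simp [rescale, h]
  -- Reversing `ε` permutes the diagonals and their vertices, so the line is unchanged; zeroth
  -- coordinate one selects a single vector on it.
  have heven : ∀ᶠ ε in 𝓝[≠] (0 : ℝ), ∀ x, G (-ε, x) = G (ε, x) := by
    filter_upwards [hnY', tendsto_neg_nhdsNE.eventually hnY', self_mem_nhdsWithin] with ε h1 h2 hε x
    have h3 := (hspan (-ε) (neg_ne_zero.2 hε) h2 x).2
    rw [iInf_iSup_span_neg, (hspan ε hε h1 x).2] at h3
    have h4 : G (-ε, x) ∈ Submodule.span ℝ {G (ε, x)} := by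
      rw [h3]; exact Submodule.mem_span_singleton_self _
    obtain ⟨a, ha⟩ := Submodule.mem_span_singleton.1 h4
    simp only [hG] at ha
    rw [← Matrix.smul_vecMul] at ha
    have h5 := congrFun (vecMul_jetMatrix_injective (hdet x) ha) 0
    simp only [Pi.smul_apply, hcoord _ _ h1, hcoord _ _ h2, smul_eq_mul, mul_one] at h5
    subst h5
    simpa [hG] using ha.symm
  obtain ⟨G₂, hG₂, hGG₂, hG₂even⟩ := exists_hadamard_even hGs heven
  refine ⟨G, G₂, hGs, hG₂, fun ε x => by rw [hGG₂, hG0], fun x => ?_, fun ε x => ?_, heven, hG₂even,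
    ?_⟩
  -- `H` is `(G - Γ) / ε²` in jet coordinates: coordinate `0` cancels by normalization, and
  -- coordinate `1` has an extra `ε²` because `leadingPoint` vanishes there. At `ε = 0` only `j = 2`
  -- survives, with half the ratio of `leadingPoint 2` to `leadingPoint 0`.
  · let H : ℝ → Vec d := fun ε => (fun j : Fin (d + 1) => if (j : ℕ) = 0 then 0 else
      if (j : ℕ) = 1 then ε * (n (ε, x) * Z (ε, x) j) else
        ε ^ ((j : ℕ) - 2) / ((j : ℕ).factorial : ℝ) * (n (ε, x) * Y (ε, x) j)) ᵥ* jetMatrix d Γ x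
    have hHc : Continuous H := by
      have hnc : Continuous fun ε : ℝ => n (ε, x) := hns.continuous.comp (by fun_prop)
      have hZc : ∀ j, Continuous fun ε : ℝ => Z (ε, x) j := fun j =>
        (contDiff_pi.1 hZ j).continuous.comp (by fun_prop)
      have hYc : ∀ j, Continuous fun ε : ℝ => Y (ε, x) j := fun j =>
        (hYj j).continuous.comp (by fun_prop)
      refine Continuous.matrix_vecMul (continuous_pi fun j => ?_) continuous_const
      have := hZc j
      have := hYc j
      split_ifs
      · exact continuous_const
      · fun_prop
      · simp only [div_eq_mul_inv]; fun_prop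
    have hGc : Continuous fun ε : ℝ => G₂ (ε, x) := hG₂.continuous.comp (by fun_prop)
    have hl1 : ∀ j : Fin (d + 1), (j : ℕ) = 1 → leadingPoint d j = 0 := fun j hj => by
      have : j = ⟨1, by omega⟩ := Fin.ext hj
      rw [this]; exact leadingPoint_one (by omega)
    have key : G₂ (0, x) = H 0 := by
      refine eq_of_eventuallyEq_nhdsNE hGc hHc ?_
      filter_upwards [hnY', self_mem_nhdsWithin] with ε h1 hε
      have hε2 : ε ^ 2 ≠ 0 := pow_ne_zero 2 hε
      refine smul_right_injective (Vec d) hε2 ?_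
      have h2 := hGG₂ ε x
      rw [hG0] at h2
      have h3 : Γ x = (Pi.single 0 1 : Vec d) ᵥ* jetMatrix d Γ x := by
        rw [Matrix.single_one_vecMul]; simp [jetMatrix]
      simp only
      rw [eq_comm, ← sub_eq_iff_eq_add'.2 h2]
      conv_rhs => rw [h3]
      simp only [hG, H]
      rw [← Matrix.sub_vecMul, ← Matrix.smul_vecMul]
      congr 1
      funext j
      by_cases hj0 : (j : ℕ) = 0
      · have : j = 0 := Fin.ext hj0
        subst this
        simp [rescale, h1]
      · have hj0' : j ≠ 0 := fun h => hj0 (by simp [h])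
        by_cases hj1 : (j : ℕ) = 1
        · simp only [Pi.smul_apply, Pi.sub_apply, rescale, hj1, hYZ', hl1 j hj1, Pi.add_apply]
          simp [hj0']; ring
        · have h4 : ε ^ (j : ℕ) = ε ^ 2 * ε ^ ((j : ℕ) - 2) := by rw [← pow_add]; congr 1; omega
          simp only [Pi.smul_apply, Pi.sub_apply, rescale, hj0, hj1, h4, if_false]
          simp [hj0']; ring
    rw [key]
    have hH0 : ∀ j : Fin (d + 1), (if (j : ℕ) = 0 then 0 else
      if (j : ℕ) = 1 then (0 : ℝ) * (n (0, x) * Z (0, x) j) else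
        0 ^ ((j : ℕ) - 2) / ((j : ℕ).factorial : ℝ) * (n (0, x) * Y (0, x) j)) =
        if (j : ℕ) = 2 then pentagramCoeff d else 0 := by
      intro j
      by_cases hj2 : (j : ℕ) = 2
      · have hd2 : 2 ≤ d := by have := j.2; omega
        have hj : j = ⟨2, by omega⟩ := Fin.ext hj2
        have h5 := leadingPoint_two (d := d) (by omega)
        have hd2' : (2 : ℝ) ≤ d := by exact_mod_cast hd2
        have hne : (d : ℝ) * (d - 1) ≠ 0 := by
          have : (0 : ℝ) < d * (d - 1) := by nlinarith
          exact this.ne'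
        rw [← hj] at h5
        simp only [hj2, hY0, pentagramCoeff, hd2, if_true]
        have h6 := hn0 x
        simp only [OfNat.ofNat_ne_zero, OfNat.ofNat_ne_one, if_false, Nat.sub_self, pow_zero,
          Nat.factorial_two, Nat.cast_ofNat]
        rw [div_mul_eq_mul_div, one_mul, div_eq_div_iff two_ne_zero (by positivity)]
        linear_combination 2 * n (0, x) * h5 + 6 * (∑ k, center d k ^ 2) * h6
      · rw [if_neg hj2]
        split_ifs with h1 h2
        · rfl
        · simp
        · rw [zero_pow (by omega)]; simp
    simp only [H, hH0]
    rw [Matrix.vecMul_eq_sum]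
    by_cases hd2 : 2 ≤ d
    · rw [Finset.sum_eq_single (⟨2, by omega⟩ : Fin (d + 1))]
      · simp; rfl
      · intro j _ hj
        have : (j : ℕ) ≠ 2 := fun h => hj (Fin.ext h)
        simp [this]
      · simp
    · simp only [pentagramCoeff, hd2, if_false, ite_self, zero_smul, Finset.sum_const_zero]
  · simp only [hG, hn]
    have : Y (ε, x + T) = Y (ε, x) := hper ε x
    rw [this, jetMatrix_monodromy hΓ hB, Matrix.vecMul_vecMul]
  · filter_upwards [hnY', self_mem_nhdsWithin] with ε h1 hε x using hspan ε hε h1 x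

end Image

/-! ### The normalized image curve -/

section NormalizedImage

variable {d : ℕ} {Γ : ℝ → Vec d}

theorem hasDerivAt_jetMatrix_deriv {C : ℝ → Vec d} (hC : ContDiff ℝ ∞ C) (x : ℝ)
    (i j : Fin (d + 1)) :
    HasDerivAt (fun y => jetMatrix d C y i j) (jetMatrix d (deriv C) x i j) x := by
  have h := deriv_iteratedDeriv_entry hC i j x
  rw [iteratedDeriv_succ'] at h
  exact h

theorem jetMatrix_deriv (hΓ : ContDiff ℝ ∞ Γ) (hdet : ∀ x, (jetMatrix d Γ x).det = 1) (x : ℝ) :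
    jetMatrix d (deriv Γ) x = curveU d Γ x * jetMatrix d Γ x := by
  ext i j
  exact (hasDerivAt_jetMatrix_deriv hΓ x i j).unique (hasDerivAt_jetMatrix hΓ hdet x i j)

theorem contDiff_infty_deriv {E : Type} [NormedAddCommGroup E] [NormedSpace ℝ E] {f : ℝ → E}
    (hf : ContDiff ℝ ∞ f) : ContDiff ℝ ∞ (deriv f) := (contDiff_infty_iff_deriv.1 hf).2

theorem smoothEntries_curveU (hΓ : ContDiff ℝ ∞ Γ) (hdet : ∀ x, (jetMatrix d Γ x).det = 1) :
    SmoothEntries (curveU d Γ) := by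
  have : curveU d Γ = fun x => jetMatrix d (deriv Γ) x * (jetMatrix d Γ x)⁻¹ := by
    funext x
    rw [jetMatrix_deriv hΓ hdet, Matrix.mul_nonsing_inv_cancel_right _ _
      (by rw [hdet]; exact isUnit_one)]
  rw [this]
  exact (smoothEntries_jetMatrix (contDiff_infty_deriv hΓ)).mul
    ((smoothEntries_jetMatrix hΓ).inv_of_det_eq_one hdet)

theorem SmoothEntries.hasDerivAt {m n : Type} {M : ℝ → Matrix m n ℝ} (hM : SmoothEntries M) (x : ℝ)
    (i : m) (j : n) : HasDerivAt (fun y => M y i j) (matrixDeriv M x i j) x :=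
  ((hM i j).differentiable (by simp) x).hasDerivAt

theorem hasDerivAt_matrix_mul {l m n : Type} [Fintype m] {M : ℝ → Matrix l m ℝ}
    {N : ℝ → Matrix m n ℝ} {M' : Matrix l m ℝ} {N' : Matrix m n ℝ} {x : ℝ}
    (hM : ∀ i j, HasDerivAt (fun y => M y i j) (M' i j) x)
    (hN : ∀ i j, HasDerivAt (fun y => N y i j) (N' i j) x) (i : l) (j : n) :
    HasDerivAt (fun y => (M y * N y) i j) ((M' * N x + M x * N') i j) x := by
  simp only [Matrix.mul_apply, Matrix.add_apply, ← Finset.sum_add_distrib]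
  exact HasDerivAt.fun_sum fun k _ => (hM i k).mul (hN k j)

theorem jetMatrix_second (hΓ : ContDiff ℝ ∞ Γ) (hdet : ∀ x, (jetMatrix d Γ x).det = 1) (x : ℝ) :
    jetMatrix d (iteratedDeriv 2 Γ) x = (matrixDeriv (curveU d Γ) x +
      curveU d Γ x * curveU d Γ x) * jetMatrix d Γ x := by
  have h2 : iteratedDeriv 2 Γ = deriv (deriv Γ) := by simp [iteratedDeriv_succ]
  ext i j
  have h := hasDerivAt_jetMatrix_deriv (contDiff_infty_deriv hΓ) x i j
  rw [show (fun y => jetMatrix d (deriv Γ) y i j) = fun y =>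
    (curveU d Γ y * jetMatrix d Γ y) i j by funext y; rw [jetMatrix_deriv hΓ hdet]] at h
  have h' := hasDerivAt_matrix_mul ((smoothEntries_curveU hΓ hdet).hasDerivAt x)
    (hasDerivAt_jetMatrix hΓ hdet x) i j
  rw [h2, h.unique h', add_mul, Matrix.mul_assoc]

/-- The trace counts weighted closed paths of length two; since the last entry is zero, only those
between `d - 1` and `d` exist. -/
theorem trace_laxOfCoeff_sq (hd : 0 < d) (a : Fin (d + 1) → ℝ) (ha : a (Fin.last d) = 0) :
    (laxOfCoeff d 1 a * laxOfCoeff d 1 a).trace = 2 * a ⟨d - 1, by omega⟩ := by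
  have hne : (⟨d - 1, by omega⟩ : Fin (d + 1)) ≠ Fin.last d := by
    intro h
    have := congrArg Fin.val h
    simp at this
    omega
  rw [Matrix.trace, Fintype.sum_eq_add (⟨d - 1, by omega⟩ : Fin (d + 1)) (Fin.last d) hne,
    laxOfCoeff_one_mul]
  · have h1 : (⟨d - 1 + 1, by omega⟩ : Fin (d + 1)) = Fin.last d := Fin.ext (by simp; omega)
    have h2 : (a ᵥ* laxOfCoeff d 1 a) (Fin.last d) = a ⟨d - 1, by omega⟩ := by
      rw [Matrix.vecMul, dotProduct, Fintype.sum_eq_add (⟨d - 1, by omega⟩ : Fin (d + 1))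
        (Fin.last d) hne]
      · have : d = d - 1 + 1 := by omega
        simp [laxOfCoeff, ha, hd, spectralDiag]
        intro h; omega
      · rintro k ⟨hk1, hk2⟩
        have hk3 : (k : ℕ) < d := lt_of_le_of_ne (Nat.lt_succ_iff.1 k.2) fun h => hk2 (Fin.ext h)
        have hk4 : (k : ℕ) ≠ d - 1 := fun h => hk1 (Fin.ext h)
        have : ¬ d = (k : ℕ) + 1 := by omega
        simp [laxOfCoeff, hk3, this]
    have h3 : d - 1 < d := by omega
    simp only [Matrix.diag_apply, Matrix.of_apply, h3, dif_pos, h1, Fin.val_last, lt_irrefl,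
      dif_neg, not_false_eq_true, h2]
    simp [laxOfCoeff]; ring
  · rintro k ⟨hk1, hk2⟩
    have hk3 : (k : ℕ) < d := lt_of_le_of_ne (Nat.lt_succ_iff.1 k.2) fun h => hk2 (Fin.ext h)
    have hk4 : (k : ℕ) ≠ d - 1 := fun h => hk1 (Fin.ext h)
    have : (k : ℕ) + 1 < d := by omega
    have h5 : ¬ (k : ℕ) = k + 1 + 1 := by omega
    rw [laxOfCoeff_one_mul]
    simp [hk3, laxOfCoeff, this, h5]

theorem trace_matrixDeriv_curveU (Γ : ℝ → Vec d) (x : ℝ) :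
    (matrixDeriv (curveU d Γ) x).trace = 0 := by
  refine Finset.sum_eq_zero fun i _ => ?_
  have : (fun y => curveU d Γ y i i) = fun _ => 0 := by
    funext y
    by_cases hi : (i : ℕ) < d <;> simp [curveU, companion, hi]
  simp [matrixDeriv, this]

theorem trace_jetMatrix_second (hd : 0 < d) (hΓ : ContDiff ℝ ∞ Γ)
    (hdet : ∀ x, (jetMatrix d Γ x).det = 1) (x : ℝ) :
    (jetMatrix d (iteratedDeriv 2 Γ) x * (jetMatrix d Γ x)⁻¹).trace =
      -2 * operatorCoeff d Γ ⟨d - 1, by omega⟩ x := by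
  rw [jetMatrix_second hΓ hdet, Matrix.mul_nonsing_inv_cancel_right _ _
    (by rw [hdet]; exact isUnit_one), Matrix.trace_add, trace_matrixDeriv_curveU,
    curveU_eq_laxOfCoeff hΓ hdet, trace_laxOfCoeff_sq hd _ (topCoord_last hΓ hdet x), zero_add]
  simp [operatorCoeff, topCoord]

/-- The order `ε²` term of the determinant is this trace. As `M` itself depends on `ε`, the factor
`ε²` and the argument of `M` are treated as separate variables. -/
theorem trace_eq_zero_of_det_eq_one {n : Type} [Fintype n] [DecidableEq n] {J : Matrix n n ℝ}
    (hJ : J.det = 1) {M : ℝ → Matrix n n ℝ} (hM : SmoothEntries M)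
    (h : ∀ᶠ ε in 𝓝[≠] (0 : ℝ), (J + ε ^ 2 • M ε).det = 1) : (M 0 * J⁻¹).trace = 0 := by
  let φ : ℝ × ℝ → ℝ := fun q => (J + q.1 • M q.2).det
  have hφ : ContDiff ℝ ∞ φ := SmoothEntries.det
    ((SmoothEntries.const J).add (SmoothEntries.smul contDiff_fst (hM.comp contDiff_snd)))
  obtain ⟨G, hG, hφG, hG0⟩ := exists_hadamard hφ
  have h0 : ∀ ε, φ (0, ε) = 1 := fun ε => by simp [φ, hJ]
  have h1 : G (0, 0) = 0 := by
    have := eq_of_eventuallyEq_nhdsNE (f := fun ε : ℝ => G (ε ^ 2, ε)) (g := fun _ => 0)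
      (hG.continuous.comp (by fun_prop)) continuous_const (by
        filter_upwards [h, self_mem_nhdsWithin] with ε h2 hε
        have h3 := hφG (ε ^ 2) ε
        rw [h0] at h3
        have h4 : φ (ε ^ 2, ε) = 1 := h2
        rw [h4, left_eq_add, smul_eq_mul] at h3
        exact (mul_eq_zero.1 h3).resolve_left (pow_ne_zero 2 hε))
    simpa using this
  have h2 : HasDerivAt (fun s => φ (s, 0)) (fderiv ℝ φ (0, 0) (1, 0)) 0 :=
    HasFDerivAt.comp_hasDerivAt (0 : ℝ) (f := fun s : ℝ => (s, (0 : ℝ)))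
      (hφ.differentiable (by simp) _).hasFDerivAt
      ((hasDerivAt_id (0 : ℝ)).prodMk (hasDerivAt_const (0 : ℝ) (0 : ℝ)))
  have h3 := hasDerivAt_det (A := fun s => J + s • M 0) (U := M 0 * J⁻¹) (t := 0) (fun i j => by
    have hu : IsUnit J.det := by rw [hJ]; exact isUnit_one
    simp only [zero_smul, add_zero, Matrix.nonsing_inv_mul_cancel_right _ _ hu]
    simpa using ((hasDerivAt_id (0 : ℝ)).mul_const (M 0 i j)).const_add (J i j))
  have h4 := h2.unique h3
  rw [← hG0, h1] at h4
  simpa [hJ] using h4.symm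

/-- The constant in the expansion of the pentagram map. For `d = 1` the map is the identity, the
operator `Q₂` annihilates the curve, and the constant is arbitrary. -/
noncomputable def pentagramConst (d : ℕ) : ℝ := if 2 ≤ d then pentagramCoeff d else 1

theorem pentagramConst_ne_zero : pentagramConst d ≠ 0 := by
  by_cases hd : 2 ≤ d
  · have h1 := sum_center_sq_pos hd
    have h2 : (2 : ℝ) ≤ d := by exact_mod_cast hd
    have h3 : (0 : ℝ) < d * (d - 1) := by nlinarith
    simp only [pentagramConst, pentagramCoeff, hd, if_true]
    positivity
  · simp [pentagramConst, hd]

/-- A smooth family of normalized lifts of the pentagram images. -/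
theorem exists_normalized_family (hd : 1 ≤ d) (hΓ : ContDiff ℝ ∞ Γ)
    (hdet : ∀ x, (jetMatrix d Γ x).det = 1)
    {B : Matrix (Fin (d + 1)) (Fin (d + 1)) ℝ} {T : ℝ} (hT : 0 < T) (hB1 : B.det = 1)
    (hB : ∀ x, Γ (x + T) = Γ x ᵥ* B) :
    ∃ F R : ℝ × ℝ → Vec d, ContDiff ℝ ∞ F ∧ ContDiff ℝ ∞ R ∧
      (∀ ε x, F (ε, x) = Γ x + ε ^ 2 • (pentagramConst d • applyQ2 d Γ x + ε ^ 2 • R (ε, x))) ∧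
      (∀ ε x, F (ε, x + T) = F (ε, x) ᵥ* B) ∧
      (∀ᶠ ε in 𝓝[≠] (0 : ℝ), ∀ x, (jetMatrix d (fun y => F (ε, y)) x).det = 1) ∧
      ∀ᶠ ε in 𝓝[≠] (0 : ℝ), ∀ x,
        (∀ k, Module.finrank ℝ
          (⨆ l, Submodule.span ℝ {Γ (x + node d k l * ε)} : Submodule ℝ (Vec d)) = d) ∧
        (⨅ k, ⨆ l, Submodule.span ℝ {Γ (x + node d k l * ε)}) = Submodule.span ℝ {F (ε, x)} := by
  obtain ⟨G, G₂, hG, hG₂, hGG₂, hG₂0, hGB, hGe, hG₂e, hGspan⟩ := exists_even_family hd hΓ hdet hT hB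
  have hG0 : (fun y => G (0, y)) = Γ := by funext y; simp [hGG₂]
  set W : ℝ × ℝ → ℝ := fun q => (jetMatrix d (fun y => G (q.1, y)) q.2).det with hW
  have hWs : ContDiff ℝ ∞ W := (smoothEntries_jetMatrix_slice hG).det
  have hW0 : ∀ x, W (0, x) = 1 := fun x => by simp only [hW, hG0, hdet]
  have hWper : ∀ ε x, W (ε, x + T) = W (ε, x) := fun ε x => by
    simp only [hW]
    rw [jetMatrix_monodromy (contDiff_slice hG ε) (hGB ε), Matrix.det_mul, hB1, mul_one]
  -- Multiplying a curve by `f` multiplies its Wronskian by `f ^ (d + 1)`, so the normalizing factor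
  -- is `W ^ (-1 / (d + 1))`.
  obtain ⟨φ, hφ, hφ1, hφW⟩ := exists_contDiff_inv_root d
  have hWφ : ∀ᶠ ε in 𝓝 (0 : ℝ), ∀ x, φ (W (ε, x)) ^ (d + 1) * W (ε, x) = 1 :=
    eventually_forall_of_periodic hWs.continuous hT hWper
      (s := {w | φ w ^ (d + 1) * w = 1}) (fun x => by rw [hW0]; exact hφW)
  have hWφ' := hWφ.filter_mono (nhdsWithin_le_nhds (s := {0}ᶜ))
  set f : ℝ × ℝ → ℝ := fun q => φ (W q) with hf
  have hfs : ContDiff ℝ ∞ f := hφ.comp hWs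
  have hfe : ∀ᶠ ε in 𝓝[≠] (0 : ℝ), ∀ x, f (-ε, x) = f (ε, x) := by
    filter_upwards [hGe] with ε h x
    simp only [hf, hW, funext h]
  obtain ⟨b, hb, hfb, hbe⟩ := exists_hadamard_even hfs hfe
  have hf0 : ∀ x, f (0, x) = 1 := fun x => by simp only [hf, hW0, hφ1]
  set F₂ : ℝ × ℝ → Vec d := fun q => G₂ q + b q • Γ q.2 + q.1 ^ 2 • (b q • G₂ q) with hF₂
  have hF₂s : ContDiff ℝ ∞ F₂ := by
    have : ContDiff ℝ ∞ fun q : ℝ × ℝ => Γ q.2 := hΓ.comp contDiff_snd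
    fun_prop
  -- Evenness of the second order part removes the `ε³` term, so the remainder is `ε⁴ R`.
  obtain ⟨R, hR, hFR, -⟩ := exists_hadamard_even hF₂s (by
    filter_upwards [hG₂e, hbe] with ε h1 h2 x
    simp only [hF₂, h1, h2, neg_sq])
  have hF : ∀ ε x, f (ε, x) • G (ε, x) = Γ x + ε ^ 2 • F₂ (ε, x) := fun ε x => by
    rw [hfb, hf0, hGG₂]
    simp only [hF₂]
    module
  have hdetF : ∀ᶠ ε in 𝓝[≠] (0 : ℝ), ∀ x,
      (jetMatrix d (fun y => f (ε, y) • G (ε, y)) x).det = 1 := by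
    filter_upwards [hWφ'] with ε h x
    rw [det_jetMatrix_smul (contDiff_slice hfs ε) (contDiff_slice hG ε)]
    exact h x
  -- The perturbation `pentagramCoeff • Γ'' + b Γ` must be traceless; `Γ''` contributes `-2 u_{d-1}`
  -- and `b Γ` contributes `(d + 1) b`.
  have hb0 : ∀ x, (d + 1) * b (0, x) =
      2 * pentagramCoeff d * operatorCoeff d Γ ⟨d - 1, by omega⟩ x := by
    intro x
    have h1 := trace_eq_zero_of_det_eq_one (hdet x)
      (M := fun ε => jetMatrix d (fun y => F₂ (ε, y)) x)
      ((smoothEntries_jetMatrix_slice hF₂s).comp (g := fun ε : ℝ => (ε, x)) (by fun_prop)) (by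
        filter_upwards [hdetF] with ε h2
        rw [← jetMatrix_const_smul, ← jetMatrix_add hΓ ((contDiff_slice hF₂s ε).const_smul _),
          ← funext (hF ε)]
        exact h2 x)
    have h3 : (fun y => F₂ (0, y)) = fun y => pentagramCoeff d • iteratedDeriv 2 Γ y +
        b (0, y) • Γ y := by
      funext y; simp [hF₂, hG₂0]
    have h4 := contDiff_slice hb 0
    rw [h3, jetMatrix_add ((smooth_iteratedDeriv hΓ 2).const_smul _)
      (show ContDiff ℝ ∞ fun y => b (0, y) • Γ y from h4.smul hΓ),
      jetMatrix_const_smul, add_mul, Matrix.trace_add, Matrix.smul_mul, Matrix.trace_smul,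
      trace_jetMatrix_smul_mul_inv h4 hΓ x (hdet x), trace_jetMatrix_second hd hΓ hdet,
      smul_eq_mul] at h1
    linarith
  have hd1 : (d : ℝ) + 1 ≠ 0 := by positivity
  have hF₂0 : ∀ x, F₂ (0, x) = pentagramConst d • applyQ2 d Γ x := by
    intro x
    have h1 : b (0, x) = 2 / ((d : ℝ) + 1) * pentagramCoeff d *
        operatorCoeff d Γ ⟨d - 1, by omega⟩ x := by
      have := hb0 x
      field_simp
      linarith
    have hd' : 0 < d := hd
    simp only [hF₂, hG₂0, h1, applyQ2, hd', dif_pos]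
    by_cases hd2 : 2 ≤ d
    · simp only [pentagramConst, hd2, if_true]
      module
    -- Here `Q₂` is the whole operator `L`, so `Q₂ Γ = 0`, in agreement with the zero
    -- `pentagramCoeff`.
    · obtain rfl : d = 1 := by omega
      have h2 : iteratedDeriv 2 Γ x = -∑ k : Fin 1, operatorCoeff 1 Γ k x • iteratedDeriv k Γ x :=
        iteratedDeriv_top_eq hΓ hdet x
      simp only [pentagramConst, pentagramCoeff, hd2, if_false, h2]
      norm_num
  refine ⟨fun q => f q • G q, R, hfs.smul hG, hR, fun ε x => ?_, fun ε x => ?_, hdetF, ?_⟩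
  · rw [← hF₂0, ← hFR]; exact hF ε x
  · have : f (ε, x + T) = f (ε, x) := by simp only [hf, hWper]
    simp only [this, hGB, Matrix.smul_vecMul]
  · filter_upwards [hGspan, hWφ'] with ε h1 h2 x
    refine ⟨(h1 x).1, (h1 x).2.trans ?_⟩
    have : f (ε, x) ≠ 0 := by
      intro h0
      have := h2 x
      simp only [hf] at h0
      rw [h0, zero_pow (by omega), zero_mul] at this
      exact zero_ne_one this
    rw [Submodule.span_singleton_smul_eq this.isUnit]

theorem isPentagramCurve_of_span {γ : ℝ → ℙ ℝ (Vec d)} (hd : 1 ≤ d)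
    (hγ : ∀ x, ∃ h : Γ x ≠ 0, γ x = Projectivization.mk ℝ (Γ x) h) {ε : ℝ} {F : ℝ → Vec d}
    (hF : ∀ x, F x ≠ 0)
    (h : ∀ x, (∀ k, Module.finrank ℝ
        (⨆ l, Submodule.span ℝ {Γ (x + node d k l * ε)} : Submodule ℝ (Vec d)) = d) ∧
      (⨅ k, ⨆ l, Submodule.span ℝ {Γ (x + node d k l * ε)}) = Submodule.span ℝ {F x}) :
    IsPentagramCurve ε γ fun x => Projectivization.mk ℝ (F x) (hF x) := by
  intro x
  have hsub : ∀ y, (γ y).submodule = Submodule.span ℝ {Γ y} := fun y => by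
    obtain ⟨h1, h2⟩ := hγ y
    rw [h2, Projectivization.submodule_mk]
  -- For even `d` the index `⌊(d - 1) / 2⌋` falls short of `(d - 1) / 2` by one half; the shift by
  -- `ε / 2` makes up for it and centers the nodes.
  have hnode : ∀ k l : Fin d, (if Odd d then x else x - ε / 2) +
      ((0 - (((d - 1) / 2 : ℕ) : ℤ) + ((k : ℕ) : ℤ) - ((d : ℤ) - 1) + 2 * ((l : ℕ) : ℤ) : ℤ) : ℝ) * ε
        = x + node d k l * ε := by
    intro k l
    simp only [node, center]
    rcases Nat.even_or_odd' d with ⟨m, hm | hm⟩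
    · have h1 : ¬ Odd d := by rw [Nat.not_odd_iff_even, hm]; exact even_two_mul m
      have h2 : (d - 1) / 2 = m - 1 := by omega
      have h3 : (m - 1 + 1 : ℕ) = m := by omega
      have h4 : ((m - 1 : ℕ) : ℝ) = m - 1 := by rw [← h3]; push_cast; simp
      have hm' : (d : ℝ) = 2 * m := by exact_mod_cast hm
      rw [if_neg h1, h2]
      push_cast
      rw [h4]
      linear_combination (ε / 2) * hm'
    · have h1 : Odd d := ⟨m, hm⟩
      have h2 : (d - 1) / 2 = m := by omega
      have hm' : (d : ℝ) = 2 * m + 1 := by exact_mod_cast hm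
      rw [if_pos h1, h2]
      push_cast
      linear_combination (ε / 2) * hm'
  have hsd : ∀ k : Fin d, shortDiagonal (discretize γ ε (if Odd d then x else x - ε / 2))
      (0 - (((d - 1) / 2 : ℕ) : ℤ) + ((k : ℕ) : ℤ)) =
        ⨆ l, Submodule.span ℝ {Γ (x + node d k l * ε)} := fun k => by
    simp only [shortDiagonal, discretize, hsub, hnode]
  refine ⟨fun k => by rw [hsd]; exact (h x).1 k, ?_⟩
  simp only [hsd]
  rw [Projectivization.submodule_mk]
  exact (h x).2

end NormalizedImage

/-! ### Sample matrices and discrete Lax matrices -/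

section Sample

variable {d : ℕ}

theorem det_changeOfBasis_ne_zero {ε : ℝ} (hε : ε ≠ 0) : (changeOfBasis d ε).det ≠ 0 := by
  rw [Matrix.det_of_isLowerTriangular]
  · refine Finset.prod_ne_zero_iff.2 fun i _ => ?_
    simp [changeOfBasis, hε]
  · intro i j hij
    have : ¬ j ≤ i := not_le.2 hij
    simp [changeOfBasis, this]

/-- Divided differences converge to derivatives, smoothly in the step. At `ε = 0` itself
`changeOfBasis` degenerates through division by zero, so there `S` is the jet matrix instead. -/
theorem exists_sample_extension {F : ℝ × ℝ → Vec d} (hF : ContDiff ℝ ∞ F) :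
    ∃ S : ℝ × ℝ → Matrix (Fin (d + 1)) (Fin (d + 1)) ℝ, SmoothEntries S ∧
      (∀ ε x, ε ≠ 0 → changeOfBasis d ε * sampleMatrix d ε (fun y => F (ε, y)) x = S (ε, x)) ∧
      ∀ x, S (0, x) = jetMatrix d (fun y => F (0, y)) x := by
  choose G hG h h0 using fun k : ℕ => exists_iterate_diffQuot k hF
  refine ⟨fun q => Matrix.of fun k : Fin (d + 1) => G k q, SmoothEntries.of_rows fun k => hG k,
    fun ε x hε => ?_, fun x => ?_⟩
  · rw [changeOfBasis_mul_sampleMatrix]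
    ext k j
    simp only [Matrix.of_apply, h, smul_smul]
    rw [inv_mul_cancel₀ (pow_ne_zero _ hε), one_smul]
  · ext k j
    simp [jetMatrix, h0]

theorem sampleMatrix_monodromy {Γ : ℝ → Vec d} {B : Matrix (Fin (d + 1)) (Fin (d + 1)) ℝ} {T : ℝ}
    (hB : ∀ x, Γ (x + T) = Γ x ᵥ* B) (ε x : ℝ) :
    sampleMatrix d ε Γ (x + T) = sampleMatrix d ε Γ x * B := by
  ext i j
  have := congrFun (hB (x + ((i : ℕ) : ℝ) * ε)) j
  rw [add_right_comm] at this
  simpa [sampleMatrix, Matrix.mul_apply, Matrix.vecMul, dotProduct] using this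

/-- The matrix of difference quotients of a family with monodromy is smooth up to `ε = 0` and
uniformly invertible. -/
theorem exists_sample_extension_inv {F : ℝ × ℝ → Vec d} (hF : ContDiff ℝ ∞ F)
    {B : Matrix (Fin (d + 1)) (Fin (d + 1)) ℝ} {T : ℝ} (hT : 0 < T) (hB1 : B.det = 1)
    (hB : ∀ ε x, F (ε, x + T) = F (ε, x) ᵥ* B)
    (hdet : ∀ x, (jetMatrix d (fun y => F (0, y)) x).det = 1) :
    ∃ S S' : ℝ × ℝ → Matrix (Fin (d + 1)) (Fin (d + 1)) ℝ, SmoothEntries S ∧ SmoothEntries S' ∧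
      (∀ ε x, ε ≠ 0 → changeOfBasis d ε * sampleMatrix d ε (fun y => F (ε, y)) x = S (ε, x)) ∧
      (∀ x, S (0, x) = jetMatrix d (fun y => F (0, y)) x) ∧
      (∀ x, S' (0, x) = (jetMatrix d (fun y => F (0, y)) x)⁻¹) ∧
      ∀ᶠ ε in 𝓝 (0 : ℝ), ∀ x, S (ε, x) * S' (ε, x) = 1 := by
  obtain ⟨S, hS, hSD, hS0⟩ := exists_sample_extension hF
  obtain ⟨g, hg, hg1⟩ := exists_contDiff_inv (one_ne_zero (α := ℝ))
  have hper : ∀ ε x, (S (ε, x + T)).det = (S (ε, x)).det := by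
    intro ε x
    have : S (ε, x + T) = S (ε, x) * B := by
      by_cases hε : ε = 0
      · subst hε
        rw [hS0, hS0, jetMatrix_monodromy (contDiff_slice hF 0) (hB 0)]
      · rw [← hSD _ _ hε, ← hSD _ _ hε, sampleMatrix_monodromy (hB ε), Matrix.mul_assoc]
    rw [this, Matrix.det_mul, hB1, mul_one]
  have hev : ∀ᶠ ε in 𝓝 (0 : ℝ), ∀ x, g (S (ε, x)).det * (S (ε, x)).det = 1 :=
    eventually_forall_of_periodic (F := fun q => (S q).det) hS.det.continuous hT hper
      (s := {w | g w * w = 1}) (fun x => by simp only [hS0, hdet]; exact hg1)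
  -- The adjugate times a smooth substitute for the reciprocal determinant is smooth for all `ε`,
  -- and is the inverse for small ones.
  refine ⟨S, fun q => g (S q).det • (S q).adjugate, hS,
    SmoothEntries.smul (hg.comp hS.det) hS.adjugate, hSD, hS0, fun x => ?_, ?_⟩
  · have h1 : g 1 = 1 := by simpa using hg1.self_of_nhds
    simp only [hS0, hdet, h1, Matrix.inv_def, Ring.inverse_one, one_smul]
  · filter_upwards [hev] with ε h x
    rw [Matrix.mul_smul, Matrix.mul_adjugate, smul_smul, h, one_smul]

/-- The Lax matrix is the transition matrix from the samples at `x` to those at `x + ε`: rows shift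
by one and the recurrence supplies the last. -/
theorem laxL_eq {ε x : ℝ} {Γ : ℝ → Vec d} (h : IsUnit (sampleMatrix d ε Γ x).det) :
    laxL d ε Γ x = sampleMatrix d ε Γ (x + ε) * (sampleMatrix d ε Γ x)⁻¹ := by
  have key : laxL d ε Γ x * sampleMatrix d ε Γ x = sampleMatrix d ε Γ (x + ε) := by
    rw [laxL, laxOfCoeff_one_mul]
    ext i j
    by_cases hi : (i : ℕ) < d
    · simp only [Matrix.of_apply, hi, dif_pos, sampleMatrix]
      push_cast
      congr 1; ring_nf
    · have hi' : (i : ℕ) = d := by omega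
      simp only [Matrix.of_apply, sampleMatrix, hi', lt_irrefl, dif_neg, not_false_eq_true]
      have := differenceCoeff_spec d ε Γ x h
      rw [show x + ε + (d : ℝ) * ε = x + ((d : ℝ) + 1) * ε by ring, ← this, Matrix.vecMul_eq_sum]
      rfl
  rw [← key, Matrix.mul_nonsing_inv_cancel_right _ _ h]

theorem conjD_mul_inv (ε : ℝ) (M N : Matrix (Fin (d + 1)) (Fin (d + 1)) ℝ) :
    conjD d ε (M * N⁻¹) = (changeOfBasis d ε * M) * (changeOfBasis d ε * N)⁻¹ := by
  rw [conjD, Matrix.mul_inv_rev]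
  simp only [Matrix.mul_assoc]

/-- All three factors are transition matrices between sample bases, so the product telescopes. -/
theorem laxL_eq_laxP_mul {ε x : ℝ} {Γ Γ' : ℝ → Vec d}
    (h : ∀ x, IsUnit (sampleMatrix d ε Γ x).det) (h' : ∀ x, IsUnit (sampleMatrix d ε Γ' x).det) :
    laxL d ε Γ' x = laxP d ε Γ Γ' (x + ε) * laxL d ε Γ x * (laxP d ε Γ Γ' x)⁻¹ := by
  rw [laxL_eq (h' x), laxL_eq (h x), laxP, laxP, Matrix.mul_inv_rev,
    Matrix.nonsing_inv_nonsing_inv _ (h x)]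
  simp only [Matrix.mul_assoc]
  rw [Matrix.nonsing_inv_mul_cancel_left _ _ (h x), Matrix.nonsing_inv_mul_cancel_left _ _ (h _)]

theorem SmoothEntries.tendsto {m n : Type} {M : ℝ → Matrix m n ℝ} (hM : SmoothEntries M) :
    Tendsto M (𝓝[>] 0) (𝓝 (M 0)) :=
  tendsto_pi_nhds.2 fun i => tendsto_pi_nhds.2 fun j =>
    ((hM i j).continuous.tendsto 0).mono_left nhdsWithin_le_nhds

theorem isBigO_pow_of_eventually {E : Type} [NormedAddCommGroup E] [NormedSpace ℝ E] {f g : ℝ → E}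
    (hg : Continuous g) (n : ℕ) (h : ∀ᶠ ε in 𝓝[>] (0 : ℝ), f ε = ε ^ n • g ε) :
    f =O[𝓝[>] (0 : ℝ)] fun ε => ε ^ n := by
  have h1 : g =O[𝓝[>] (0 : ℝ)] fun _ => (1 : ℝ) :=
    ((hg.tendsto 0).mono_left nhdsWithin_le_nhds).isBigO_one ℝ
  have h2 := (isBigO_refl (fun ε : ℝ => ε ^ n) (𝓝[>] (0 : ℝ))).smul h1
  simp only [smul_eq_mul, mul_one] at h2
  exact h2.congr' (h.mono fun ε hε => hε.symm) EventuallyEq.rfl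

/-- The entrywise difference quotient of a smooth family of matrices. -/
theorem SmoothEntries.exists_diffQuot {m n : Type} {M : ℝ × ℝ → Matrix m n ℝ}
    (hM : SmoothEntries M) : ∃ N : ℝ × ℝ → Matrix m n ℝ, SmoothEntries N ∧
      (∀ ε x, M (ε, x + ε) = M (ε, x) + ε • N (ε, x)) ∧
      ∀ x, N (0, x) = matrixDeriv (fun y => M (0, y)) x := by
  choose N hN h h0 using fun i j => _root_.exists_diffQuot (hM i j)
  refine ⟨fun q => Matrix.of fun i j => N i j q, fun i j => hN i j, fun ε x => ?_, fun x => ?_⟩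
  · ext i j
    have := h i j ε x
    simp only [Matrix.add_apply, Matrix.smul_apply, Matrix.of_apply]
    linear_combination this
  · ext i j
    simp [matrixDeriv, h0]

theorem SmoothEntries.exists_hadamard {m n : Type} {M : ℝ × ℝ → Matrix m n ℝ}
    (hM : SmoothEntries M) : ∃ N : ℝ × ℝ → Matrix m n ℝ, SmoothEntries N ∧
      ∀ ε x, M (ε, x) = M (0, x) + ε • N (ε, x) := by
  choose N hN h h0 using fun i j => _root_.exists_hadamard (hM i j)
  refine ⟨fun q => Matrix.of fun i j => N i j q, fun i j => hN i j, fun ε x => ?_⟩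
  ext i j
  exact h i j ε x

theorem matrixDeriv_jetMatrix {Γ : ℝ → Vec d} (hΓ : ContDiff ℝ ∞ Γ)
    (hdet : ∀ x, (jetMatrix d Γ x).det = 1) (x : ℝ) :
    matrixDeriv (jetMatrix d Γ) x = curveU d Γ x * jetMatrix d Γ x := by
  ext i j
  exact (hasDerivAt_jetMatrix hΓ hdet x i j).deriv

/-- The logarithmic difference quotient `(S(x + ε) S(x)⁻¹ - 1) / ε` of the sample matrices is
smooth up to `ε = 0`, where it equals `U`. -/
theorem exists_lax_extension {Γ : ℝ → Vec d} (hΓ : ContDiff ℝ ∞ Γ)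
    (hdet : ∀ x, (jetMatrix d Γ x).det = 1)
    {S S' : ℝ × ℝ → Matrix (Fin (d + 1)) (Fin (d + 1)) ℝ} (hS : SmoothEntries S)
    (hS' : SmoothEntries S') (hS0 : ∀ x, S (0, x) = jetMatrix d Γ x)
    (hS'0 : ∀ x, S' (0, x) = (jetMatrix d Γ x)⁻¹)
    (hSS' : ∀ᶠ ε in 𝓝 (0 : ℝ), ∀ x, S (ε, x) * S' (ε, x) = 1) :
    ∃ A : ℝ × ℝ → Matrix (Fin (d + 1)) (Fin (d + 1)) ℝ, SmoothEntries A ∧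
      (∀ x, A (0, x) = curveU d Γ x) ∧
      ∀ᶠ ε in 𝓝 (0 : ℝ), ∀ x, S (ε, x + ε) * S' (ε, x) = 1 + ε • A (ε, x) := by
  obtain ⟨N, hN, hSN, hN0⟩ := hS.exists_diffQuot
  refine ⟨fun q => N q * S' q, hN.mul hS', fun x => ?_, ?_⟩
  · simp only [hN0, hS0, hS'0]
    rw [show (fun y => jetMatrix d Γ y) = jetMatrix d Γ from rfl, matrixDeriv_jetMatrix hΓ hdet,
      Matrix.mul_nonsing_inv_cancel_right _ _ (by rw [hdet]; exact isUnit_one)]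
  · filter_upwards [hSS'] with ε h x
    rw [hSN, add_mul, h, Matrix.smul_mul]

theorem isUnit_sampleMatrix {Γ : ℝ → Vec d} {ε x : ℝ}
    {M N : Matrix (Fin (d + 1)) (Fin (d + 1)) ℝ}
    (hM : changeOfBasis d ε * sampleMatrix d ε Γ x = M) (hMN : M * N = 1) :
    IsUnit (sampleMatrix d ε Γ x).det := by
  have h := congrArg Matrix.det hMN
  rw [← hM, Matrix.det_mul, Matrix.det_mul, Matrix.det_one] at h
  refine isUnit_iff_ne_zero.2 fun h0 => ?_
  rw [h0] at h
  simp at h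

/-- The continuous limit of the discrete zero curvature expression. -/
theorem tendsto_gauge_quotient {S S' W W' S₁ : ℝ × ℝ → Matrix (Fin (d + 1)) (Fin (d + 1)) ℝ}
    (hS : SmoothEntries S) (hS' : SmoothEntries S') (hW' : SmoothEntries W')
    (hS₁ : SmoothEntries S₁)
    (hSS' : ∀ᶠ ε in 𝓝 (0 : ℝ), ∀ x, S (ε, x) * S' (ε, x) = 1)
    (hWW' : ∀ᶠ ε in 𝓝 (0 : ℝ), ∀ x, W (ε, x) * W' (ε, x) = 1)
    (hW0 : ∀ x, W (0, x) = S (0, x))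
    (hWS : ∀ ε x, ε ≠ 0 → W (ε, x) = S (ε, x) + ε ^ 2 • S₁ (ε, x))
    {A : ℝ × ℝ → Matrix (Fin (d + 1)) (Fin (d + 1)) ℝ} (hA : SmoothEntries A)
    (hSA : ∀ᶠ ε in 𝓝 (0 : ℝ), ∀ x, S (ε, x + ε) * S' (ε, x) = 1 + ε • A (ε, x)) (x : ℝ) :
    Tendsto (fun ε : ℝ => (ε ^ 3)⁻¹ • (W (ε, x + ε) * W' (ε, x) - S (ε, x + ε) * S' (ε, x)))
      (𝓝[>] 0) (𝓝 (S₁ (0, x) * S' (0, x) * A (0, x) - A (0, x) * (S₁ (0, x) * S' (0, x)) +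
        matrixDeriv (fun y => S₁ (0, y) * S' (0, y)) x)) := by
  have hV : SmoothEntries fun q => S₁ q * S' q := hS₁.mul hS'
  obtain ⟨N, hN, hVN, hN0⟩ := hV.exists_diffQuot
  have hshift : ContDiff ℝ ∞ fun ε : ℝ => (ε, x + ε) := by fun_prop
  have hfix : ContDiff ℝ ∞ fun ε : ℝ => (ε, x) := by fun_prop
  have hE : SmoothEntries fun ε : ℝ => (S₁ (ε, x + ε) * S' (ε, x + ε) * A (ε, x) -
      A (ε, x) * (S₁ (ε, x) * S' (ε, x)) + N (ε, x)) * (S (ε, x) * W' (ε, x)) :=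
    ((((hV.comp hshift).mul (hA.comp hfix)).sub ((hA.comp hfix).mul (hV.comp hfix))).add
      (hN.comp hfix)).mul ((hS.comp hfix).mul (hW'.comp hfix))
  have hlim := hE.tendsto
  have h0 : S (0, x) * W' (0, x) = 1 := by
    rw [← hW0]; exact hWW'.self_of_nhds x
  simp only [add_zero, h0, mul_one, hN0] at hlim
  refine hlim.congr' ?_
  filter_upwards [hSS'.filter_mono nhdsWithin_le_nhds, hWW'.filter_mono nhdsWithin_le_nhds,
    hSA.filter_mono nhdsWithin_le_nhds, self_mem_nhdsWithin] with ε h1 h2 h3 hε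
  have hε0 : ε ≠ 0 := ne_of_gt hε
  have h1' : ∀ y, S' (ε, y) * S (ε, y) = 1 := fun y => mul_eq_one_comm.1 (h1 y)
  set V : ℝ → Matrix (Fin (d + 1)) (Fin (d + 1)) ℝ := fun y => S₁ (ε, y) * S' (ε, y) with hVdef
  have hWV : ∀ y, W (ε, y) = (1 + ε ^ 2 • V y) * S (ε, y) := fun y => by
    rw [hWS ε y hε0, add_mul, one_mul, hVdef, Matrix.smul_mul, Matrix.mul_assoc, h1', mul_one]
  have hVx : V (x + ε) = V x + ε • N (ε, x) := hVN ε x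
  have hSx : S (ε, x + ε) = (1 + ε • A (ε, x)) * S (ε, x) := by
    rw [← h3, Matrix.mul_assoc, h1', mul_one]
  have hX : (1 + ε ^ 2 • V x) * (S (ε, x) * W' (ε, x)) = 1 := by
    rw [← Matrix.mul_assoc, ← hWV, h2]
  have e1 : W (ε, x + ε) * W' (ε, x) =
      (1 + ε ^ 2 • V (x + ε)) * (1 + ε • A (ε, x)) * (S (ε, x) * W' (ε, x)) := by
    rw [hWV, hSx]; simp only [Matrix.mul_assoc]
  -- Both transition matrices now end in the common factor `S W' = (1 + ε² V)⁻¹`, which tends to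
  -- `1`.
  have e2 : S (ε, x + ε) * S' (ε, x) =
      (1 + ε • A (ε, x)) * (1 + ε ^ 2 • V x) * (S (ε, x) * W' (ε, x)) := by
    rw [Matrix.mul_assoc, hX, mul_one, h3]
  -- The `ε²` terms leave only `V(x + ε) - V(x) = ε N`, which is the source of `dV/dx`; the mixed
  -- terms give the commutator.
  have e3 : (1 + ε ^ 2 • V (x + ε)) * (1 + ε • A (ε, x)) - (1 + ε • A (ε, x)) * (1 + ε ^ 2 • V x) =
      ε ^ 3 • (V (x + ε) * A (ε, x) - A (ε, x) * V x + N (ε, x)) := by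
    have : ε ^ 2 • V (x + ε) = ε ^ 2 • V x + ε ^ 3 • N (ε, x) := by
      rw [hVx, smul_add, smul_smul]; ring_nf
    simp only [add_mul, mul_add, one_mul, mul_one, Matrix.smul_mul, Matrix.mul_smul, smul_smul,
      smul_add, smul_sub]
    linear_combination (norm := module) this
  rw [e1, e2, ← sub_mul, e3, Matrix.smul_mul, smul_smul, inv_mul_cancel₀ (pow_ne_zero 3 hε0),
    one_smul]

end Sample

/-! ### The evolution of the operator -/

section Evolution

variable {d : ℕ} {Γ : ℝ → Vec d}

theorem contDiff_applyQ2 (hΓ : ContDiff ℝ ∞ Γ) (hdet : ∀ x, (jetMatrix d Γ x).det = 1) :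
    ContDiff ℝ ∞ (applyQ2 d Γ) := by
  have hu : ContDiff ℝ ∞ fun x => 2 / ((d : ℝ) + 1) *
      (if h : 0 < d then operatorCoeff d Γ ⟨d - 1, by omega⟩ x else 0) := by
    by_cases hd : 0 < d
    · simp only [hd, dif_pos]
      exact contDiff_const.mul (contDiff_operatorCoeff hΓ hdet ⟨d - 1, by omega⟩)
    · simp only [hd, dif_neg, not_false_eq_true]
      exact contDiff_const
  exact (smooth_iteratedDeriv hΓ 2).add (hu.smul hΓ)

theorem smoothEntries_curveV (c : ℝ) (hΓ : ContDiff ℝ ∞ Γ)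
    (hdet : ∀ x, (jetMatrix d Γ x).det = 1) : SmoothEntries (curveV d c Γ) :=
  SmoothEntries.smul contDiff_const ((smoothEntries_jetMatrix (contDiff_applyQ2 hΓ hdet)).mul
    ((smoothEntries_jetMatrix hΓ).inv_of_det_eq_one hdet))

theorem smoothEntries_matrixDeriv_slice {m n : Type} {M : ℝ × ℝ → Matrix m n ℝ}
    (hM : SmoothEntries M) : SmoothEntries fun q : ℝ × ℝ => matrixDeriv (fun y => M (q.1, y)) q.2 :=
  fun i j => by
    have := contDiff_iteratedDeriv_slice 1 (hM i j)
    simp only [iteratedDeriv_one] at this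
    exact this

/-- The gauge transformation of `U` under a perturbation of a normalized curve. -/
theorem curveU_gauge {Γ' : ℝ → Vec d} (hΓ : ContDiff ℝ ∞ Γ)
    (hdet : ∀ x, (jetMatrix d Γ x).det = 1) (hΓ' : ContDiff ℝ ∞ Γ')
    (hdet' : ∀ x, (jetMatrix d Γ' x).det = 1) {P : ℝ → Matrix (Fin (d + 1)) (Fin (d + 1)) ℝ}
    (hP : SmoothEntries P) (h : ∀ x, jetMatrix d Γ' x = P x * jetMatrix d Γ x) (x : ℝ) :
    curveU d Γ' x * P x = matrixDeriv P x + P x * curveU d Γ x := by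
  have h1 : curveU d Γ' x * jetMatrix d Γ' x =
      matrixDeriv P x * jetMatrix d Γ x + P x * (curveU d Γ x * jetMatrix d Γ x) := by
    ext i j
    refine (hasDerivAt_jetMatrix hΓ' hdet' x i j).unique ?_
    simp only [h]
    exact hasDerivAt_matrix_mul (hP.hasDerivAt x) (hasDerivAt_jetMatrix hΓ hdet x) i j
  have hu : IsUnit (jetMatrix d Γ x).det := by rw [hdet]; exact isUnit_one
  rw [h, ← Matrix.mul_assoc, ← Matrix.mul_assoc, ← add_mul] at h1
  have h2 := congrArg (· * (jetMatrix d Γ x)⁻¹) h1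
  simpa only [Matrix.mul_nonsing_inv_cancel_right _ _ hu] using h2

/-- Solves the gauge relation `U' P = P' + P U` for `U'` with an explicit remainder; `V'` and `V₂'`
stand for derivatives, `Q` for `P⁻¹`. -/
theorem gauge_expansion {n : Type} [Fintype n] [DecidableEq n] {U U' V V₂ V' V₂' Q : Matrix n n ℝ}
    {ε : ℝ} (h : U' * (1 + ε ^ 2 • (V + ε ^ 2 • V₂)) =
      ε ^ 2 • (V' + ε ^ 2 • V₂') + (1 + ε ^ 2 • (V + ε ^ 2 • V₂)) * U)
    (hQ : (1 + ε ^ 2 • (V + ε ^ 2 • V₂)) * Q = 1) :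
    U' - U = ε ^ 2 • ((V * U - U * V + V') + ε ^ 2 •
      ((V₂ * U - U * V₂ + V₂' - (V * U - U * V + V') * (V + ε ^ 2 • V₂)) * Q)) := by
  have key : (U' - U - ε ^ 2 • (V * U - U * V + V')) * (1 + ε ^ 2 • (V + ε ^ 2 • V₂)) =
      ε ^ 4 • (V₂ * U - U * V₂ + V₂' - (V * U - U * V + V') * (V + ε ^ 2 • V₂)) := by
    rw [sub_mul, sub_mul, h]
    simp only [add_mul, sub_mul, mul_add, one_mul, mul_one, Matrix.smul_mul,
      Matrix.mul_smul, smul_add, smul_sub, smul_smul]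
    module
  have key2 := congrArg (· * Q) key
  simp only [Matrix.mul_assoc _ (1 + ε ^ 2 • (V + ε ^ 2 • V₂)), hQ, mul_one,
    Matrix.smul_mul] at key2
  rw [sub_eq_iff_eq_add.mp key2]
  module

theorem matrixDeriv_one_add {n : Type} [DecidableEq n] {V V₂ : ℝ → Matrix n n ℝ}
    (hV : SmoothEntries V) (hV₂ : SmoothEntries V₂) (ε x : ℝ) :
    matrixDeriv (fun y => 1 + ε ^ 2 • (V y + ε ^ 2 • V₂ y)) x =
      ε ^ 2 • (matrixDeriv V x + ε ^ 2 • matrixDeriv V₂ x) := by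
  ext i j
  have h1 := ((hV.hasDerivAt x i j).add ((hV₂.hasDerivAt x i j).const_mul (ε ^ 2))).const_mul
    (ε ^ 2)
  exact (h1.const_add ((1 : Matrix n n ℝ) i j)).deriv

theorem jetMatrix_deformation (hΓ : ContDiff ℝ ∞ Γ) (hdet : ∀ x, (jetMatrix d Γ x).det = 1)
    {G R : ℝ → Vec d} (hR : ContDiff ℝ ∞ R) {c ε : ℝ}
    (hG : ∀ x, G x = Γ x + ε ^ 2 • (c • applyQ2 d Γ x + ε ^ 2 • R x)) (y : ℝ) :
    jetMatrix d G y = (1 + ε ^ 2 • (curveV d c Γ y +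
      ε ^ 2 • (jetMatrix d R y * (jetMatrix d Γ y)⁻¹))) * jetMatrix d Γ y := by
  have hu : IsUnit (jetMatrix d Γ y).det := by rw [hdet]; exact isUnit_one
  have hQ := contDiff_applyQ2 hΓ hdet
  have h1 : jetMatrix d G y = jetMatrix d Γ y +
      ε ^ 2 • (c • jetMatrix d (applyQ2 d Γ) y + ε ^ 2 • jetMatrix d R y) := by
    rw [funext hG, jetMatrix_add hΓ (((hQ.const_smul c).add (hR.const_smul _)).const_smul _),
      jetMatrix_const_smul, jetMatrix_add (hQ.const_smul c) (hR.const_smul _),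
      jetMatrix_const_smul, jetMatrix_const_smul]
  rw [h1, add_mul, one_mul, Matrix.smul_mul, add_mul, curveV_mul_jetMatrix _ _ _ _ (hdet y),
    Matrix.smul_mul, Matrix.nonsing_inv_mul_cancel_right _ _ hu]

/-- The expansion of the matrix `U` of a deformed normalized curve. -/
theorem exists_curveU_expansion (hΓ : ContDiff ℝ ∞ Γ) (hdet : ∀ x, (jetMatrix d Γ x).det = 1)
    {c : ℝ} {F R : ℝ × ℝ → Vec d} (hF : ContDiff ℝ ∞ F) (hR : ContDiff ℝ ∞ R)
    (hFR : ∀ ε x, F (ε, x) = Γ x + ε ^ 2 • (c • applyQ2 d Γ x + ε ^ 2 • R (ε, x)))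
    (hFdet : ∀ᶠ ε in 𝓝[≠] (0 : ℝ), ∀ x, (jetMatrix d (fun y => F (ε, y)) x).det = 1) (x : ℝ) :
    ∃ M : ℝ → Matrix (Fin (d + 1)) (Fin (d + 1)) ℝ, SmoothEntries M ∧
      ∀ᶠ ε in 𝓝[≠] (0 : ℝ), curveU d (fun y => F (ε, y)) x - curveU d Γ x =
        ε ^ 2 • ((curveV d c Γ x * curveU d Γ x - curveU d Γ x * curveV d c Γ x +
          matrixDeriv (curveV d c Γ) x) + ε ^ 2 • M ε) := by
  have hJ' : SmoothEntries fun y => (jetMatrix d Γ y)⁻¹ :=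
    (smoothEntries_jetMatrix hΓ).inv_of_det_eq_one hdet
  have hV : SmoothEntries (curveV d c Γ) := smoothEntries_curveV c hΓ hdet
  have hV₂ : SmoothEntries fun q : ℝ × ℝ =>
      jetMatrix d (fun y => R (q.1, y)) q.2 * (jetMatrix d Γ q.2)⁻¹ :=
    (smoothEntries_jetMatrix_slice hR).mul (hJ'.comp contDiff_snd)
  have hfix : ContDiff ℝ ∞ fun ε : ℝ => (ε, x) := by fun_prop
  have hD₂ := (smoothEntries_matrixDeriv_slice hV₂).comp hfix
  have hV₂x := hV₂.comp hfix
  have hc : ∀ N : Matrix (Fin (d + 1)) (Fin (d + 1)) ℝ, SmoothEntries fun _ : ℝ => N :=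
    SmoothEntries.const
  -- The inverse of the gauge matrix `P`, where `P J_Γ = J_F` and `det J_F = 1`, is written `J_Γ
  -- adj(J_F)`, which is smooth for every `ε`.
  refine ⟨_, ((((hV₂x.mul (hc (curveU d Γ x))).sub ((hc (curveU d Γ x)).mul hV₂x)).add hD₂).sub
    ((hc (curveV d c Γ x * curveU d Γ x - curveU d Γ x * curveV d c Γ x +
      matrixDeriv (curveV d c Γ) x)).mul ((hc (curveV d c Γ x)).add
        (SmoothEntries.smul (contDiff_id.pow 2) hV₂x)))).mul ((hc (jetMatrix d Γ x)).mul
          ((smoothEntries_jetMatrix_slice hF).comp hfix).adjugate), ?_⟩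
  filter_upwards [hFdet] with ε hε
  have hV₂ε := hV₂.comp (g := fun y : ℝ => (ε, y)) (by fun_prop)
  have hPs := (SmoothEntries.const (1 : Matrix (Fin (d + 1)) (Fin (d + 1)) ℝ)).add
    (SmoothEntries.smul (contDiff_const (c := ε ^ 2))
      (hV.add (SmoothEntries.smul (contDiff_const (c := ε ^ 2)) hV₂ε)))
  have hjet := jetMatrix_deformation hΓ hdet (contDiff_slice hR ε) (hFR ε)
  have hgauge := curveU_gauge hΓ hdet (contDiff_slice hF ε) hε hPs hjet x
  rw [matrixDeriv_one_add hV hV₂ε] at hgauge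
  refine gauge_expansion hgauge ?_
  rw [← Matrix.mul_assoc, ← hjet, Matrix.mul_adjugate, hε, one_smul]

end Evolution

/-! ### Uniqueness of the pentagram lift. -/

section Uniqueness

variable {d : ℕ} {Γ : ℝ → Vec d}

theorem IsPentagramCurve.unique {ε : ℝ} {γ γ₁ γ₂ : ℝ → ℙ ℝ (Vec d)}
    (h₁ : IsPentagramCurve ε γ γ₁) (h₂ : IsPentagramCurve ε γ γ₂) : γ₁ = γ₂ := by
  funext x
  exact Projectivization.submodule_injective ((h₁ x).2.symm.trans (h₂ x).2)

theorem IsNormalizedLift.eq_or_eq_neg {γ : ℝ → ℙ ℝ (Vec d)} {F G : ℝ → Vec d}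
    (hF : IsNormalizedLift γ F) (hG : IsNormalizedLift γ G) :
    (∀ x, F x = G x) ∨ ∀ x, F x = -G x := by
  obtain ⟨hFs, hFd, hFl⟩ := hF
  obtain ⟨hGs, hGd, hGl⟩ := hG
  have hprop : ∀ x, ∃ c : ℝ, F x = c • G x := by
    intro x
    obtain ⟨h1, h2⟩ := hFl x
    obtain ⟨h3, h4⟩ := hGl x
    rw [h2, Projectivization.mk_eq_mk_iff'] at h4
    obtain ⟨a, ha⟩ := h4
    exact ⟨a, ha.symm⟩
  choose l hl using hprop
  obtain ⟨c, hc, hc'⟩ := exists_const_ratio hFs hGs (fun x => (hGl x).1) one_ne_zero hFd hGd hl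
  rw [mul_one] at hc
  have habs : |c| = 1 := by
    rw [← abs_pow_eq_one c (Nat.succ_ne_zero d), hc, abs_one]
  rcases eq_or_eq_neg_of_abs_eq habs with rfl | rfl
  · exact Or.inl fun x => by rw [hc', one_smul]
  · exact Or.inr fun x => by rw [hc', neg_one_smul]

/-- The pentagram lift is determined for small `ε`. -/
theorem IsPentagramLift.eventually_eq {γ : ℝ → ℙ ℝ (Vec d)} {F G : ℝ → ℝ → Vec d}
    (hΓ : Γ 0 ≠ 0) (hF : IsPentagramLift γ Γ F) (hG : IsPentagramLift γ Γ G) :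
    ∀ᶠ ε in 𝓝[>] (0 : ℝ), F ε = G ε := by
  -- At the single point `0` the sum tends to `2 Γ(0) ≠ 0`, which excludes opposite signs on the
  -- whole line.
  have hsum := (hF.2 0).add (hG.2 0)
  have hne : Γ 0 + Γ 0 ≠ 0 := by
    rw [← two_smul ℝ]; exact smul_ne_zero two_ne_zero hΓ
  filter_upwards [hF.1, hG.1, hsum.eventually_ne hne] with ε h1 h2 h3
  obtain ⟨γ₁, h4, h5⟩ := h1
  obtain ⟨γ₂, h6, h7⟩ := h2
  obtain rfl := IsPentagramCurve.unique h4 h6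
  rcases IsNormalizedLift.eq_or_eq_neg h5 h7 with h | h
  · exact funext h
  · exact absurd (by rw [h, neg_add_cancel]) h3

end Uniqueness

/-! ### The limit of the discrete Lax equation -/

section Limit

variable {d : ℕ} {Γ : ℝ → Vec d}

/-- The evolution of the operator under the deformation, in its zero curvature form. -/
theorem exists_operatorCoeff_expansion (hΓ : ContDiff ℝ ∞ Γ)
    (hdet : ∀ x, (jetMatrix d Γ x).det = 1) {c : ℝ} {F R : ℝ × ℝ → Vec d} (hF : ContDiff ℝ ∞ F)
    (hR : ContDiff ℝ ∞ R)
    (hFR : ∀ ε x, F (ε, x) = Γ x + ε ^ 2 • (c • applyQ2 d Γ x + ε ^ 2 • R (ε, x)))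
    (hFdet : ∀ᶠ ε in 𝓝[≠] (0 : ℝ), ∀ x, (jetMatrix d (fun y => F (ε, y)) x).det = 1) :
    ∃ w : Fin d → ℝ → ℝ,
      (∀ x, companionVelocity d (fun k => w k x) =
        curveV d c Γ x * curveU d Γ x - curveU d Γ x * curveV d c Γ x +
          matrixDeriv (curveV d c Γ) x) ∧
      ∀ k x, (fun ε : ℝ => operatorCoeff d (fun y => F (ε, y)) k x -
        (operatorCoeff d Γ k x + ε ^ 2 * w k x)) =O[𝓝[>] (0 : ℝ)] fun ε => ε ^ 4 := by
  set K : ℝ → Matrix (Fin (d + 1)) (Fin (d + 1)) ℝ := fun x =>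
    curveV d c Γ x * curveU d Γ x - curveU d Γ x * curveV d c Γ x + matrixDeriv (curveV d c Γ) x
  have hex : ∀ x, ∃ M : ℝ → Matrix (Fin (d + 1)) (Fin (d + 1)) ℝ, SmoothEntries M ∧
      ∀ᶠ ε in 𝓝[≠] (0 : ℝ), curveU d (fun y => F (ε, y)) x - curveU d Γ x =
        ε ^ 2 • (K x + ε ^ 2 • M ε) := exists_curveU_expansion hΓ hdet hF hR hFR hFdet
  choose M hM hKM using hex
  -- Where a companion matrix has fixed entries, `U_ε - U` vanishes for all small `ε ≠ 0`, hence so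
  -- does its `ε²` coefficient. Thus `[V, U] + V'` has the shape of `companionVelocity`.
  have hzero : ∀ x i j, (∀ u v, companion d u i j = companion d v i j) → K x i j = 0 := by
    intro x i j hij
    have hc : Continuous fun ε : ℝ => K x i j + ε ^ 2 * M x ε i j :=
      continuous_const.add ((continuous_pow 2).mul (hM x i j).continuous)
    have := eq_of_eventuallyEq_nhdsNE hc (continuous_const (y := (0 : ℝ))) ?_
    · simpa using this
    · filter_upwards [hKM x, self_mem_nhdsWithin] with ε hε hε0
      have h1 := congrFun (congrFun hε i) j
      rw [Matrix.sub_apply, curveU, curveU, hij _ (fun k => operatorCoeff d Γ k x), sub_self] at h1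
      exact (mul_eq_zero.1 h1.symm).resolve_left (pow_ne_zero 2 hε0)
  refine ⟨fun k x => -K x (Fin.last d) k.castSucc, fun x => ?_, fun k x => ?_⟩
  · change _ = K x
    ext i j
    by_cases hi : (i : ℕ) < d
    · simp only [companionVelocity, Matrix.of_apply, hi, if_true]
      exact (hzero x i j fun u v => by simp [companion, hi]).symm
    · by_cases hj : (j : ℕ) < d
      · obtain rfl : i = Fin.last d := Fin.ext (by simp only [Fin.val_last]; omega)
        simp only [companionVelocity, Matrix.of_apply, hi, hj, if_false, dif_pos, neg_neg]
        rfl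
      · simp only [companionVelocity, Matrix.of_apply, hi, hj, if_false, dif_neg,
          not_false_eq_true]
        exact (hzero x i j fun u v => by simp [companion, hi, hj]).symm
  · refine isBigO_pow_of_eventually (g := fun ε => -M x ε (Fin.last d) k.castSucc)
      (hM x _ _).continuous.neg 4 ?_
    filter_upwards [(hKM x).filter_mono (nhdsGT_le_nhdsNE 0)] with ε hε
    have h1 := congrFun (congrFun hε (Fin.last d)) k.castSucc
    simp only [Matrix.sub_apply, Matrix.smul_apply, Matrix.add_apply, curveU, companion,
      Matrix.of_apply, Fin.val_last, lt_irrefl, if_false, Fin.val_castSucc, k.2, dif_pos,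
      Fin.eta, smul_eq_mul] at h1
    rw [smul_eq_mul]
    linear_combination -h1

theorem conjD_laxL {ε x : ℝ} {S S' : ℝ → Matrix (Fin (d + 1)) (Fin (d + 1)) ℝ}
    (hS : ∀ y, changeOfBasis d ε * sampleMatrix d ε Γ y = S y) (hSS' : S x * S' x = 1) :
    conjD d ε (laxL d ε Γ x) = S (x + ε) * S' x := by
  rw [laxL_eq (isUnit_sampleMatrix (hS x) hSS'), conjD_mul_inv, hS, hS,
    Matrix.inv_eq_right_inv hSS']

theorem conjD_gauge {ε : ℝ} (hε : ε ≠ 0) (P L Q : Matrix (Fin (d + 1)) (Fin (d + 1)) ℝ) :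
    conjD d ε P * conjD d ε L * (conjD d ε Q)⁻¹ = conjD d ε (P * L * Q⁻¹) := by
  have hu : IsUnit (changeOfBasis d ε).det := isUnit_iff_ne_zero.2 (det_changeOfBasis_ne_zero hε)
  simp only [conjD, Matrix.mul_inv_rev, Matrix.nonsing_inv_nonsing_inv _ hu, Matrix.mul_assoc,
    Matrix.nonsing_inv_mul_cancel_left _ _ hu]

/-- The expansion `D_ε L D_ε⁻¹ = 1 + ε U + O(ε²)`. -/
theorem isBigO_conjD_laxL {S S' A : ℝ × ℝ → Matrix (Fin (d + 1)) (Fin (d + 1)) ℝ}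
    (hSD : ∀ ε x, ε ≠ 0 → changeOfBasis d ε * sampleMatrix d ε Γ x = S (ε, x))
    (hSS' : ∀ᶠ ε in 𝓝 (0 : ℝ), ∀ x, S (ε, x) * S' (ε, x) = 1)
    (hA : SmoothEntries A) (hA0 : ∀ x, A (0, x) = curveU d Γ x)
    (hSA : ∀ᶠ ε in 𝓝 (0 : ℝ), ∀ x, S (ε, x + ε) * S' (ε, x) = 1 + ε • A (ε, x))
    (x : ℝ) (i j : Fin (d + 1)) :
    (fun ε : ℝ => (conjD d ε (laxL d ε Γ x) - (1 + ε • curveU d Γ x)) i j)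
      =O[𝓝[>] (0 : ℝ)] fun ε => ε ^ 2 := by
  obtain ⟨N, hN, hAN⟩ := hA.exists_hadamard
  refine isBigO_pow_of_eventually (g := fun ε => N (ε, x) i j)
    (hN.comp (g := fun ε : ℝ => (ε, x)) (by fun_prop) i j).continuous 2 ?_
  filter_upwards [hSS'.filter_mono nhdsWithin_le_nhds, hSA.filter_mono nhdsWithin_le_nhds,
    self_mem_nhdsWithin] with ε h1 h2 hε
  rw [conjD_laxL (S := fun y => S (ε, y)) (S' := fun y => S' (ε, y))
    (fun y => hSD ε y (ne_of_gt hε)) (h1 x), h2, hAN, hA0]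
  simp only [Matrix.sub_apply, Matrix.add_apply, Matrix.smul_apply, smul_eq_mul]
  ring

theorem sampleMatrix_add_smul (ε a : ℝ) (f g : ℝ → Vec d) (x : ℝ) :
    sampleMatrix d ε (fun y => f y + a • g y) x = sampleMatrix d ε f x + a • sampleMatrix d ε g x :=
  rfl

theorem isPentagramLift_family (hd : 1 ≤ d) {γ : ℝ → ℙ ℝ (Vec d)} (h : IsNormalizedLift γ Γ)
    {F : ℝ × ℝ → Vec d} (hF : ContDiff ℝ ∞ F) (hF0 : ∀ x, F (0, x) = Γ x)
    (hFdet : ∀ᶠ ε in 𝓝[≠] (0 : ℝ), ∀ x, (jetMatrix d (fun y => F (ε, y)) x).det = 1)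
    (hspan : ∀ᶠ ε in 𝓝[≠] (0 : ℝ), ∀ x,
      (∀ k, Module.finrank ℝ
        (⨆ l, Submodule.span ℝ {Γ (x + node d k l * ε)} : Submodule ℝ (Vec d)) = d) ∧
      (⨅ k, ⨆ l, Submodule.span ℝ {Γ (x + node d k l * ε)}) = Submodule.span ℝ {F (ε, x)}) :
    IsPentagramLift γ Γ fun ε x => F (ε, x) := by
  refine ⟨?_, fun x => ?_⟩
  · filter_upwards [hFdet.filter_mono (nhdsGT_le_nhdsNE 0),
      hspan.filter_mono (nhdsGT_le_nhdsNE 0)] with ε h1 h2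
    have hne : ∀ x, F (ε, x) ≠ 0 := fun x =>
      ne_zero_of_det_jetMatrix (Γ := fun y => F (ε, y)) (by rw [h1]; exact one_ne_zero)
    exact ⟨_, isPentagramCurve_of_span hd h.2.2 hne h2, contDiff_slice hF ε, h1,
      fun x => ⟨hne x, rfl⟩⟩
  · have hc : Continuous fun ε : ℝ => F (ε, x) := hF.continuous.comp (by fun_prop)
    have := (hc.tendsto 0).mono_left (nhdsWithin_le_nhds (s := Set.Ioi 0))
    rwa [hF0] at this

end Limit

theorem theorem4p2 (d : ℕ) (hd : 1 ≤ d) :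
    ∃ c : ℝ, c ≠ 0 ∧
      ∀ (γ : ℝ → ℙ ℝ (Vec d)) (Γ : ℝ → Vec d), HasMonodromy γ → IsNormalizedLift γ Γ →
        -- the operator `L` of the curve, and the Lax matrix is well defined for small `ε`
        IsOperatorOf (operatorCoeff d Γ) Γ ∧
        (∀ᶠ ε in 𝓝[>] (0 : ℝ), ∀ x, IsUnit (sampleMatrix d ε Γ x).det) ∧
        -- kinematics: `D_ε L̃₀₀ D_ε⁻¹ = I + ε U + O(ε²)`
        (∀ x i j, (fun ε : ℝ =>
            (conjD d ε (laxL d ε Γ x) - (1 + ε • curveU d Γ x)) i j)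
              =O[𝓝[>] (0 : ℝ)] fun ε => ε ^ 2) ∧
        -- the pentagram map is defined on the discretized curve for small `ε`
        (∃ Γt : ℝ → ℝ → Vec d, IsPentagramLift γ Γ Γt) ∧
        -- dynamics
        ∀ Γt : ℝ → ℝ → Vec d, IsPentagramLift γ Γ Γt →
          (∀ᶠ ε in 𝓝[>] (0 : ℝ), IsOperatorOf (operatorCoeff d (Γt ε)) (Γt ε)) ∧
          (∀ᶠ ε in 𝓝[>] (0 : ℝ), ∀ x, IsUnit (sampleMatrix d ε (Γt ε) x).det) ∧
          -- `c` is the constant in `Γ̃_ε = Γ + ε² c Q₂ Γ + O(ε⁴)`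
          (∀ x, (fun ε : ℝ => Γt ε x - (Γ x + (ε ^ 2 * c) • applyQ2 d Γ x))
              =O[𝓝[>] (0 : ℝ)] fun ε => ε ^ 4) ∧
          -- the discrete Lax equation `L̃₀₁ = P̃₁₀ L̃₀₀ P̃₀₀⁻¹`
          (∀ᶠ ε in 𝓝[>] (0 : ℝ), ∀ x,
            laxL d ε (Γt ε) x =
              laxP d ε Γ (Γt ε) (x + ε) * laxL d ε Γ x * (laxP d ε Γ (Γt ε) x)⁻¹) ∧
          (∀ i j, ContDiff ℝ ∞ fun x => curveV d c Γ x i j) ∧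
          ∃ w : Fin d → ℝ → ℝ,
            -- the evolution `du_k/dt = w_k`, with `ε²` as time
            (∀ k x, (fun ε : ℝ =>
                operatorCoeff d (Γt ε) k x - (operatorCoeff d Γ k x + ε ^ 2 * w k x))
                  =O[𝓝[>] (0 : ℝ)] fun ε => ε ^ 4) ∧
            ∀ x,
              -- the left side of the rescaled Lax equation tends to `dU/dt`
              Tendsto (fun ε : ℝ => (ε ^ 3)⁻¹ •
                  (conjD d ε (laxL d ε (Γt ε) x) - conjD d ε (laxL d ε Γ x)))
                (𝓝[>] 0) (𝓝 (companionVelocity d fun k => w k x)) ∧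
              -- the right side of the rescaled Lax equation tends to `[V, U] + dV/dx`
              Tendsto (fun ε : ℝ => (ε ^ 3)⁻¹ •
                  (conjD d ε (laxP d ε Γ (Γt ε) (x + ε)) * conjD d ε (laxL d ε Γ x) *
                    (conjD d ε (laxP d ε Γ (Γt ε) x))⁻¹ - conjD d ε (laxL d ε Γ x)))
                (𝓝[>] 0)
                (𝓝 (curveV d c Γ x * curveU d Γ x - curveU d Γ x * curveV d c Γ x +
                  matrixDeriv (curveV d c Γ) x)) ∧
              -- the zero-curvature equation `dU/dt = [V, U] + dV/dx`
              companionVelocity d (fun k => w k x) =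
                curveV d c Γ x * curveU d Γ x - curveU d Γ x * curveV d c Γ x +
                  matrixDeriv (curveV d c Γ) x := by

  refine ⟨pentagramConst d, pentagramConst_ne_zero, fun γ Γ hγ hlift => ?_⟩
  obtain ⟨B, hB1, hB⟩ := IsNormalizedLift.exists_monodromy hγ hlift
  obtain ⟨hΓ, hdet, hl⟩ := id hlift
  obtain ⟨F, R, hF, hR, hFR, hFB, hFdet, hspan⟩ :=
    exists_normalized_family hd hΓ hdet Real.two_pi_pos hB1 hB
  have hF0 : (fun y => F (0, y)) = Γ := by funext y; simp [hFR]
  have hQ : ContDiff ℝ ∞ (applyQ2 d Γ) := contDiff_applyQ2 hΓ hdet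
  have hFpent := isPentagramLift_family hd hlift hF (congrFun hF0) hFdet hspan
  obtain ⟨S, S', hS, hS', hSD, hS0, hS'0, hSS'⟩ := exists_sample_extension_inv
    (F := fun q => Γ q.2) (hΓ.comp contDiff_snd) Real.two_pi_pos hB1 (fun _ => hB) hdet
  obtain ⟨W, W', hW, hW', hWD, hW0, hW'0, hWW'⟩ := exists_sample_extension_inv
    hF Real.two_pi_pos hB1 hFB (by rw [hF0]; exact hdet)
  -- This family is `(F - Γ) / ε²`; by linearity of sampling its difference quotients are `(W - S) /
  -- ε²`.
  obtain ⟨S₁, hS₁, hS₁D, hS₁0⟩ := exists_sample_extension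
    (F := fun q => pentagramConst d • applyQ2 d Γ q.2 + q.1 ^ 2 • R q)
    (((hQ.comp contDiff_snd).const_smul _).add ((contDiff_fst.pow 2).smul hR))
  obtain ⟨A, hA, hA0, hSA⟩ := exists_lax_extension hΓ hdet hS hS' hS0 hS'0 hSS'
  have hWS : ∀ ε x, ε ≠ 0 → W (ε, x) = S (ε, x) + ε ^ 2 • S₁ (ε, x) := by
    intro ε x hε
    rw [← hWD ε x hε, ← hSD ε x hε, ← hS₁D ε x hε, ← Matrix.mul_smul, ← Matrix.mul_add,
      ← sampleMatrix_add_smul]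
    simp only [hFR]
  have hW0S : ∀ x, W (0, x) = S (0, x) := fun x => by rw [hW0, hS0, hF0]
  have hV : (fun y => S₁ (0, y) * S' (0, y)) = curveV d (pentagramConst d) Γ := by
    funext y
    rw [hS₁0, hS'0]
    have : (fun y => pentagramConst d • applyQ2 d Γ y + (0 : ℝ) ^ 2 • R (0, y)) =
        fun y => pentagramConst d • applyQ2 d Γ y := by funext y; simp
    rw [this, jetMatrix_const_smul, Matrix.smul_mul, curveV]
  have hlim := tendsto_gauge_quotient hS hS' hW' hS₁ hSS' hWW' hW0S hWS hA hSA
  rw [hV] at hlim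
  simp only [congrFun hV, hA0] at hlim
  have hSS'pos := hSS'.filter_mono (nhdsWithin_le_nhds (s := Set.Ioi 0))
  have hWW'pos := hWW'.filter_mono (nhdsWithin_le_nhds (s := Set.Ioi 0))
  have hunit : ∀ᶠ ε in 𝓝[>] (0 : ℝ), ∀ x, IsUnit (sampleMatrix d ε Γ x).det := by
    filter_upwards [hSS'pos, self_mem_nhdsWithin] with ε h hε x
    exact isUnit_sampleMatrix (hSD ε x (ne_of_gt hε)) (h x)
  refine ⟨isOperatorOf_operatorCoeff hΓ hdet hB1 hB, hunit,
    isBigO_conjD_laxL hSD hSS' hA hA0 hSA, ⟨_, hFpent⟩, fun Γt hΓt => ?_⟩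
  -- An arbitrary lift coincides with the constructed family for small `ε`, so only the latter needs
  -- expanding.
  have hΓtF : ∀ᶠ ε in 𝓝[>] (0 : ℝ), Γt ε = fun y => F (ε, y) :=
    IsPentagramLift.eventually_eq (hl 0).1 hΓt hFpent
  have hunit' : ∀ᶠ ε in 𝓝[>] (0 : ℝ), ∀ x, IsUnit (sampleMatrix d ε (Γt ε) x).det := by
    filter_upwards [hWW'pos, hΓtF, self_mem_nhdsWithin] with ε h h' hε x
    rw [h']
    exact isUnit_sampleMatrix (hWD ε x (ne_of_gt hε)) (h x)
  have hlax : ∀ᶠ ε in 𝓝[>] (0 : ℝ), ∀ x, laxL d ε (Γt ε) x =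
      laxP d ε Γ (Γt ε) (x + ε) * laxL d ε Γ x * (laxP d ε Γ (Γt ε) x)⁻¹ := by
    filter_upwards [hunit, hunit'] with ε h h' x using laxL_eq_laxP_mul h h'
  obtain ⟨w, hwK, hw⟩ := exists_operatorCoeff_expansion hΓ hdet hF hR hFR hFdet
  have hleft : ∀ x, Tendsto (fun ε : ℝ => (ε ^ 3)⁻¹ •
      (conjD d ε (laxL d ε (Γt ε) x) - conjD d ε (laxL d ε Γ x))) (𝓝[>] 0)
      (𝓝 (companionVelocity d fun k => w k x)) := by
    intro x
    rw [hwK]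
    refine (hlim x).congr' ?_
    filter_upwards [hSS'pos, hWW'pos, hΓtF, self_mem_nhdsWithin] with ε h h' h'' hε
    rw [h'', conjD_laxL (S := fun y => S (ε, y)) (S' := fun y => S' (ε, y))
      (fun y => hSD ε y (ne_of_gt hε)) (h x), conjD_laxL (S := fun y => W (ε, y))
        (S' := fun y => W' (ε, y)) (fun y => hWD ε y (ne_of_gt hε)) (h' x)]
  refine ⟨?_, hunit', fun x => ?_, hlax, smoothEntries_curveV _ hΓ hdet, w, fun k x => ?_,
    fun x => ⟨hleft x, ?_, hwK x⟩⟩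
  · filter_upwards [hΓtF, hFdet.filter_mono (nhdsGT_le_nhdsNE 0)] with ε h h'
    rw [h]
    exact isOperatorOf_operatorCoeff (contDiff_slice hF ε) h' hB1 (hFB ε)
  · refine isBigO_pow_of_eventually (g := fun ε => R (ε, x))
      (hR.continuous.comp (by fun_prop)) 4 ?_
    filter_upwards [hΓtF] with ε h
    rw [h]
    simp only [hFR]
    module
  · refine (hw k x).congr' ?_ EventuallyEq.rfl
    filter_upwards [hΓtF] with ε h
    rw [h]
  -- By the exact discrete Lax equation the two rescaled expressions coincide for small `ε`, so this
  -- limit is the previous one.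
  · rw [← hwK]
    refine (hleft x).congr' ?_
    filter_upwards [hlax, self_mem_nhdsWithin] with ε h hε
    rw [conjD_gauge (ne_of_gt hε), ← h]
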